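/- On $\mathbb R^4$ with coordinates $(x_1,x_2,y_1,y_2)$ and the standard symplectic form, put $I_j=\frac12(x_j^2+y_j^2)$, $\xi_j=\frac1{\sqrt2}(x_j+iy_j)$, $\eta_j=\frac1{\sqrt2}(x_j-iy_j)$ for $j=1,2$. Let $\omega=(\omega_1,\omega_2)\in\mathbb R^2$ have rationally independent coordinates, with $\omega_1\omega_2<0$ and $|\omega_2|=\theta|\omega_1|$ for some $\theta>1$, and fix $\varepsilon\in(0,\frac1{100})$ with $1+2\varepsilon<\theta$. Let $(k_n,l_n)_{n\in\mathbb N}$ be a sequence in $\mathbb N^2$, put $\hat k_n=\lfloor(1+\varepsilon)l_n\rfloor$, and suppose that for all $n\in\mathbb N=\{0,1,2,\dots\}$ $$|k_n\omega_1+l_n\omega_2|<\frac1{k_n},\qquad k_n\ge 10e^{e^n},\qquad k_{n+1}+l_{n+1}>2k_n+2\hat k_n .$$ For $\zeta=(\zeta_n)_{n\in\mathbb N}\in[0,1]^{\mathbb N}$ let $$H=(\omega_1+I_2)I_1+\omega_2I_2+\sum_{n\in\mathbb N}\zeta_n a_n\bigl(\xi_1^{k_n}\xi_2^{l_n}+\eta_1^{k_n}\eta_2^{l_n}\bigr),\qquad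 a_n=e^{-n(k_n+l_n)}.$$ A Birkhoff normal form (BNF) of $H$ at the origin is a formal power series $B(I_1,I_2)$ with real coefficients such that $H\circ\Phi(x,y)=B(I)$ for some formal symplectic transformation $\Phi=\mathrm{Id}+O^2(x,y)$, where $O^2(x,y)$ stands for formal power series without constant and linear terms, and where $H$ is identified with its Taylor series at the origin. Then $H$ has a BNF at the origin, it is unique, and for every $n\in\mathbb N$ the coefficient $\Gamma_n$ of $I_1^{k_n-1}I_2^{\hat k_n}$ in it is $$\Gamma_n=\zeta_n^2\gamma_n+\zeta_nP_n(\zeta_0,\dots,\zeta_{n-1})+Q_n(\zeta_0,\dots,\zeta_{n-1}),$$ where $P_n,Q_n$ are polynomials with real coefficients that depend only on $\omega$, $\varepsilon$, $n$ and the $(k_j,l_j)$ with $j\le n$ (and not on $\zeta$), and $$\gamma_n=(-1)^{\hat k_n-l_n+1}\,a_n^2\,k_n\left(\frac{k_n}{k_n\omega_1+l_n\omega_2}\right)^{\hat k_n-l_n+1}.$$ Moreover there is $N\in\mathbb N$, depending only on $\omega$ and $\varepsilon$, such that $|\gamma_n|\ge e^{nk_n}$ for all $n\ge N$ and all such sequences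 $(k_n,l_n)$. -/

import Mathlib

noncomputable section

namespace BirkhoffNF

/-- Index set of the canonical coordinates `(x₁,…,x_d,y₁,…,y_d)` of `ℝ^{2d}`: `Sum.inl j` is the
index of `x_j`, and `Sum.inr j` is the index of `y_j`. -/
abbrev Coord (d : ℕ) : Type := Fin d ⊕ Fin d

/-! ### Formal Birkhoff normal forms -/

/-- `p` is the Taylor series at `0` of the function `f`, which is real analytic near `0`: at every
point `z` close to `0`, the power series converges absolutely with sum `f z`. -/
def HasTaylorSeriesAtZero {σ : Type} [Fintype σ] (f : (σ → ℝ) → ℝ) (p : MvPowerSeries σ ℝ) :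
    Prop :=
  ∀ᶠ z in nhds (0 : σ → ℝ),
    HasSum (fun m : σ →₀ ℕ => MvPowerSeries.coeff m p * m.prod (fun s e => z s ^ e)) (f z)

/-- The Poisson bracket `{F,G} = ∑_j (∂F/∂x_j ∂G/∂y_j - ∂F/∂y_j ∂G/∂x_j)` of formal series. -/
def poisson {d : ℕ} (F G : MvPowerSeries (Coord d) ℝ) : MvPowerSeries (Coord d) ℝ :=
  ∑ j : Fin d,
    (MvPowerSeries.pderiv ℝ (Sum.inl j) F * MvPowerSeries.pderiv ℝ (Sum.inr j) G
      - MvPowerSeries.pderiv ℝ (Sum.inr j) F * MvPowerSeries.pderiv ℝ (Sum.inl j) G)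

/-- The formal map with components `Φ s` is symplectic: its components satisfy the canonical
commutation relations. (A formal symplectic map fixing the origin is automatically exact, by the
formal Poincaré lemma.) -/
def IsFormalSymplectic {d : ℕ} (Φ : Coord d → MvPowerSeries (Coord d) ℝ) : Prop :=
  ∀ s t : Coord d, poisson (Φ s) (Φ t) = poisson (MvPowerSeries.X s) (MvPowerSeries.X t)

/-- `Φ = Id + O²(x,y)`: the components of `Φ - Id` have no terms of degree `0` or `1`. -/
def IsTangentToId {d : ℕ} (Φ : Coord d → MvPowerSeries (Coord d) ℝ) : Prop :=
  ∀ (s : Coord d) (m : Coord d →₀ ℕ), m.degree ≤ 1 →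
    MvPowerSeries.coeff m (Φ s - MvPowerSeries.X s) = 0

/-- The action variable `I_j = (x_j² + y_j²)/2` as a formal power series in `(x,y)`. -/
def formalAction {d : ℕ} (j : Fin d) : MvPowerSeries (Coord d) ℝ :=
  MvPowerSeries.C (1 / 2 : ℝ) *
    (MvPowerSeries.X (Sum.inl j) ^ 2 + MvPowerSeries.X (Sum.inr j) ^ 2)

/-- The formal power series `B` in the actions is a Birkhoff normal form of `H` at the origin:
there is a formal symplectic map `Φ = Id + O²(x,y)` with `H ∘ Φ (x,y) = B(I)` as formal series. -/
def IsBNF {d : ℕ} (H : (Coord d → ℝ) → ℝ) (B : MvPowerSeries (Fin d) ℝ) : Prop :=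
  ∃ h : MvPowerSeries (Coord d) ℝ, HasTaylorSeriesAtZero H h ∧
    ∃ Φ : Coord d → MvPowerSeries (Coord d) ℝ,
      IsFormalSymplectic Φ ∧ IsTangentToId Φ ∧
        MvPowerSeries.subst Φ h = MvPowerSeries.subst (formalAction (d := d)) B

/-! Both substitutions above are legitimate ones (not junk values). -/

theorem IsTangentToId.hasSubst {d : ℕ} {Φ : Coord d → MvPowerSeries (Coord d) ℝ}
    (hΦ : IsTangentToId Φ) : MvPowerSeries.HasSubst Φ := by
  apply MvPowerSeries.hasSubst_of_constantCoeff_zero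
  intro s
  have h := hΦ s 0 (by simp)
  simpa using h

theorem hasSubst_formalAction (d : ℕ) :
    MvPowerSeries.HasSubst (formalAction (d := d)) := by
  apply MvPowerSeries.hasSubst_of_constantCoeff_zero
  intro s
  simp [formalAction]

/-! ### The Hamiltonians on `ℝ⁴` -/

/-- The action `I_j = (x_j² + y_j²)/2`. -/
def action {d : ℕ} (j : Fin d) (z : Coord d → ℝ) : ℝ :=
  (z (Sum.inl j) ^ 2 + z (Sum.inr j) ^ 2) / 2

/-- `ξ_j = (x_j + i y_j)/√2`. -/
def xi {d : ℕ} (j : Fin d) (z : Coord d → ℝ) : ℂ :=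
  ((z (Sum.inl j) : ℂ) + Complex.I * (z (Sum.inr j) : ℂ)) / (Real.sqrt 2 : ℂ)

/-- `η_j = (x_j - i y_j)/√2`. -/
def eta {d : ℕ} (j : Fin d) (z : Coord d → ℝ) : ℂ :=
  ((z (Sum.inl j) : ℂ) - Complex.I * (z (Sum.inr j) : ℂ)) / (Real.sqrt 2 : ℂ)

/-- `a_n = e^{-n(k_n+l_n)}`. -/
def amp (k l : ℕ → ℕ) (n : ℕ) : ℝ := Real.exp (-((n : ℝ) * ((k n : ℝ) + (l n : ℝ))))

/-- `F̃_n = a_n (ξ₁^{k_n} ξ₂^{l_n} + η₁^{k_n} η₂^{l_n})`. The bracket is a real number (see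
`ofReal_Ftilde`), and `Complex.re` serves only to read it as an element of `ℝ`. -/
def Ftilde (k l : ℕ → ℕ) (n : ℕ) (z : Coord 2 → ℝ) : ℝ :=
  amp k l n * (xi 0 z ^ k n * xi 1 z ^ l n + eta 0 z ^ k n * eta 1 z ^ l n).re

/-- `H = (ω₁ + I₂) I₁ + ω₂ I₂ + ∑_n ζ_n F̃_n`. -/
def Ham (ω₁ ω₂ : ℝ) (k l : ℕ → ℕ) (ζ : ℕ → ℝ) (z : Coord 2 → ℝ) : ℝ :=
  (ω₁ + action 1 z) * action 0 z + ω₂ * action 1 z + ∑' n, ζ n * Ftilde k l n z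

theorem conj_xi {d : ℕ} (j : Fin d) (z : Coord d → ℝ) :
    (starRingEnd ℂ) (xi j z) = eta j z := by
  simp [xi, eta, sub_eq_add_neg]

theorem xi_mul_eta {d : ℕ} (j : Fin d) (z : Coord d → ℝ) :
    xi j z * eta j z = (action j z : ℂ) := by
  have h : (Real.sqrt 2 : ℂ) * (Real.sqrt 2 : ℂ) = 2 := by
    rw [← Complex.ofReal_mul, Real.mul_self_sqrt (by norm_num)]; norm_num
  unfold xi eta action
  rw [div_mul_div_comm, h]
  push_cast
  congr 1
  linear_combination (-(z (Sum.inr j) : ℂ) ^ 2) * Complex.I_sq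

theorem ofReal_Ftilde (k l : ℕ → ℕ) (n : ℕ) (z : Coord 2 → ℝ) :
    (Ftilde k l n z : ℂ) =
      amp k l n * (xi 0 z ^ k n * xi 1 z ^ l n + eta 0 z ^ k n * eta 1 z ^ l n) := by
  have h : (starRingEnd ℂ) (xi 0 z ^ k n * xi 1 z ^ l n + eta 0 z ^ k n * eta 1 z ^ l n)
      = xi 0 z ^ k n * xi 1 z ^ l n + eta 0 z ^ k n * eta 1 z ^ l n := by
    simp only [← conj_xi, map_add, map_mul, map_pow, Complex.conj_conj]
    ring
  rw [Ftilde, Complex.ofReal_mul, Complex.conj_eq_iff_re.mp h]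

/-- `k̂_n = [(1+ε) l_n]`. -/
def hatk (ε : ℝ) (l : ℕ → ℕ) (n : ℕ) : ℕ := ⌊(1 + ε) * (l n : ℝ)⌋₊

/-- The sequences `(k_n, l_n)` in `ℕ²` that are used: `k_n ω₁ + l_n ω₂` is smaller than `1/k_n`,
and `k_n` grows fast, both absolutely and relative to the preceding terms. -/
structure IsAdmissible (ω₁ ω₂ ε : ℝ) (k l : ℕ → ℕ) : Prop where
  small : ∀ n, |(k n : ℝ) * ω₁ + (l n : ℝ) * ω₂| < 1 / (k n : ℝ)
  large : ∀ n : ℕ, 10 * Real.exp (Real.exp (n : ℝ)) ≤ (k n : ℝ)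
  sparse : ∀ n, 2 * k n + 2 * hatk ε l n < k (n + 1) + l (n + 1)

/-- `γ_n = (-1)^{k̂_n-l_n+1} a_n² k_n (k_n / (k_n ω₁ + l_n ω₂))^{k̂_n-l_n+1}`; for `ε ≥ 0` one has
`l_n ≤ k̂_n`, so the subtraction is not truncated. -/
def gam (ω₁ ω₂ ε : ℝ) (k l : ℕ → ℕ) (n : ℕ) : ℝ :=
  (-1) ^ (hatk ε l n - l n + 1) * amp k l n ^ 2 * (k n : ℝ) *
    ((k n : ℝ) / ((k n : ℝ) * ω₁ + (l n : ℝ) * ω₂)) ^ (hatk ε l n - l n + 1)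

theorem le_hatk {ε : ℝ} (hε : 0 ≤ ε) (l : ℕ → ℕ) (n : ℕ) : l n ≤ hatk ε l n := by
  apply Nat.le_floor
  nlinarith [(Nat.cast_nonneg (l n) : (0 : ℝ) ≤ (l n : ℝ))]

end BirkhoffNF

end

/-! In the variables `(ξ, η)` the bracket with the quadratic part `∑ ω_j ξ_j η_j` is diagonal on
monomials, with eigenvalue `ω · (a - b)` on `ξ^a η^b`. Rational independence makes this vanish only
when `a = b`, that is, on monomials in the actions. Hence a single Lie series `exp (ad χ)` brings
`H` to normal form, where `χ` has order at least 3 and no resonant monomials. Such a `χ` exists and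
is determined degree by degree (`exists_isNormalizing`, `IsNormalizing.sub_mem`), over any
commutative `ℝ`-algebra of coefficients.

Uniqueness of `χ` has three uses. It makes the construction natural in the coefficient ring
(`IsNormalizing.map`): with the `ζ_j` as indeterminates, every coefficient of the normal form is a
polynomial in them. It makes the construction local (`coeff_expAd_fullHam`): by sparsity of the
sequence, terms with index above `n` do not reach `I₁^(k_n-1) I₂^(k̂_n)`. It makes `χ` odd under the
exchange of `ξ` and `η` (`IsNormalizing.swapVars_eq`), so the transformation is real in `(x,y)`. The
normal form itself is unique because a symplectic map tangent to the identity between two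
nonresonant normal forms fixes the actions (`fix_act`).

The shape of `Γ_n` comes from a weight count. Give `ζ_j` the weight `k_j - 2`. In `H` without `ω₂
I₂`, and then in `χ` and in the transformed series without `ω₂ I₂`, a monomial of degree `e` in
`(ξ₁,η₁)` has a coefficient of weight at most `e - 2`: a bracket removes at most two powers from
this pair (`pb_mem_filt`). For `I₁^(k_n-1)` the bound is `2(k_n - 2)`, so `ζ_n` occurs at most
squared, and its square occurs alone (`exists_coeff_expAd_truncHam`).

The factor of `ζ_n²` is found by keeping one perturbation `X F` and working modulo `X³`
(`coeff_two_coeff_expAd`). With `b` the integrable part, `{χ₁,b} = -F`, and the second-order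
resonant part is `{χ₁,F}/2`. Because of the term `I₁ I₂` in `b`, solving for `χ₁` gives a geometric
progression along `ξ₁^k ξ₂^(l+j) η₂^j` with ratio `-k/(kω₁+lω₂)`; its term `j = k̂ - l` produces
`γ_n`.

Finally, `|k_nω₁+l_nω₂| < 1/k_n` makes the base of the power in `γ_n` at least `k_n²` in modulus,
and the exponent is at least `ε l_n`, comparable to `k_n`. As `log k_n ≥ e^n`, this beats `a_n² =
e^(-2n(k_n+l_n))` (`exists_forall_exp_le_abs_gam`). -/

noncomputable section

namespace BirkhoffNF

open MvPowerSeries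

/-! ### The degree filtration of formal power series -/

section OrderIdeal

variable {σ τ K K' : Type*} [CommRing K] [CommRing K']

/-- The ideal of power series without terms of total degree less than `d`. -/
def orderIdeal (σ K : Type*) [CommRing K] (d : ℕ) : Ideal (MvPowerSeries σ K) where
  carrier := {f | ∀ m : σ →₀ ℕ, m.degree < d → coeff m f = 0}
  zero_mem' := by simp
  add_mem' := fun ha hb m hm => by simp [ha m hm, hb m hm]
  smul_mem' := fun c f hf => by
    intro m hm
    classical
    rw [smul_eq_mul, coeff_mul]
    refine Finset.sum_eq_zero fun p hp => ?_
    rw [hf p.2, mul_zero]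
    have := congrArg Finsupp.degree (Finset.HasAntidiagonal.mem_antidiagonal.mp hp)
    rw [map_add] at this
    omega

theorem orderIdeal_anti {d e : ℕ} (h : d ≤ e) : orderIdeal σ K e ≤ orderIdeal σ K d :=
  fun _ hf m hm => hf m (hm.trans_le h)

theorem orderIdeal_zero (f : MvPowerSeries σ K) : f ∈ orderIdeal σ K 0 :=
  fun m hm => absurd hm (Nat.not_lt_zero _)

theorem mul_mem_orderIdeal {a b : ℕ} {f g : MvPowerSeries σ K} (hf : f ∈ orderIdeal σ K a)
    (hg : g ∈ orderIdeal σ K b) : f * g ∈ orderIdeal σ K (a + b) := by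
  classical
  intro m hm
  rw [coeff_mul]
  refine Finset.sum_eq_zero fun p hp => ?_
  have := congrArg Finsupp.degree (Finset.HasAntidiagonal.mem_antidiagonal.mp hp)
  rw [map_add] at this
  by_cases h : p.1.degree < a
  · rw [hf _ h, zero_mul]
  · rw [hg _ (by omega), mul_zero]

theorem smul_mem_orderIdeal {S : Type*} [CommRing S] [Algebra S K] {d : ℕ} (r : S)
    {f : MvPowerSeries σ K}
    (hf : f ∈ orderIdeal σ K d) : r • f ∈ orderIdeal σ K d := fun m hm => by
  rw [show coeff m (r • f) = r • coeff m f from rfl, hf m hm, smul_zero]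

theorem pderiv_mem_orderIdeal {d : ℕ} {f : MvPowerSeries σ K} (hf : f ∈ orderIdeal σ K d)
    (i : σ) : pderiv K i f ∈ orderIdeal σ K (d - 1) := fun m hm => by
  rw [coeff_pderiv, hf, zero_mul]
  rw [map_add, Finsupp.degree_single]
  omega

theorem map_mem_orderIdeal {d : ℕ} {f : MvPowerSeries σ K} (hf : f ∈ orderIdeal σ K d)
    (φ : K →+* K') : MvPowerSeries.map φ f ∈ orderIdeal σ K' d := fun m hm => by
  rw [coeff_map, hf m hm, map_zero]

/-- The filtration is separated. Identities between infinite series are proved below by checking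
them modulo every order, where only finite sums matter. -/
theorem eq_of_sub_mem_orderIdeal {f g : MvPowerSeries σ K}
    (h : ∀ d, f - g ∈ orderIdeal σ K d) : f = g := by
  ext m
  have := h (m.degree + 1) m (Nat.lt_succ_self _)
  rwa [map_sub, sub_eq_zero] at this

theorem sub_truncTotal_mem [Finite σ] (d : ℕ) (f : MvPowerSeries σ K) :
    f - (truncTotal d f : MvPolynomial σ K) ∈ orderIdeal σ K d := fun m hm => by
  rw [map_sub, MvPolynomial.coeff_coe, coeff_truncTotal f hm, sub_self]

theorem mem_orderIdeal_iff_le_order {d : ℕ} {f : MvPowerSeries σ K} :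
    f ∈ orderIdeal σ K d ↔ (d : ℕ∞) ≤ f.order :=
  ⟨fun h => nat_le_order h,
    fun h m hm => coeff_of_lt_order (lt_of_lt_of_le (by exact_mod_cast hm) h)⟩

theorem constantCoeff_eq_zero_of_mem {d : ℕ} (hd : 1 ≤ d) {f : MvPowerSeries σ K}
    (hf : f ∈ orderIdeal σ K d) : constantCoeff f = 0 :=
  hf 0 (by simp; omega)

theorem X_mem_orderIdeal (s : σ) : (X s : MvPowerSeries σ K) ∈ orderIdeal σ K 1 := by
  classical
  intro m hm
  rw [coeff_X, if_neg]
  rintro rfl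
  simp at hm

theorem hasSubst_of_mem [Finite σ] {a : σ → MvPowerSeries τ K}
    (ha : ∀ s, a s ∈ orderIdeal τ K 1) : HasSubst a :=
  hasSubst_of_constantCoeff_zero fun s => constantCoeff_eq_zero_of_mem le_rfl (ha s)

theorem subst_mem_orderIdeal [Finite σ] {a : σ → MvPowerSeries τ K}
    (ha : ∀ s, a s ∈ orderIdeal τ K 1) {d : ℕ} {f : MvPowerSeries σ K}
    (hf : f ∈ orderIdeal σ K d) : subst a f ∈ orderIdeal τ K d := by
  rw [mem_orderIdeal_iff_le_order] at hf ⊢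
  refine hf.trans (le_trans ?_ (le_order_subst (hasSubst_of_mem ha) f))
  have : (1 : ℕ∞) ≤ ⨅ i, (a i).order := le_iInf fun i => by
    simpa using mem_orderIdeal_iff_le_order.mp (ha i)
  simpa using mul_le_mul_left this f.order

/-- Algebra homomorphisms that respect the degree filtration commute with substitution. -/
theorem algHom_subst {υ : Type*} [Finite σ] [Finite τ] {a : σ → MvPowerSeries τ K}
    (ha : ∀ s, a s ∈ orderIdeal τ K 1) (Ψ : MvPowerSeries τ K →ₐ[K] MvPowerSeries υ K)
    (hΨ : ∀ d, ∀ f ∈ orderIdeal τ K d, Ψ f ∈ orderIdeal υ K d) (f : MvPowerSeries σ K) :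
    Ψ (subst a f) = subst (fun s => Ψ (a s)) f := by
  have h1 := hasSubst_of_mem ha
  have ha' : ∀ s, Ψ (a s) ∈ orderIdeal υ K 1 := fun s => hΨ 1 _ (ha s)
  have h2 := hasSubst_of_mem ha'
  refine eq_of_sub_mem_orderIdeal fun d => ?_
  have hf := sub_truncTotal_mem d f
  set p := truncTotal d f
  -- On the polynomial truncation the claim is the compatibility of algebra homomorphisms with
  -- evaluation; the remainder keeps its order on both sides.
  have hp : Ψ (subst a (p : MvPowerSeries σ K)) =
      subst (fun s => Ψ (a s)) (p : MvPowerSeries σ K) := by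
    rw [subst_coe, subst_coe]
    exact MvPolynomial.comp_aeval_apply a Ψ p
  have e : Ψ (subst a f) - subst (fun s => Ψ (a s)) f =
      Ψ (subst a (f - (p : MvPowerSeries σ K))) -
        subst (fun s => Ψ (a s)) (f - (p : MvPowerSeries σ K)) := by
    rw [subst_sub h1, subst_sub h2, map_sub, hp]
    ring
  rw [e]
  exact sub_mem (hΨ _ _ (subst_mem_orderIdeal ha hf)) (subst_mem_orderIdeal ha' hf)

end OrderIdeal

/-! ### The Poisson bracket over a coefficient ring -/

section Bracket

variable {K K' : Type*} [CommRing K] [CommRing K']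

/-- The Poisson bracket in two degrees of freedom over an arbitrary coefficient ring. -/
def pb (f g : MvPowerSeries (Coord 2) K) : MvPowerSeries (Coord 2) K :=
  ∑ j : Fin 2, (pderiv K (Sum.inl j) f * pderiv K (Sum.inr j) g
    - pderiv K (Sum.inr j) f * pderiv K (Sum.inl j) g)

theorem poisson_eq_pb (f g : MvPowerSeries (Coord 2) ℝ) : poisson f g = pb f g := rfl

/-- The Hamiltonian derivation `g ↦ {f, g}`. -/
def ad (f : MvPowerSeries (Coord 2) K) :
    Derivation K (MvPowerSeries (Coord 2) K) (MvPowerSeries (Coord 2) K) :=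
  ∑ j : Fin 2, (pderiv K (Sum.inl j) f • pderiv K (Sum.inr j)
    - pderiv K (Sum.inr j) f • pderiv K (Sum.inl j))

theorem ad_apply (f g : MvPowerSeries (Coord 2) K) : ad f g = pb f g := by
  simp [ad, pb, Fin.sum_univ_two]

theorem pb_swap (f g : MvPowerSeries (Coord 2) K) : pb f g = -pb g f := by
  simp only [pb, Fin.sum_univ_two]; ring

theorem pb_add (f g h : MvPowerSeries (Coord 2) K) : pb f (g + h) = pb f g + pb f h := by
  simp only [← ad_apply, map_add]

theorem pb_sub (f g h : MvPowerSeries (Coord 2) K) : pb f (g - h) = pb f g - pb f h := by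
  simp only [← ad_apply, map_sub]

theorem add_pb (f g h : MvPowerSeries (Coord 2) K) : pb (f + g) h = pb f h + pb g h := by
  rw [pb_swap, pb_add, pb_swap h f, pb_swap h g]; ring

theorem sub_pb (f g h : MvPowerSeries (Coord 2) K) : pb (f - g) h = pb f h - pb g h := by
  rw [pb_swap, pb_sub, pb_swap h f, pb_swap h g]; ring

theorem neg_pb (f h : MvPowerSeries (Coord 2) K) : pb (-f) h = -pb f h := by
  have := sub_pb 0 f h
  have h0 : pb 0 h = 0 := by simp [pb]
  rwa [zero_sub, h0, zero_sub] at this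

theorem pb_mul (f g h : MvPowerSeries (Coord 2) K) :
    pb f (g * h) = g * pb f h + h * pb f g := by
  simp only [← ad_apply, Derivation.leibniz, smul_eq_mul]

theorem mul_pb (f g h : MvPowerSeries (Coord 2) K) :
    pb (f * g) h = f * pb g h + g * pb f h := by
  rw [pb_swap, pb_mul, pb_swap h f, pb_swap h g]; ring

theorem pb_C (f : MvPowerSeries (Coord 2) K) (c : K) : pb f (C c) = 0 := by
  simp [pb]

theorem C_pb (f : MvPowerSeries (Coord 2) K) (c : K) : pb (C c) f = 0 := by
  simp [pb]

theorem pb_C_mul (c : K) (f g : MvPowerSeries (Coord 2) K) :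
    pb f (C c * g) = C c * pb f g := by
  rw [pb_mul, pb_C, mul_zero, add_zero]

theorem C_mul_pb (c : K) (f g : MvPowerSeries (Coord 2) K) :
    pb (C c * f) g = C c * pb f g := by
  rw [mul_pb, C_pb, mul_zero, add_zero]

theorem pderiv_comm (s t : Coord 2) (f : MvPowerSeries (Coord 2) K) :
    pderiv K s (pderiv K t f) = pderiv K t (pderiv K s f) := by
  ext m
  simp only [coeff_pderiv, Finsupp.add_apply]
  rw [show m + Finsupp.single s 1 + Finsupp.single t 1 =
    m + Finsupp.single t 1 + Finsupp.single s 1 from add_right_comm _ _ _]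
  by_cases h : s = t
  · subst h; rfl
  · rw [Finsupp.single_eq_of_ne h, Finsupp.single_eq_of_ne (Ne.symm h)]
    push_cast
    ring

theorem pb_jacobi (f g h : MvPowerSeries (Coord 2) K) :
    pb f (pb g h) = pb (pb f g) h + pb g (pb f h) := by
  simp only [pb, Fin.sum_univ_two, map_add, map_sub, Derivation.leibniz, smul_eq_mul]
  -- Mixed second derivatives are put in one fixed order; afterwards the identity is polynomial in
  -- the derivatives.
  simp only [pderiv_comm (Sum.inr 0) (Sum.inl 0), pderiv_comm (Sum.inl 1) (Sum.inl 0),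
    pderiv_comm (Sum.inl 1) (Sum.inr 0), pderiv_comm (Sum.inr 1) (Sum.inl 0),
    pderiv_comm (Sum.inr 1) (Sum.inr 0), pderiv_comm (Sum.inr 1) (Sum.inl 1)]
  ring

/-- Each factor is differentiated once. The truncated subtractions also cover a factor of order 0,
which has nothing to lose. -/
theorem pb_mem_orderIdeal {a b c : ℕ} {f g : MvPowerSeries (Coord 2) K}
    (hf : f ∈ orderIdeal _ K a) (hg : g ∈ orderIdeal _ K b) (h : c ≤ a - 1 + (b - 1)) :
    pb f g ∈ orderIdeal _ K c :=
  orderIdeal_anti h <| sum_mem fun _ _ => sub_mem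
    (mul_mem_orderIdeal (pderiv_mem_orderIdeal hf _) (pderiv_mem_orderIdeal hg _))
    (mul_mem_orderIdeal (pderiv_mem_orderIdeal hf _) (pderiv_mem_orderIdeal hg _))

theorem pderiv_map (φ : K →+* K') (s : Coord 2) (f : MvPowerSeries (Coord 2) K) :
    pderiv K' s (MvPowerSeries.map φ f) = MvPowerSeries.map φ (pderiv K s f) := by
  ext m
  simp [coeff_pderiv]

theorem pb_map (φ : K →+* K') (f g : MvPowerSeries (Coord 2) K) :
    pb (MvPowerSeries.map φ f) (MvPowerSeries.map φ g) = MvPowerSeries.map φ (pb f g) := by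
  simp only [pb, pderiv_map, map_sum, map_sub, map_mul]

/-- A substitution that multiplies the brackets of the coordinates by a constant does so for all
brackets. -/
theorem pb_subst {a : Coord 2 → MvPowerSeries (Coord 2) K}
    (ha : ∀ s, a s ∈ orderIdeal _ K 1) (c : K)
    (hc : ∀ s t, pb (a s) (a t) = C c * pb (X s) (X t))
    (f g : MvPowerSeries (Coord 2) K) :
    pb (subst a f) (subst a g) = C c * subst a (pb f g) := by
  have h1 := hasSubst_of_mem ha
  have hconst : ∀ s t, ∃ r : K, pb (X s : MvPowerSeries (Coord 2) K) (X t) = C r := by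
    intro s t
    refine ⟨∑ j : Fin 2, ((if s = Sum.inl j then 1 else 0) * (if t = Sum.inr j then 1 else 0) -
      (if s = Sum.inr j then 1 else 0) * (if t = Sum.inl j then 1 else 0)), ?_⟩
    simp only [pb, pderiv_X, map_sum, map_sub, map_mul, Pi.single_apply, apply_ite C, map_one,
      map_zero]
  have hC : ∀ r : K, subst a (C r : MvPowerSeries (Coord 2) K) = C r := fun r => subst_C r
  have hXX : ∀ s t, pb (a s) (a t) =
      C c * subst a (pb (X s : MvPowerSeries (Coord 2) K) (X t)) := by
    intro s t
    obtain ⟨r, hr⟩ := hconst s t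
    rw [hc, hr, hC]
  have hXp : ∀ (s : Coord 2) (q : MvPolynomial (Coord 2) K),
      pb (a s) (subst a (q : MvPowerSeries (Coord 2) K)) =
        C c * subst a (pb (X s) (q : MvPowerSeries (Coord 2) K)) := by
    intro s q
    induction q using MvPolynomial.induction_on with
    | C r => rw [MvPolynomial.coe_C, hC, pb_C, pb_C, ← map_zero C, hC, map_zero, mul_zero]
    | add p q hp hq =>
      rw [MvPolynomial.coe_add, subst_add h1, pb_add, pb_add, subst_add h1, hp, hq, mul_add]
    | mul_X p t hp =>
      rw [MvPolynomial.coe_mul, MvPolynomial.coe_X, subst_mul h1, pb_mul, pb_mul, subst_add h1,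
        subst_mul h1, subst_mul h1, subst_X h1, hp, hXX]
      ring
  have hpp : ∀ p q : MvPolynomial (Coord 2) K,
      pb (subst a (p : MvPowerSeries (Coord 2) K)) (subst a (q : MvPowerSeries (Coord 2) K)) =
        C c * subst a (pb (p : MvPowerSeries (Coord 2) K) (q : MvPowerSeries (Coord 2) K)) := by
    intro p q
    induction p using MvPolynomial.induction_on with
    | C r => rw [MvPolynomial.coe_C, hC, C_pb, C_pb, ← map_zero C, hC, map_zero, mul_zero]
    | add p q hp hq =>
      rw [MvPolynomial.coe_add, subst_add h1, add_pb, add_pb, subst_add h1, hp, hq, mul_add]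
    | mul_X p t hp =>
      rw [MvPolynomial.coe_mul, MvPolynomial.coe_X, subst_mul h1, mul_pb, mul_pb, subst_add h1,
        subst_mul h1, subst_mul h1, subst_X h1, hp, hXp]
      ring
  refine eq_of_sub_mem_orderIdeal fun d => ?_
  -- The truncation is at `d + 1` because the bracket differentiates the remainder once.
  have hf := sub_truncTotal_mem (d + 1) f
  have hg := sub_truncTotal_mem (d + 1) g
  have hpq := hpp (truncTotal (d + 1) f) (truncTotal (d + 1) g)
  set p : MvPowerSeries (Coord 2) K := MvPolynomial.toMvPowerSeries (truncTotal (d + 1) f)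
  set q : MvPowerSeries (Coord 2) K := MvPolynomial.toMvPowerSeries (truncTotal (d + 1) g)
  have e : pb (subst a f) (subst a g) - C c * subst a (pb f g) =
      (pb (subst a (f - p)) (subst a g) + pb (subst a p) (subst a (g - q))) -
      C c * subst a (pb (f - p) g + pb p (g - q)) := by
    simp only [subst_sub h1, subst_add h1, sub_pb, pb_sub]
    linear_combination hpq
  rw [e]
  refine sub_mem (add_mem ?_ ?_) (Ideal.mul_mem_left _ _ (subst_mem_orderIdeal ha (add_mem ?_ ?_)))
  · exact pb_mem_orderIdeal (subst_mem_orderIdeal ha hf) (orderIdeal_zero _) (by simp)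
  · exact pb_mem_orderIdeal (orderIdeal_zero _) (subst_mem_orderIdeal ha hg) (by simp)
  · exact pb_mem_orderIdeal hf (orderIdeal_zero _) (by simp)
  · exact pb_mem_orderIdeal (orderIdeal_zero _) hg (by simp)

end Bracket

/-! ### Lie series as symplectic automorphisms -/

section LieSeries

variable {K K' : Type*} [CommRing K] [Algebra ℝ K] [CommRing K'] [Algebra ℝ K']

/-- The truncated Lie series `∑_{k<N} (ad χ)^k f / k!`. -/
def lieSum (N : ℕ) (χ f : MvPowerSeries (Coord 2) K) : MvPowerSeries (Coord 2) K :=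
  ∑ k ∈ Finset.range N, ((k.factorial : ℝ)⁻¹) • (ad χ)^[k] f

/-- The Lie series `exp (ad χ) f`, for `χ` without terms of degree less than `3`. -/
def expAd (χ f : MvPowerSeries (Coord 2) K) : MvPowerSeries (Coord 2) K :=
  fun m => coeff m (lieSum (m.degree + 1) χ f)

variable {χ : MvPowerSeries (Coord 2) K}

-- A bracket costs two degrees and `χ` supplies at least three. This gain makes the Lie series
-- locally finite.
omit [Algebra ℝ K] in
theorem ad_mem_orderIdeal (hχ : χ ∈ orderIdeal _ K 3) {d : ℕ} {f : MvPowerSeries (Coord 2) K}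
    (hf : f ∈ orderIdeal _ K d) : ad χ f ∈ orderIdeal _ K (d + 1) := by
  rw [ad_apply]
  rcases d with _ | d
  · exact pb_mem_orderIdeal hχ hf (by simp)
  · exact pb_mem_orderIdeal hχ hf (by omega)

omit [Algebra ℝ K] in
theorem iterate_ad_mem_orderIdeal (hχ : χ ∈ orderIdeal _ K 3) (k : ℕ) {d : ℕ}
    {f : MvPowerSeries (Coord 2) K} (hf : f ∈ orderIdeal _ K d) :
    (ad χ)^[k] f ∈ orderIdeal _ K (d + k) := by
  induction k with
  | zero => simpa using hf
  | succ k ih =>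
    rw [Function.iterate_succ_apply']
    exact ad_mem_orderIdeal hχ ih

theorem lieSum_add_sub_mem (hχ : χ ∈ orderIdeal _ K 3) (N j : ℕ) {d : ℕ}
    {f : MvPowerSeries (Coord 2) K} (hf : f ∈ orderIdeal _ K d) :
    lieSum (N + j) χ f - lieSum N χ f ∈ orderIdeal _ K (d + N) := by
  rw [lieSum, lieSum, Finset.sum_range_add, add_sub_cancel_left]
  exact sum_mem fun k _ => smul_mem_orderIdeal _
    (orderIdeal_anti (by omega) (iterate_ad_mem_orderIdeal hχ (N + k) hf))

/-- In `expAd` each exponent has its own truncation of the Lie series. All long enough truncations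
agree there, so one finite sum can serve for all low degrees at once. -/
theorem expAd_sub_lieSum_mem (hχ : χ ∈ orderIdeal _ K 3) (N : ℕ) {d : ℕ}
    {f : MvPowerSeries (Coord 2) K} (hf : f ∈ orderIdeal _ K d) :
    expAd χ f - lieSum N χ f ∈ orderIdeal _ K (d + N) := by
  intro m hm
  have h0 : coeff m (expAd χ f) = coeff m (lieSum (m.degree + 1) χ f) := rfl
  have h1 := lieSum_add_sub_mem hχ (m.degree + 1) N hf m (by omega)
  have h2 := lieSum_add_sub_mem hχ N (m.degree + 1) hf m hm
  rw [map_sub, sub_eq_zero] at h1 h2 ⊢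
  rw [h0, ← h1, ← h2, add_comm]

theorem expAd_sub_lieSum_mem' (hχ : χ ∈ orderIdeal _ K 3) (N : ℕ)
    (f : MvPowerSeries (Coord 2) K) :
    expAd χ f - lieSum N χ f ∈ orderIdeal _ K N := by
  simpa using expAd_sub_lieSum_mem hχ N (orderIdeal_zero f)

theorem expAd_sub_self_mem (hχ : χ ∈ orderIdeal _ K 3) {d : ℕ}
    {f : MvPowerSeries (Coord 2) K} (hf : f ∈ orderIdeal _ K d) :
    expAd χ f - f ∈ orderIdeal _ K (d + 1) := by
  simpa [lieSum] using expAd_sub_lieSum_mem hχ 1 hf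

theorem expAd_mem_orderIdeal (hχ : χ ∈ orderIdeal _ K 3) {d : ℕ}
    {f : MvPowerSeries (Coord 2) K} (hf : f ∈ orderIdeal _ K d) :
    expAd χ f ∈ orderIdeal _ K d := by
  simpa [lieSum] using expAd_sub_lieSum_mem hχ 0 hf

/-- Lie series are intertwined by linear maps that intertwine the Hamiltonian derivations. -/
theorem expAd_intertwine {χ' : MvPowerSeries (Coord 2) K'} (hχ : χ ∈ orderIdeal _ K 3)
    (hχ' : χ' ∈ orderIdeal _ K' 3)
    (W : MvPowerSeries (Coord 2) K →ₗ[ℝ] MvPowerSeries (Coord 2) K')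
    (hW : ∀ d, ∀ f ∈ orderIdeal _ K d, W f ∈ orderIdeal _ K' d)
    (hD : ∀ f, W (pb χ f) = pb χ' (W f)) (f : MvPowerSeries (Coord 2) K) :
    W (expAd χ f) = expAd χ' (W f) := by
  have hk : ∀ k, W ((ad χ)^[k] f) = (ad χ')^[k] (W f) := by
    intro k
    induction k with
    | zero => rfl
    | succ k ih =>
      rw [Function.iterate_succ_apply', Function.iterate_succ_apply', ad_apply, ad_apply, hD, ih]
  refine eq_of_sub_mem_orderIdeal fun d => ?_
  have h1 := hW _ _ (expAd_sub_lieSum_mem' hχ d f)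
  have h2 := expAd_sub_lieSum_mem' hχ' d (W f)
  have h3 : W (lieSum d χ f) = lieSum d χ' (W f) := by
    simp only [lieSum, map_sum, map_smul, hk]
  rw [map_sub, h3] at h1
  simpa using sub_mem h1 h2

theorem expAd_add (hχ : χ ∈ orderIdeal _ K 3) (f g : MvPowerSeries (Coord 2) K) :
    expAd χ (f + g) = expAd χ f + expAd χ g := by
  refine eq_of_sub_mem_orderIdeal fun d => ?_
  have h1 := expAd_sub_lieSum_mem' hχ d (f + g)
  have h2 := expAd_sub_lieSum_mem' hχ d f
  have h3 := expAd_sub_lieSum_mem' hχ d g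
  have h4 : lieSum d χ (f + g) = lieSum d χ f + lieSum d χ g := by
    simp only [lieSum, iterate_map_add, smul_add, Finset.sum_add_distrib]
  rw [h4] at h1
  convert sub_mem (sub_mem h1 h2) h3 using 1
  ring

theorem expAd_C (hχ : χ ∈ orderIdeal _ K 3) (c : K) : expAd χ (C c) = C c := by
  refine eq_of_sub_mem_orderIdeal fun d => orderIdeal_anti (Nat.le_succ d) ?_
  have h1 := expAd_sub_lieSum_mem' hχ (d + 1) (C c)
  have h4 : lieSum (d + 1) χ (C c) = C c := by
    rw [lieSum, Finset.sum_range_succ', Finset.sum_eq_zero]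
    · simp
    · intro k _
      rw [Function.iterate_succ_apply, ad_apply, pb_C, iterate_map_zero, smul_zero]
  rwa [h4] at h1

theorem inv_factorial_mul_choose (i j : ℕ) :
    ((i + j).factorial : ℝ)⁻¹ * ((i + j).choose i : ℝ) =
      (i.factorial : ℝ)⁻¹ * (j.factorial : ℝ)⁻¹ := by
  have h : (((i + j).choose i * i.factorial * j.factorial : ℕ) : ℝ) = ((i + j).factorial : ℕ) :=
    by
    rw [← Nat.add_choose_mul_factorial_mul_factorial i j, Nat.choose_symm_add]
  push_cast at h
  rw [← h]
  have := Nat.cast_ne_zero (R := ℝ).mpr (Nat.choose_pos (Nat.le_add_right i j)).ne'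
  field_simp

/-- Leibniz rule for iterates of a derivation of a bilinear operation. -/
theorem iterate_leibniz {A : Type*} [AddCommGroup A] (D : A → A) (β : A → A → A)
    (hD : ∀ a b, D (a + b) = D a + D b)
    (hβ : ∀ f g, D (β f g) = β (D f) g + β f (D g)) (n : ℕ) (f g : A) :
    D^[n] (β f g) = ∑ p ∈ Finset.HasAntidiagonal.antidiagonal n, n.choose p.1 • β (D^[p.1] f) (D^[p.2] g) := by
  -- `L` and `R` apply `D` to the first and to the second argument. They commute, so the Leibniz
  -- rule is the binomial theorem for `L + R`.
  let L : AddMonoid.End (A → A → A) :=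
    { toFun := fun F f g => F (D f) g, map_zero' := rfl, map_add' := fun _ _ => rfl }
  let R : AddMonoid.End (A → A → A) :=
    { toFun := fun F f g => F f (D g), map_zero' := rfl, map_add' := fun _ _ => rfl }
  have hL : ∀ (k : ℕ) (F : A → A → A) (f g : A), (L ^ k) F f g = F (D^[k] f) g := by
    intro k
    induction k with
    | zero => intro F f g; rfl
    | succ k ih =>
      intro F f g
      rw [pow_succ, Function.iterate_succ_apply']
      exact ih (L F) f g
  have hR : ∀ (k : ℕ) (F : A → A → A) (f g : A), (R ^ k) F f g = F f (D^[k] g) := by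
    intro k
    induction k with
    | zero => intro F f g; rfl
    | succ k ih =>
      intro F f g
      rw [pow_succ, Function.iterate_succ_apply']
      exact ih (R F) f g
  have hLR : ∀ k, (fun f g => D^[k] (β f g)) = ((L + R) ^ k) β := by
    intro k
    induction k with
    | zero => rfl
    | succ k ih =>
      rw [pow_succ']
      refine Eq.trans ?_ (congrArg (L + R) ih)
      funext f g
      have h0 : ∀ k a b, D^[k] (a + b) = D^[k] a + D^[k] b := by
        intro k
        induction k with
        | zero => intro a b; rfl
        | succ k ih => intro a b; simp only [Function.iterate_succ_apply, hD, ih]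
      rw [Function.iterate_succ_apply, hβ, h0]
      rfl
  have hc : Commute L R := rfl
  have h1 := congrFun (congrFun (hLR n) f) g
  rw [hc.add_pow'] at h1
  let ev : AddMonoid.End (A → A → A) →+ A :=
    { toFun := fun E => E β f g, map_zero' := rfl, map_add' := fun _ _ => rfl }
  refine (h1.trans (map_sum ev _ _)).trans ?_
  refine Finset.sum_congr rfl fun p _ => ?_
  have h2 : ev ((n.choose p.1) • (L ^ p.1 * R ^ p.2)) =
      n.choose p.1 • ((L ^ p.1 * R ^ p.2) β f g) := rfl
  rw [h2, show (L ^ p.1 * R ^ p.2) β = (L ^ p.1) ((R ^ p.2) β) from rfl, hL, hR]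

/-- `exp (ad χ)` is compatible with every bilinear operation of bounded degree loss for which
`ad χ` satisfies the Leibniz rule. -/
theorem expAd_bilin (hχ : χ ∈ orderIdeal _ K 3)
    (β : MvPowerSeries (Coord 2) K →ₗ[ℝ] MvPowerSeries (Coord 2) K →ₗ[ℝ]
      MvPowerSeries (Coord 2) K)
    (hβ : ∀ f g, ad χ (β f g) = β (ad χ f) g + β f (ad χ g))
    (hord : ∀ a b f g, f ∈ orderIdeal _ K a → g ∈ orderIdeal _ K b →
      β f g ∈ orderIdeal _ K (a + b - 2))
    (f g : MvPowerSeries (Coord 2) K) :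
    expAd χ (β f g) = β (expAd χ f) (expAd χ g) := by
  refine eq_of_sub_mem_orderIdeal fun d => ?_
  -- The two extra degrees pay for the loss allowed in `β`.
  set N := d + 2 with hN
  let u : ℕ → MvPowerSeries (Coord 2) K := fun k => ((k.factorial : ℝ)⁻¹) • (ad χ)^[k] f
  let v : ℕ → MvPowerSeries (Coord 2) K := fun k => ((k.factorial : ℝ)⁻¹) • (ad χ)^[k] g
  have hu : ∀ k, u k ∈ orderIdeal _ K k := fun k => smul_mem_orderIdeal _
    (by simpa using iterate_ad_mem_orderIdeal hχ k (orderIdeal_zero f))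
  have hv : ∀ k, v k ∈ orderIdeal _ K k := fun k => smul_mem_orderIdeal _
    (by simpa using iterate_ad_mem_orderIdeal hχ k (orderIdeal_zero g))
  have hn : ∀ n, ((n.factorial : ℝ)⁻¹) • (ad χ)^[n] (β f g) =
      ∑ p ∈ Finset.HasAntidiagonal.antidiagonal n, β (u p.1) (v p.2) := by
    intro n
    rw [iterate_leibniz (ad χ) (fun f g => β f g) (fun a b => map_add _ a b) hβ, Finset.smul_sum]
    refine Finset.sum_congr rfl fun p hp => ?_
    rw [Finset.HasAntidiagonal.mem_antidiagonal] at hp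
    simp only [u, v, map_smul, LinearMap.smul_apply, smul_smul]
    rw [← Nat.cast_smul_eq_nsmul ℝ, smul_smul]
    congr 1
    rw [← hp, inv_factorial_mul_choose, mul_comm]
  have h1 := expAd_sub_lieSum_mem' hχ N (β f g)
  have h2 : lieSum N χ (β f g) = ∑ n ∈ Finset.range N, ∑ p ∈ Finset.HasAntidiagonal.antidiagonal n,
      β (u p.1) (v p.2) := Finset.sum_congr rfl fun n _ => hn n
  have h3 : β (lieSum N χ f) (lieSum N χ g) =
      ∑ p ∈ Finset.range N ×ˢ Finset.range N, β (u p.1) (v p.2) := by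
    simp only [lieSum, map_sum, LinearMap.sum_apply, Finset.sum_product, u, v]
    exact Finset.sum_comm
  -- The product of the sums runs over a square of index pairs, the sum of the product over the
  -- triangle below the diagonal. The remaining pairs have index sum at least `N`, hence contribute
  -- in order at least `d`.
  have h4 : β (lieSum N χ f) (lieSum N χ g) - lieSum N χ (β f g) ∈ orderIdeal _ K d := by
    rw [h3, h2, Finset.sum_sigma']
    have h5 : ∑ x ∈ (Finset.range N).sigma fun n => Finset.HasAntidiagonal.antidiagonal n,
        β (u x.2.1) (v x.2.2) =
        ∑ p ∈ (Finset.range N ×ˢ Finset.range N).filter (fun p => p.1 + p.2 < N),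
          β (u p.1) (v p.2) := by
      refine Finset.sum_nbij' (fun x => x.2) (fun p => ⟨p.1 + p.2, p⟩) ?_ ?_ ?_ ?_ ?_
      · rintro ⟨n, a, b⟩ h
        simp at h ⊢
        omega
      · rintro ⟨a, b⟩ h
        simp at h ⊢
        omega
      · rintro ⟨n, a, b⟩ h
        simp at h
        obtain ⟨_, rfl⟩ := h
        rfl
      · rintro ⟨a, b⟩ _; rfl
      · rintro ⟨n, a, b⟩ _; rfl
    rw [h5, ← Finset.sum_filter_add_sum_filter_not _ (fun p : ℕ × ℕ => p.1 + p.2 < N),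
      add_sub_cancel_left]
    refine sum_mem fun p hp => orderIdeal_anti ?_ (hord _ _ _ _ (hu p.1) (hv p.2))
    simp at hp
    omega
  have h6 := expAd_sub_lieSum_mem' hχ N f
  have h7 := expAd_sub_lieSum_mem' hχ N g
  have h8 := hord _ _ _ _ h6 (orderIdeal_zero (expAd χ g))
  have h9 := hord _ _ _ _ (orderIdeal_zero (lieSum N χ f)) h7
  have e : expAd χ (β f g) - β (expAd χ f) (expAd χ g) =
      (expAd χ (β f g) - lieSum N χ (β f g)) -
      (β (lieSum N χ f) (lieSum N χ g) - lieSum N χ (β f g))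
      - β (expAd χ f - lieSum N χ f) (expAd χ g) -
      β (lieSum N χ f) (expAd χ g - lieSum N χ g) := by
    simp only [map_sub, LinearMap.sub_apply]
    abel
  rw [e]
  refine sub_mem (sub_mem (sub_mem (orderIdeal_anti (by omega) h1) h4)
    (orderIdeal_anti (by omega) h8)) (orderIdeal_anti (by omega) h9)

theorem expAd_mul (hχ : χ ∈ orderIdeal _ K 3) (f g : MvPowerSeries (Coord 2) K) :
    expAd χ (f * g) = expAd χ f * expAd χ g := by
  refine expAd_bilin hχ (LinearMap.mul ℝ _) (fun f g => ?_) (fun a b f g hf hg => ?_) f g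
  · simp only [LinearMap.mul_apply', Derivation.leibniz, smul_eq_mul]
    ring
  · exact orderIdeal_anti (by omega) (mul_mem_orderIdeal hf hg)

theorem pb_smul (r : ℝ) (f g : MvPowerSeries (Coord 2) K) : pb f (r • g) = r • pb f g := by
  rw [← ad_apply, ← ad_apply]
  exact Derivation.map_smul_of_tower _ _ _

theorem smul_pb (r : ℝ) (f g : MvPowerSeries (Coord 2) K) : pb (r • f) g = r • pb f g := by
  rw [pb_swap, pb_smul, pb_swap g f, smul_neg, neg_neg]

/-- The Jacobi identity is the Leibniz rule of `ad χ` for the bracket, so the argument for products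
applies. -/
theorem expAd_pb (hχ : χ ∈ orderIdeal _ K 3) (f g : MvPowerSeries (Coord 2) K) :
    expAd χ (pb f g) = pb (expAd χ f) (expAd χ g) := by
  refine expAd_bilin hχ (LinearMap.mk₂ ℝ pb add_pb smul_pb pb_add pb_smul)
    (fun f g => ?_) (fun a b f g hf hg => ?_) f g
  · simp only [LinearMap.mk₂_apply, ad_apply]
    exact pb_jacobi _ _ _
  · exact pb_mem_orderIdeal hf hg (by omega)

/-- In the Cauchy product of the two exponential series the factor of `(ad χ)^n` is `(-1 + 1)^n /
n!`, so only `n = 0` survives. -/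
theorem expAd_neg_expAd (hχ : χ ∈ orderIdeal _ K 3) (f : MvPowerSeries (Coord 2) K) :
    expAd (-χ) (expAd χ f) = f := by
  have hχ' : -χ ∈ orderIdeal _ K 3 := neg_mem hχ
  refine eq_of_sub_mem_orderIdeal fun d => ?_
  rcases d with _ | d
  · exact orderIdeal_zero _
  set N := d + 1
  have hneg : ∀ k g, (ad (-χ))^[k] g = ((-1 : ℝ) ^ k) • (ad χ)^[k] g := by
    intro k
    induction k with
    | zero => intro g; simp
    | succ k ih =>
      intro g
      rw [Function.iterate_succ_apply', ih, Function.iterate_succ_apply', ad_apply, pb_smul,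
        neg_pb, ad_apply, pow_succ, mul_smul]
      simp
  have h1 := expAd_sub_lieSum_mem' hχ' N (expAd χ f)
  have hlin : ∀ a b, lieSum N (-χ) (a - b) = lieSum N (-χ) a - lieSum N (-χ) b := fun a b => by
    simp only [lieSum, iterate_map_sub, smul_sub, Finset.sum_sub_distrib]
  have hmem : ∀ g ∈ orderIdeal _ K N, lieSum N (-χ) g ∈ orderIdeal _ K N := fun g hg =>
    sum_mem fun k _ => smul_mem_orderIdeal _
      (orderIdeal_anti (by omega) (iterate_ad_mem_orderIdeal hχ' k hg))
  have h2 := hmem _ (expAd_sub_lieSum_mem' hχ N f)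
  rw [hlin] at h2
  let c : ℕ → ℕ → ℝ := fun i j => (i.factorial : ℝ)⁻¹ * (-1) ^ i * (j.factorial : ℝ)⁻¹
  have h3 : lieSum N (-χ) (lieSum N χ f) = ∑ p ∈ Finset.range N ×ˢ Finset.range N,
      c p.1 p.2 • (ad χ)^[p.1 + p.2] f := by
    rw [Finset.sum_product]
    refine Finset.sum_congr rfl fun i _ => ?_
    rw [hneg, lieSum, smul_smul]
    have : ∀ (s : Finset ℕ) (w : ℕ → MvPowerSeries (Coord 2) K),
        (ad χ)^[i] (∑ j ∈ s, w j) = ∑ j ∈ s, (ad χ)^[i] (w j) := by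
      intro s w
      have := map_sum ((ad χ).toLinearMap ^ i) w s
      simp only [Module.End.pow_apply] at this
      exact this
    rw [this, Finset.smul_sum]
    refine Finset.sum_congr rfl fun j _ => ?_
    have h5 : (ad χ)^[i] (((j.factorial : ℝ)⁻¹) • (ad χ)^[j] f) =
        ((j.factorial : ℝ)⁻¹) • (ad χ)^[i] ((ad χ)^[j] f) := by
      have := ((ad χ).toLinearMap ^ i).map_smul_of_tower ((j.factorial : ℝ)⁻¹) ((ad χ)^[j] f)
      simp only [Module.End.pow_apply] at this
      exact this
    rw [h5, smul_smul, Function.iterate_add_apply]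
  have h4 : lieSum N (-χ) (lieSum N χ f) - f ∈ orderIdeal _ K N := by
    have hzero : ∀ n, 0 < n → ∑ p ∈ Finset.HasAntidiagonal.antidiagonal n, c p.1 p.2 = 0 := by
      intro n hn
      have h := (Commute.all (-1 : ℝ) 1).add_pow' n
      rw [neg_add_cancel, zero_pow hn.ne'] at h
      have h' : ∑ p ∈ Finset.HasAntidiagonal.antidiagonal n, c p.1 p.2 =
          (n.factorial : ℝ)⁻¹ * ∑ p ∈ Finset.HasAntidiagonal.antidiagonal n,
            n.choose p.1 • ((-1 : ℝ) ^ p.1 * 1 ^ p.2) := by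
        rw [Finset.mul_sum]
        refine Finset.sum_congr rfl fun p hp => ?_
        rw [Finset.HasAntidiagonal.mem_antidiagonal] at hp
        simp only [c]
        rw [← hp, nsmul_eq_mul, ← mul_assoc, inv_factorial_mul_choose, one_pow]
        ring
      rw [h', ← h, mul_zero]
    have h6 : f = ∑ p ∈ (Finset.range N ×ˢ Finset.range N).filter (fun p => p.1 + p.2 < N),
        c p.1 p.2 • (ad χ)^[p.1 + p.2] f := by
      have h7 : ∑ x ∈ (Finset.range N).sigma fun n => Finset.HasAntidiagonal.antidiagonal n,
          c x.2.1 x.2.2 • (ad χ)^[x.2.1 + x.2.2] f =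
          ∑ p ∈ (Finset.range N ×ˢ Finset.range N).filter (fun p => p.1 + p.2 < N),
            c p.1 p.2 • (ad χ)^[p.1 + p.2] f := by
        refine Finset.sum_nbij' (fun x => x.2) (fun p => ⟨p.1 + p.2, p⟩) ?_ ?_ ?_ ?_ ?_
        · rintro ⟨n, a, b⟩ h
          simp at h ⊢
          omega
        · rintro ⟨a, b⟩ h
          simp at h ⊢
          omega
        · rintro ⟨n, a, b⟩ h
          simp at h
          obtain ⟨_, rfl⟩ := h
          rfl
        · rintro ⟨a, b⟩ _; rfl
        · rintro ⟨n, a, b⟩ _; rfl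
      rw [← h7, ← Finset.sum_sigma' (Finset.range N) (fun n => Finset.HasAntidiagonal.antidiagonal n)
        (fun _ p => c p.1 p.2 • (ad χ)^[p.1 + p.2] f)]
      have h8 : ∀ n ∈ Finset.range N, ∑ p ∈ Finset.HasAntidiagonal.antidiagonal n,
          c p.1 p.2 • (ad χ)^[p.1 + p.2] f = if n = 0 then f else 0 := by
        intro n _
        have h9 : ∑ p ∈ Finset.HasAntidiagonal.antidiagonal n, c p.1 p.2 • (ad χ)^[p.1 + p.2] f =
            (∑ p ∈ Finset.HasAntidiagonal.antidiagonal n, c p.1 p.2) • (ad χ)^[n] f := by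
          rw [Finset.sum_smul]
          refine Finset.sum_congr rfl fun p hp => ?_
          rw [Finset.HasAntidiagonal.mem_antidiagonal.mp hp]
        rw [h9]
        split_ifs with h0
        · subst h0; simp [c]
        · rw [hzero n (Nat.pos_of_ne_zero h0), zero_smul]
      rw [Finset.sum_congr rfl h8, Finset.sum_ite_eq' (Finset.range N) 0 (fun _ => f),
        if_pos (by simp [N])]
    nth_rewrite 2 [h6]
    rw [h3, ← Finset.sum_filter_add_sum_filter_not _ (fun p : ℕ × ℕ => p.1 + p.2 < N),
      add_sub_cancel_left]
    refine sum_mem fun p hp => smul_mem_orderIdeal _ (orderIdeal_anti ?_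
      (iterate_ad_mem_orderIdeal hχ _ (orderIdeal_zero f)))
    simp at hp
    omega
  convert add_mem (add_mem h1 h2) h4 using 1
  ring

/-- `exp (ad χ)` as an algebra homomorphism. -/
def expAdHom (hχ : χ ∈ orderIdeal _ K 3) :
    MvPowerSeries (Coord 2) K →ₐ[K] MvPowerSeries (Coord 2) K where
  toFun := expAd χ
  map_one' := by simpa using expAd_C hχ 1
  map_mul' := expAd_mul hχ
  map_zero' := by simpa using expAd_C hχ 0
  map_add' := expAd_add hχ
  commutes' := expAd_C hχ

theorem expAdHom_apply (hχ : χ ∈ orderIdeal _ K 3) (f : MvPowerSeries (Coord 2) K) :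
    expAdHom hχ f = expAd χ f := rfl

/-- Effect on `exp (ad χ) h` of a change of `χ` in degrees at least `d`. -/
theorem expAd_add_left_sub_mem {χ τ h : MvPowerSeries (Coord 2) K} (hχ : χ ∈ orderIdeal _ K 3)
    {d : ℕ} (hd : 3 ≤ d) (hτ : τ ∈ orderIdeal _ K d) (hh : h ∈ orderIdeal _ K 2) :
    expAd (χ + τ) h - expAd χ h - pb τ h ∈ orderIdeal _ K (d + 1) := by
  have hχ' : χ + τ ∈ orderIdeal _ K 3 := add_mem hχ (orderIdeal_anti hd hτ)
  -- Every further application of `ad` gains a degree, so in degree `d` only the linear term `{τ,h}`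
  -- notices the change.
  have hk : ∀ k, (ad (χ + τ))^[k + 1] h - (ad χ)^[k + 1] h ∈ orderIdeal _ K (d + k) := by
    intro k
    induction k with
    | zero =>
      simp only [zero_add, Function.iterate_one, ad_apply, add_pb, add_sub_cancel_left]
      exact pb_mem_orderIdeal hτ hh (by omega)
    | succ k ih =>
      have e : (ad (χ + τ))^[k + 1 + 1] h - (ad χ)^[k + 1 + 1] h =
          ad (χ + τ) ((ad (χ + τ))^[k + 1] h - (ad χ)^[k + 1] h) + pb τ ((ad χ)^[k + 1] h) := by
        rw [Function.iterate_succ_apply' _ (k + 1), Function.iterate_succ_apply' _ (k + 1),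
          map_sub, ad_apply (χ + τ) ((ad χ)^[k + 1] h), add_pb, ad_apply χ]
        ring
      rw [e]
      exact add_mem (ad_mem_orderIdeal hχ' ih)
        (pb_mem_orderIdeal hτ (iterate_ad_mem_orderIdeal hχ (k + 1) hh) (by omega))
  have h1 := expAd_sub_lieSum_mem' hχ' (d + 3) h
  have h2 := expAd_sub_lieSum_mem' hχ (d + 3) h
  have h3 : lieSum (d + 3) (χ + τ) h - lieSum (d + 3) χ h - pb τ h ∈ orderIdeal _ K (d + 1) := by
    rw [lieSum, lieSum, ← Finset.sum_sub_distrib, Finset.sum_range_succ', Finset.sum_range_succ']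
    have : ((0 + 1).factorial : ℝ)⁻¹ • (ad (χ + τ))^[0 + 1] h -
        ((0 + 1).factorial : ℝ)⁻¹ • (ad χ)^[0 + 1] h = pb τ h := by
      simp [ad_apply, add_pb]
    rw [this]
    simp only [Nat.factorial_zero, Function.iterate_zero, id, sub_self, add_zero,
      add_sub_cancel_right]
    refine sum_mem fun k _ => ?_
    rw [← smul_sub]
    exact smul_mem_orderIdeal _ (orderIdeal_anti (by omega) (hk (k + 1)))
  convert add_mem (sub_mem (orderIdeal_anti (by omega : d + 1 ≤ d + 3) h1)
    (orderIdeal_anti (by omega : d + 1 ≤ d + 3) h2)) h3 using 1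
  ring

end LieSeries

/-! ### The normalised generator: existence, uniqueness, locality, naturality -/

section NormalForm

variable {K K' : Type*} [CommRing K] [Algebra ℝ K] [CommRing K'] [Algebra ℝ K']

/-- The exponents of the resonant monomials `∏ (ξ_j η_j)^{a_j}`. -/
def IsRes (m : Coord 2 →₀ ℕ) : Prop := ∀ j : Fin 2, m (Sum.inl j) = m (Sum.inr j)

/-- The divisor `ω · (a - b)` of the monomial `ξ^a η^b`. -/
def divisor (ω : Fin 2 → ℝ) (m : Coord 2 →₀ ℕ) : ℝ :=
  ∑ j, ω j * ((m (Sum.inl j) : ℝ) - (m (Sum.inr j) : ℝ))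

/-- The action variable `ξ_j η_j`. -/
def act (K : Type*) [CommRing K] (j : Fin 2) : MvPowerSeries (Coord 2) K :=
  X (Sum.inl j) * X (Sum.inr j)

/-- The quadratic Hamiltonian `∑ ω_j ξ_j η_j`. -/
def quad (K : Type*) [CommRing K] [Algebra ℝ K] (ω : Fin 2 → ℝ) : MvPowerSeries (Coord 2) K :=
  ∑ j, C (algebraMap ℝ K (ω j)) * act K j

omit [Algebra ℝ K] in
theorem coeff_X_mul_pderiv (s : Coord 2) (f : MvPowerSeries (Coord 2) K) (m : Coord 2 →₀ ℕ) :
    coeff m (X s * pderiv K s f) = (m s : K) * coeff m f := by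
  classical
  rw [X, coeff_monomial_mul, one_mul]
  split_ifs with h
  · rw [coeff_pderiv, tsub_add_cancel_of_le h, mul_comm]
    have h1 : 1 ≤ m s := by simpa using h s
    congr 1
    rw [Finsupp.tsub_apply, Finsupp.single_eq_same]
    norm_cast
    rw [Nat.sub_add_cancel h1]
  · have h1 : m s = 0 := by
      by_contra hne
      exact h (by simpa using Nat.one_le_iff_ne_zero.mpr hne)
    rw [h1, Nat.cast_zero, zero_mul]

omit [Algebra ℝ K] in
theorem pb_X_inl (f : MvPowerSeries (Coord 2) K) (j : Fin 2) :
    pb f (X (Sum.inl j)) = -pderiv K (Sum.inr j) f := by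
  classical
  simp [pb, pderiv_X, Pi.single_apply]

omit [Algebra ℝ K] in
theorem pb_X_inr (f : MvPowerSeries (Coord 2) K) (j : Fin 2) :
    pb f (X (Sum.inr j)) = pderiv K (Sum.inl j) f := by
  classical
  simp [pb, pderiv_X, Pi.single_apply]

omit [Algebra ℝ K] in
theorem coeff_pb_act (f : MvPowerSeries (Coord 2) K) (j : Fin 2) (m : Coord 2 →₀ ℕ) :
    coeff m (pb f (act K j)) = ((m (Sum.inl j) : K) - (m (Sum.inr j) : K)) * coeff m f := by
  rw [act, pb_mul, pb_X_inl, pb_X_inr, map_add, mul_neg, map_neg, coeff_X_mul_pderiv,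
    coeff_X_mul_pderiv]
  ring

/-- Monomials diagonalise the homological operator; its eigenvalues are the small divisors. -/
theorem coeff_pb_quad (ω : Fin 2 → ℝ) (f : MvPowerSeries (Coord 2) K) (m : Coord 2 →₀ ℕ) :
    coeff m (pb f (quad K ω)) = divisor ω m • coeff m f := by
  have h : pb f (quad K ω) = ∑ j, C (algebraMap ℝ K (ω j)) * pb f (act K j) := by
    rw [quad, ← ad_apply, map_sum]
    simp only [ad_apply, pb_C_mul]
  rw [h, map_sum, divisor, Algebra.smul_def, map_sum, Finset.sum_mul]
  refine Finset.sum_congr rfl fun j _ => ?_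
  rw [coeff_C_mul, coeff_pb_act]
  simp only [map_mul, map_sub, map_natCast]
  ring

omit [Algebra ℝ K] in
theorem act_mem_orderIdeal (j : Fin 2) : act K j ∈ orderIdeal _ K 2 :=
  mul_mem_orderIdeal (X_mem_orderIdeal _) (X_mem_orderIdeal _)

theorem quad_mem_orderIdeal (ω : Fin 2 → ℝ) : quad K ω ∈ orderIdeal _ K 2 :=
  sum_mem fun j _ => Ideal.mul_mem_left _ _ (act_mem_orderIdeal j)

omit [Algebra ℝ K] in
theorem coeff_act_eq_zero {m : Coord 2 →₀ ℕ} (hm : ¬IsRes m) (j : Fin 2) :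
    coeff m (act K j) = 0 := by
  classical
  rw [act, X, X, monomial_mul_monomial, coeff_monomial, if_neg]
  rintro rfl
  refine hm fun i => ?_
  by_cases h : i = j
  · subst h; simp
  · simp [h]

theorem coeff_quad_eq_zero (ω : Fin 2 → ℝ) {m : Coord 2 →₀ ℕ} (hm : ¬IsRes m) :
    coeff m (quad K ω) = 0 := by
  rw [quad, map_sum]
  exact Finset.sum_eq_zero fun j _ => by rw [coeff_C_mul, coeff_act_eq_zero hm, mul_zero]

/-- `χ` is the normalised generator of a transformation of `h` into Birkhoff normal form. -/
structure IsNormalizing (h χ : MvPowerSeries (Coord 2) K) : Prop where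
  mem : χ ∈ orderIdeal _ K 3
  res : ∀ m, IsRes m → coeff m χ = 0
  nonres : ∀ m, ¬IsRes m → coeff m (expAd χ h) = 0

variable {ω : Fin 2 → ℝ} {h : MvPowerSeries (Coord 2) K}

theorem mem_of_sub_quad_mem (hh : h - quad K ω ∈ orderIdeal _ K 3) : h ∈ orderIdeal _ K 2 := by
  have := add_mem (orderIdeal_anti (by omega : 2 ≤ 3) hh) (quad_mem_orderIdeal (K := K) ω)
  rwa [sub_add_cancel] at this

/-- Change of `exp (ad χ) h` in degree `d` under a change of `χ` in degree `d`. -/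
theorem coeff_expAd_add_left (hh : h - quad K ω ∈ orderIdeal _ K 3)
    {χ τ : MvPowerSeries (Coord 2) K} (hχ : χ ∈ orderIdeal _ K 3) {d : ℕ} (hd : 3 ≤ d)
    (hτ : τ ∈ orderIdeal _ K d) {m : Coord 2 →₀ ℕ} (hm : m.degree ≤ d) :
    coeff m (expAd (χ + τ) h) = coeff m (expAd χ h) + divisor ω m • coeff m τ := by
  have h1 := expAd_add_left_sub_mem hχ hd hτ (mem_of_sub_quad_mem hh) m (by omega)
  have h2 : pb τ (h - quad K ω) ∈ orderIdeal _ K (d + 1) := pb_mem_orderIdeal hτ hh (by omega)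
  have h3 := h2 m (by omega)
  rw [pb_sub, map_sub, coeff_pb_quad, sub_eq_zero] at h3
  rw [map_sub, map_sub, h3] at h1
  linear_combination h1

/-- Below degree 3 the Lie series leaves the quadratic part as it is, and that part is resonant. -/
theorem coeff_expAd_eq_zero (hh : h - quad K ω ∈ orderIdeal _ K 3)
    {χ : MvPowerSeries (Coord 2) K} (hχ : χ ∈ orderIdeal _ K 3) {m : Coord 2 →₀ ℕ}
    (hm : ¬IsRes m) (hd : m.degree < 3) : coeff m (expAd χ h) = 0 := by
  have h1 := expAd_sub_self_mem hχ (mem_of_sub_quad_mem hh) m hd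
  have h2 := hh m hd
  rw [map_sub, sub_eq_zero] at h1 h2
  rw [h1, h2, coeff_quad_eq_zero ω hm]

variable (hω : ∀ m, divisor ω m = 0 → IsRes m)

include hω in
/-- Normalised generators of Hamiltonians with the same jet have the same jet. -/
theorem IsNormalizing.sub_mem (hh : h - quad K ω ∈ orderIdeal _ K 3)
    {h' χ χ' : MvPowerSeries (Coord 2) K} (hχ : IsNormalizing h χ) (hχ' : IsNormalizing h' χ')
    {e : ℕ} (he : h - h' ∈ orderIdeal _ K e) : χ - χ' ∈ orderIdeal _ K e := by
  suffices H : ∀ d, d ≤ e → χ - χ' ∈ orderIdeal _ K d from H e le_rfl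
  intro d
  induction d with
  | zero => exact fun _ => orderIdeal_zero _
  | succ d ih =>
    intro hde m hm
    have ih' := ih (by omega)
    by_cases hlt : m.degree < d
    · exact ih' m hlt
    by_cases h3 : m.degree < 3
    · exact _root_.sub_mem hχ.mem hχ'.mem m h3
    by_cases hres : IsRes m
    · rw [map_sub, hχ.res m hres, hχ'.res m hres, sub_zero]
    -- In degree `d` the discrepancy of the generators enters multiplied by the divisor. Both
    -- transformed Hamiltonians vanish at the nonresonant exponent `m`, so the discrepancy is zero
    -- there.
    have h1 := coeff_expAd_add_left hh hχ'.mem (by omega) ih' (m := m) (by omega)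
    rw [add_sub_cancel, hχ.nonres m hres] at h1
    have h2 : expAd χ' (h - h') ∈ orderIdeal _ K e := expAd_mem_orderIdeal hχ'.mem he
    have h4 := h2 m (by omega)
    rw [← expAdHom_apply hχ'.mem, map_sub, map_sub, expAdHom_apply, expAdHom_apply,
      hχ'.nonres m hres, sub_zero] at h4
    rw [h4, zero_add] at h1
    have h5 : divisor ω m ≠ 0 := fun h0 => hres (hω m h0)
    have h6 := congrArg ((divisor ω m)⁻¹ • ·) h1.symm
    simpa [smul_smul, inv_mul_cancel₀ h5] using h6

-- This is what transfers symmetries and specialisations of the Hamiltonian to its generator.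
include hω in
theorem IsNormalizing.eq (hh : h - quad K ω ∈ orderIdeal _ K 3)
    {χ χ' : MvPowerSeries (Coord 2) K} (hχ : IsNormalizing h χ) (hχ' : IsNormalizing h χ') :
    χ = χ' :=
  eq_of_sub_mem_orderIdeal fun _ => hχ.sub_mem hω hh hχ' (by rw [sub_self]; exact zero_mem _)

/-- Together with `IsNormalizing.sub_mem` this is locality: the normal form up to a given order
depends only on the jet of the Hamiltonian to that order. -/
theorem expAd_sub_expAd_mem {h' χ χ' : MvPowerSeries (Coord 2) K} (hh : h ∈ orderIdeal _ K 2)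
    (hχ : χ ∈ orderIdeal _ K 3) (hχ' : χ' ∈ orderIdeal _ K 3) {e : ℕ}
    (he : h - h' ∈ orderIdeal _ K e) (hc : χ - χ' ∈ orderIdeal _ K e) :
    expAd χ h - expAd χ' h' ∈ orderIdeal _ K e := by
  have h2 : expAd χ' (h - h') ∈ orderIdeal _ K e := expAd_mem_orderIdeal hχ' he
  rw [← expAdHom_apply hχ', map_sub, expAdHom_apply, expAdHom_apply] at h2
  have h4 : expAd χ h - expAd χ' h ∈ orderIdeal _ K e := by
    by_cases h3 : 3 ≤ e
    · have h1 := expAd_add_left_sub_mem hχ' h3 hc hh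
      rw [add_sub_cancel] at h1
      have h5 := add_mem (orderIdeal_anti (Nat.le_succ e) h1)
        (pb_mem_orderIdeal (c := e) hc hh (by omega))
      rwa [sub_add_cancel] at h5
    · have h1 := sub_mem (expAd_sub_self_mem hχ hh) (expAd_sub_self_mem hχ' hh)
      rw [sub_sub_sub_cancel_right] at h1
      exact orderIdeal_anti (by omega) h1
  convert add_mem h4 h2 using 1
  ring

/-- One step of the recursive construction of the normalised generator. -/
def normStep (ω : Fin 2 → ℝ) (h χ : MvPowerSeries (Coord 2) K) (d : ℕ) :
    MvPowerSeries (Coord 2) K := by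
  classical
  exact fun m => if m.degree = d ∧ ¬IsRes m then
    -((divisor ω m)⁻¹ • coeff m (expAd χ h)) else 0

/-- The partial sums of the normalised generator. -/
def normSeq (ω : Fin 2 → ℝ) (h : MvPowerSeries (Coord 2) K) : ℕ → MvPowerSeries (Coord 2) K
  | 0 => 0
  | d + 1 => normSeq ω h d + normStep ω h (normSeq ω h d) d

theorem coeff_normStep (χ : MvPowerSeries (Coord 2) K) (d : ℕ) (m : Coord 2 →₀ ℕ)
    [Decidable (m.degree = d ∧ ¬IsRes m)] :
    coeff m (normStep ω h χ d) = if m.degree = d ∧ ¬IsRes m then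
      -((divisor ω m)⁻¹ • coeff m (expAd χ h)) else 0 := by
  show normStep ω h χ d m = _
  unfold normStep
  congr

-- The homological equation is solved in one degree at a time. The step in degree `d` leaves lower
-- degrees untouched, so the partial sums stabilise coefficientwise.
include hω in
theorem exists_isNormalizing (hh : h - quad K ω ∈ orderIdeal _ K 3) :
    ∃ χ, IsNormalizing h χ := by
  classical
  -- For `d < 3` there is nothing to remove, so these steps are zero and the generator keeps order
  -- 3.
  have hstep : ∀ χ ∈ orderIdeal _ K 3, ∀ d, normStep ω h χ d ∈ orderIdeal _ K (max 3 d) := by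
    intro χ hχ d m hm
    rw [coeff_normStep]
    split_ifs with h1
    · rw [coeff_expAd_eq_zero hh hχ h1.2 (by omega), smul_zero, neg_zero]
    · rfl
  have hmem : ∀ d, normSeq ω h d ∈ orderIdeal _ K 3 := by
    intro d
    induction d with
    | zero => exact zero_mem _
    | succ d ih => exact add_mem ih (orderIdeal_anti (le_max_left _ _) (hstep _ ih d))
  have hres : ∀ d m, IsRes m → coeff m (normSeq ω h d) = 0 := by
    intro d m hm
    induction d with
    | zero => exact map_zero _
    | succ d ih =>
      rw [normSeq, map_add, ih, coeff_normStep, if_neg (fun h => h.2 hm), zero_add]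
  have hnon : ∀ d m, ¬IsRes m → m.degree < d → coeff m (expAd (normSeq ω h d) h) = 0 := by
    intro d
    induction d with
    | zero => exact fun m _ hm => absurd hm (Nat.not_lt_zero _)
    | succ d ih =>
      intro m hm hmd
      by_cases h3 : m.degree < 3
      · exact coeff_expAd_eq_zero hh (hmem _) hm h3
      rw [normSeq, coeff_expAd_add_left hh (hmem d) (le_max_left 3 d) (hstep _ (hmem d) d)
        (by omega), coeff_normStep]
      have h5 : divisor ω m ≠ 0 := fun h0 => hm (hω m h0)
      by_cases hd : m.degree = d
      · rw [if_pos ⟨hd, hm⟩, smul_neg, smul_smul, mul_inv_cancel₀ h5, one_smul, add_neg_cancel]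
      · rw [if_neg (fun h => hd h.1), smul_zero, add_zero, ih m hm (by omega)]
  -- The coefficient at `m` is final once the step in degree `m.degree` has been made.
  let χ : MvPowerSeries (Coord 2) K := fun m => coeff m (normSeq ω h (m.degree + 1))
  have hco : ∀ m, coeff m χ = coeff m (normSeq ω h (m.degree + 1)) := fun m => rfl
  have hlim : ∀ d, χ - normSeq ω h d ∈ orderIdeal _ K d := by
    intro d m hm
    have : ∀ j, coeff m (normSeq ω h (m.degree + 1 + j)) =
        coeff m (normSeq ω h (m.degree + 1)) := by
      intro j
      induction j with
      | zero => rfl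
      | succ j ih =>
        rw [← add_assoc, normSeq, map_add, ih, coeff_normStep, if_neg (by omega), add_zero]
    rw [map_sub, hco, ← this (d - (m.degree + 1)), Nat.add_sub_cancel' hm, sub_self]
  have hχ3 : χ ∈ orderIdeal _ K 3 := fun m hm => by rw [hco, hmem _ m hm]
  refine ⟨χ, hχ3, fun m hm => by rw [hco, hres _ m hm], fun m hm => ?_⟩
  have := expAd_sub_expAd_mem (e := m.degree + 1) (mem_of_sub_quad_mem hh) hχ3
    (hmem (m.degree + 1)) (by rw [sub_self]; exact zero_mem _) (hlim _) m (by omega)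
  rw [map_sub, sub_eq_zero] at this
  rw [this, hnon _ m hm (by omega)]

/-- Normalised generators are natural in the coefficient ring. -/
theorem IsNormalizing.map {χ : MvPowerSeries (Coord 2) K} (hχ : IsNormalizing h χ)
    (φ : K →ₐ[ℝ] K') :
    IsNormalizing (MvPowerSeries.map φ.toRingHom h) (MvPowerSeries.map φ.toRingHom χ) ∧
    MvPowerSeries.map φ.toRingHom (expAd χ h) =
      expAd (MvPowerSeries.map φ.toRingHom χ) (MvPowerSeries.map φ.toRingHom h) := by
  let W : MvPowerSeries (Coord 2) K →ₗ[ℝ] MvPowerSeries (Coord 2) K' :=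
    { toFun := MvPowerSeries.map φ.toRingHom
      map_add' := map_add _
      map_smul' := fun r f => by
        ext m
        exact map_smul φ r (coeff m f) }
  have e : MvPowerSeries.map φ.toRingHom (expAd χ h) =
      expAd (MvPowerSeries.map φ.toRingHom χ) (MvPowerSeries.map φ.toRingHom h) :=
    expAd_intertwine hχ.mem (map_mem_orderIdeal hχ.mem _) W
      (fun d f hf => map_mem_orderIdeal hf _) (fun f => (pb_map _ _ _).symm) h
  refine ⟨⟨map_mem_orderIdeal hχ.mem _, fun m hm => ?_, fun m hm => ?_⟩, e⟩
  · rw [coeff_map, hχ.res m hm, map_zero]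
  · rw [← e, coeff_map, hχ.nonres m hm, map_zero]

end NormalForm

/-! ### Series in the actions and their brackets -/

section Resonant

variable {K K' : Type*} [CommRing K] [CommRing K']

/-- The exponent of `∏ (ξ_j η_j)^{a_j}`. -/
def diagExp (a : Fin 2 →₀ ℕ) : Coord 2 →₀ ℕ :=
  Finsupp.equivFunOnFinite.symm (Sum.elim a a)

@[simp] theorem diagExp_inl (a : Fin 2 →₀ ℕ) (j : Fin 2) : diagExp a (Sum.inl j) = a j := rfl

@[simp] theorem diagExp_inr (a : Fin 2 →₀ ℕ) (j : Fin 2) : diagExp a (Sum.inr j) = a j := rfl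

theorem isRes_diagExp (a : Fin 2 →₀ ℕ) : IsRes (diagExp a) := fun _ => rfl

theorem coord_ext {m m' : Coord 2 →₀ ℕ} (h1 : ∀ j, m (Sum.inl j) = m' (Sum.inl j))
    (h2 : ∀ j, m (Sum.inr j) = m' (Sum.inr j)) : m = m' := by
  ext s
  rcases s with j | j
  · exact h1 j
  · exact h2 j

theorem IsRes.exists_diagExp {m : Coord 2 →₀ ℕ} (hm : IsRes m) : ∃ a, m = diagExp a :=
  ⟨Finsupp.equivFunOnFinite.symm fun j => m (Sum.inl j), coord_ext (fun _ => rfl)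
    (fun j => (hm j).symm)⟩

theorem diagExp_injective : Function.Injective diagExp := fun a b h => by
  ext j
  exact DFunLike.congr_fun h (Sum.inl j)

theorem act_mem_one (j : Fin 2) : act K j ∈ orderIdeal _ K 1 :=
  orderIdeal_anti (by omega) (act_mem_orderIdeal j)

theorem prod_act_pow (a : Fin 2 →₀ ℕ) :
    (a.prod fun j e => act K j ^ e) = monomial (diagExp a) 1 := by
  rw [Finsupp.prod_fintype _ _ (fun _ => pow_zero _), Fin.prod_univ_two]
  simp only [act, mul_pow, X_pow_eq, monomial_mul_monomial, mul_one]
  refine congrArg (fun m => monomial m (1 : K)) ?_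
  refine coord_ext (fun j => ?_) (fun j => ?_) <;> fin_cases j <;> simp

theorem coeff_subst_act (B : MvPowerSeries (Fin 2) K) (m : Coord 2 →₀ ℕ) :
    coeff m (subst (act K) B) = ∑ᶠ a, coeff a B * coeff m (monomial (diagExp a) (1 : K)) := by
  rw [coeff_subst (hasSubst_of_mem act_mem_one)]
  simp only [prod_act_pow, smul_eq_mul]

theorem coeff_diagExp_subst_act (B : MvPowerSeries (Fin 2) K) (a : Fin 2 →₀ ℕ) :
    coeff (diagExp a) (subst (act K) B) = coeff a B := by
  classical
  rw [coeff_subst_act, finsum_eq_single _ a]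
  · simp
  · intro b hb
    rw [coeff_monomial_ne (fun h => hb (diagExp_injective h.symm)), mul_zero]

theorem coeff_subst_act_eq_zero (B : MvPowerSeries (Fin 2) K) {m : Coord 2 →₀ ℕ}
    (hm : ¬IsRes m) : coeff m (subst (act K) B) = 0 := by
  classical
  rw [coeff_subst_act, finsum_eq_zero_of_forall_eq_zero]
  intro a
  rw [coeff_monomial_ne, mul_zero]
  rintro rfl
  exact hm (isRes_diagExp a)

theorem subst_act_injective : Function.Injective (subst (act K) (R := K)) := fun B B' h => by
  ext a
  rw [← coeff_diagExp_subst_act, h, coeff_diagExp_subst_act]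

/-- A series without nonresonant monomials is a series in the actions. -/
theorem exists_eq_subst_act {f : MvPowerSeries (Coord 2) K}
    (hf : ∀ m, ¬IsRes m → coeff m f = 0) :
    ∃ B : MvPowerSeries (Fin 2) K, f = subst (act K) B := by
  let B : MvPowerSeries (Fin 2) K := fun a => coeff (diagExp a) f
  refine ⟨B, ?_⟩
  ext m
  by_cases hm : IsRes m
  · obtain ⟨a, rfl⟩ := hm.exists_diagExp
    rw [coeff_diagExp_subst_act]
    rfl
  · rw [hf m hm, coeff_subst_act_eq_zero _ hm]

/-- The derivative of a resonant series with respect to the action `ξ_j η_j`. -/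
def actDeriv (j : Fin 2) (g : MvPowerSeries (Coord 2) K) : MvPowerSeries (Coord 2) K :=
  fun m => coeff (m + Finsupp.single (Sum.inl j) 1 + Finsupp.single (Sum.inr j) 1) g *
    (m (Sum.inl j) + 1)

theorem coeff_actDeriv (j : Fin 2) (g : MvPowerSeries (Coord 2) K) (m : Coord 2 →₀ ℕ) :
    coeff m (actDeriv j g) =
      coeff (m + Finsupp.single (Sum.inl j) 1 + Finsupp.single (Sum.inr j) 1) g *
        (m (Sum.inl j) + 1) := rfl

/-- The Euler operator `η_j ∂_{η_j} - ξ_j ∂_{ξ_j}`. -/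
def euler (j : Fin 2) (f : MvPowerSeries (Coord 2) K) : MvPowerSeries (Coord 2) K :=
  X (Sum.inr j) * pderiv K (Sum.inr j) f - X (Sum.inl j) * pderiv K (Sum.inl j) f

theorem coeff_euler (j : Fin 2) (f : MvPowerSeries (Coord 2) K) (m : Coord 2 →₀ ℕ) :
    coeff m (euler j f) = ((m (Sum.inr j) : K) - (m (Sum.inl j) : K)) * coeff m f := by
  rw [euler, map_sub, coeff_X_mul_pderiv, coeff_X_mul_pderiv, sub_mul]

variable {g : MvPowerSeries (Coord 2) K} (hg : ∀ m, ¬IsRes m → coeff m g = 0)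

include hg in
theorem coeff_actDeriv_eq_zero (j : Fin 2) {m : Coord 2 →₀ ℕ} (hm : ¬IsRes m) :
    coeff m (actDeriv j g) = 0 := by
  rw [coeff_actDeriv, hg, zero_mul]
  intro h
  refine hm fun i => ?_
  have := h i
  by_cases hij : i = j
  · subst hij; simpa using this
  · simpa [Finsupp.single_apply, Ne.symm hij] using this

-- Chain rule: a resonant series depends on `ξ_j` only through `ξ_j η_j`.
include hg in
theorem pderiv_inl_of_res (j : Fin 2) :
    pderiv K (Sum.inl j) g = X (Sum.inr j) * actDeriv j g := by
  classical
  ext m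
  rw [coeff_pderiv, X, coeff_monomial_mul, one_mul]
  split_ifs with h
  · rw [coeff_actDeriv]
    congr 2
    · congr 1
      rw [add_right_comm, tsub_add_cancel_of_le h]
    · simp
  · rw [hg, zero_mul]
    intro hres
    have h1 := hres j
    have h2 : m (Sum.inr j) = 0 := by
      by_contra hne
      exact h (by simpa using Nat.one_le_iff_ne_zero.mpr hne)
    simp [h2] at h1

include hg in
theorem pderiv_inr_of_res (j : Fin 2) :
    pderiv K (Sum.inr j) g = X (Sum.inl j) * actDeriv j g := by
  classical
  ext m
  rw [coeff_pderiv, X, coeff_monomial_mul, one_mul]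
  split_ifs with h
  · have h1 : 1 ≤ m (Sum.inl j) := by simpa using h (Sum.inl j)
    rw [coeff_actDeriv, tsub_add_cancel_of_le h]
    by_cases hres : IsRes (m + Finsupp.single (Sum.inr j) 1)
    · have h2 := hres j
      simp at h2
      congr 1
      rw [Finsupp.tsub_apply, Finsupp.single_eq_same, h2]
      simp
    · rw [hg _ hres, zero_mul, zero_mul]
  · rw [hg, zero_mul]
    intro hres
    have h1 := hres j
    have h2 : m (Sum.inl j) = 0 := by
      by_contra hne
      exact h (by simpa using Nat.one_le_iff_ne_zero.mpr hne)
    simp [h2] at h1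

-- The Hamiltonian field of a series in the actions rotates each coordinate plane, with an angular
-- speed that is itself a resonant series.
include hg in
theorem pb_of_res (f : MvPowerSeries (Coord 2) K) :
    pb g f = ∑ j, actDeriv j g * euler j f := by
  rw [pb]
  refine Finset.sum_congr rfl fun j _ => ?_
  rw [pderiv_inl_of_res hg, pderiv_inr_of_res hg, euler]
  ring

/-- The part of a series formed by the monomials `ξ^a η^b` with `a - b = c`. -/
def weightPart (c : Fin 2 → ℤ) (f : MvPowerSeries (Coord 2) K) : MvPowerSeries (Coord 2) K := by
  classical
  exact fun m => if ∀ j, (m (Sum.inl j) : ℤ) - m (Sum.inr j) = c j then coeff m f else 0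

theorem coeff_weightPart (c : Fin 2 → ℤ) (f : MvPowerSeries (Coord 2) K) (m : Coord 2 →₀ ℕ)
    [Decidable (∀ j, (m (Sum.inl j) : ℤ) - m (Sum.inr j) = c j)] :
    coeff m (weightPart c f) =
      if ∀ j, (m (Sum.inl j) : ℤ) - m (Sum.inr j) = c j then coeff m f else 0 := by
  show weightPart c f m = _
  unfold weightPart
  congr

theorem weightPart_sum (c : Fin 2 → ℤ) (F : Fin 2 → MvPowerSeries (Coord 2) K) :
    weightPart c (∑ j, F j) = ∑ j, weightPart c (F j) := by
  classical
  ext m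
  simp only [coeff_weightPart, map_sum]
  split_ifs <;> simp

theorem weightPart_euler (c : Fin 2 → ℤ) (j : Fin 2) (f : MvPowerSeries (Coord 2) K) :
    weightPart c (euler j f) = C (-(c j : K)) * weightPart c f := by
  classical
  ext m
  simp only [coeff_weightPart, coeff_C_mul, coeff_euler]
  split_ifs with h
  · rw [← h j]
    push_cast
    ring
  · rw [mul_zero]

include hg in
theorem weightPart_mul (c : Fin 2 → ℤ) (f : MvPowerSeries (Coord 2) K) :
    weightPart c (g * f) = g * weightPart c f := by
  classical
  ext m
  rw [coeff_weightPart, coeff_mul, coeff_mul]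
  by_cases h : ∀ j, (m (Sum.inl j) : ℤ) - m (Sum.inr j) = c j
  -- Only resonant `p.1` contribute, and these do not alter the weight, so `p.2` has weight `c`
  -- exactly when `m` has. One script serves both cases; the alternatives of `first` select between
  -- them.
  all_goals
    first | rw [if_pos h] | rw [if_neg h]
    first | refine Finset.sum_congr rfl fun p hp => ?_ | refine (Finset.sum_eq_zero fun p hp => ?_).symm
    rw [Finset.HasAntidiagonal.mem_antidiagonal] at hp
    subst hp
    by_cases h1 : IsRes p.1
    · rw [coeff_weightPart]
      first
      | rw [if_pos]
        intro j
        have h2 := h j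
        have h3 := h1 j
        simp only [Finsupp.add_apply] at h2
        push_cast at h2
        omega
      | rw [if_neg, mul_zero]
        intro h'
        refine h fun j => ?_
        have h2 := h' j
        have h3 := h1 j
        simp only [Finsupp.add_apply]
        push_cast
        omega
    · simp [hg _ h1]

-- On each weight the bracket becomes multiplication by one power series. Over a domain its kernel
-- is zero unless that series is zero.
include hg in
theorem weightPart_pb (c : Fin 2 → ℤ) (f : MvPowerSeries (Coord 2) K) :
    weightPart c (pb g f) = -((∑ j, C (c j : K) * actDeriv j g) * weightPart c f) := by
  rw [pb_of_res hg, weightPart_sum, Finset.sum_mul, ← Finset.sum_neg_distrib]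
  refine Finset.sum_congr rfl fun j _ => ?_
  rw [weightPart_mul (fun m hm => coeff_actDeriv_eq_zero hg j hm), weightPart_euler, map_neg]
  ring

/-- The frequency map at the origin is `ω`, so the multiplier in `weightPart_pb` has constant term
`-ω · c`. -/
theorem constantCoeff_actDeriv_quad [Algebra ℝ K] (ω : Fin 2 → ℝ)
    {b : MvPowerSeries (Coord 2) K} (hb : b - quad K ω ∈ orderIdeal _ K 3) (j : Fin 2) :
    coeff 0 (actDeriv j b) = algebraMap ℝ K (ω j) := by
  classical
  rw [coeff_actDeriv]
  have h := hb (0 + Finsupp.single (Sum.inl j) 1 + Finsupp.single (Sum.inr j) 1)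
    (by simp [Finsupp.degree_single])
  rw [map_sub, sub_eq_zero] at h
  rw [h, quad, map_sum, Finset.sum_eq_single j]
  · rw [coeff_C_mul, act, X, X, monomial_mul_monomial, zero_add, coeff_monomial_same]
    simp
  · intro i _ hij
    rw [coeff_C_mul, act, X, X, monomial_mul_monomial, coeff_monomial_ne, mul_zero]
    intro h0
    have := DFunLike.congr_fun h0 (Sum.inl j)
    simp [hij] at this
  · simp

end Resonant

/-! ### Symplectic maps between normal forms fix the actions -/

section Uniqueness

/-- A bracket preserving homomorphism tangent to the identity that maps a nonresonant Birkhoff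
normal form to a normal form fixes the actions. -/
theorem fix_act {ω : Fin 2 → ℝ} (hω : ∀ m, divisor ω m = 0 → IsRes m)
    (Ψ : MvPowerSeries (Coord 2) ℂ →ₐ[ℂ] MvPowerSeries (Coord 2) ℂ)
    (hord : ∀ d, ∀ f ∈ orderIdeal _ ℂ d, Ψ f ∈ orderIdeal _ ℂ d)
    (hpb : ∀ f g, Ψ (pb f g) = pb (Ψ f) (Ψ g))
    (htan : ∀ s, Ψ (X s) - X s ∈ orderIdeal _ ℂ 2)
    {b b' : MvPowerSeries (Coord 2) ℂ} (hb : ∀ m, ¬IsRes m → coeff m b = 0)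
    (hb' : ∀ m, ¬IsRes m → coeff m b' = 0) (hq : b' - quad ℂ ω ∈ orderIdeal _ ℂ 3)
    (hbb' : Ψ b = b') (j : Fin 2) : Ψ (act ℂ j) = act ℂ j := by
  classical
  have hact : ∀ i m, ¬IsRes m → coeff m (act ℂ i) = 0 := fun i m hm => coeff_act_eq_zero hm i
  -- The image of an action commutes with `b'`. On a nonresonant weight the bracket with `b'`
  -- multiplies by a series with nonzero constant term, so that weight is absent.
  have hu : ∀ i m, ¬IsRes m → coeff m (Ψ (act ℂ i)) = 0 := by
    intro i m hm
    have h1 : pb b' (Ψ (act ℂ i)) = 0 := by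
      have h2 : pb b (act ℂ i) = 0 := by
        ext m
        rw [coeff_pb_act, map_zero]
        by_cases hm : IsRes m
        · rw [hm i, sub_self, zero_mul]
        · rw [hb m hm, mul_zero]
      rw [← hbb', ← hpb, h2, map_zero]
    set c : Fin 2 → ℤ := fun j => (m (Sum.inl j) : ℤ) - m (Sum.inr j) with hc
    have h2 := weightPart_pb hb' c (Ψ (act ℂ i))
    rw [h1] at h2
    have h3 : weightPart c (0 : MvPowerSeries (Coord 2) ℂ) = 0 := by
      ext m'
      rw [coeff_weightPart]
      simp
    rw [h3, eq_comm, neg_eq_zero, mul_eq_zero] at h2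
    rcases h2 with h2 | h2
    · exfalso
      have h4 := congrArg (coeff 0) h2
      simp only [map_sum, coeff_C_mul, constantCoeff_actDeriv_quad ω hq, map_zero] at h4
      refine hm (hω m ?_)
      have h5 : ((divisor ω m : ℝ) : ℂ) = 0 := by
        rw [← h4, divisor]
        push_cast
        refine Finset.sum_congr rfl fun j _ => ?_
        simp only [hc]
        push_cast
        rw [mul_comm]
        rfl
      exact_mod_cast h5
    · have h4 := congrArg (coeff m) h2
      rwa [coeff_weightPart, if_pos (fun _ => rfl), map_zero] at h4
  -- `Ψ` carries the bracket of `I_j` with `ξ_i` to that of `Ψ I_j` with `Ψ ξ_i`. In the part of `Ψ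
  -- ξ_i` of the weight of `ξ_i`, nonzero by tangency to the identity, the eigenvalue can be
  -- compared and cancelled.
  have hderiv : ∀ i, actDeriv i (Ψ (act ℂ j)) = C (if i = j then 1 else 0) := by
    intro i
    set v := Ψ (X (Sum.inl i)) with hv
    have h1 : pb (Ψ (act ℂ j)) v = -(C (if i = j then 1 else 0) * v) := by
      have h2 : pb (act ℂ j) (X (Sum.inl i)) =
          -(C (if i = j then 1 else 0) * X (Sum.inl i)) := by
        rw [pb_swap]
        congr 1
        ext m
        rw [coeff_pb_act, coeff_C_mul, coeff_X]
        by_cases hm : m = Finsupp.single (Sum.inl i) 1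
        · subst hm
          simp [Finsupp.single_apply]
        · simp [hm]
      have h3 : Ψ (C (if i = j then (1 : ℂ) else 0)) = C (if i = j then 1 else 0) :=
        Ψ.commutes (if i = j then (1 : ℂ) else 0)
      rw [hv, ← hpb, h2, map_neg, map_mul, h3]
    let c : Fin 2 → ℤ := fun l => if l = i then 1 else 0
    have h2 := weightPart_pb (hu j) c v
    have h3 : ∑ l, C (c l : ℂ) * actDeriv l (Ψ (act ℂ j)) = actDeriv i (Ψ (act ℂ j)) := by
      rw [Finset.sum_eq_single i]
      · simp [c]
      · intro l _ hl
        simp [c, hl]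
      · simp
    have h4 : weightPart c (-(C (if i = j then (1 : ℂ) else 0) * v)) =
        -(C (if i = j then 1 else 0) * weightPart c v) := by
      ext m
      simp only [coeff_weightPart, map_neg, coeff_C_mul]
      split_ifs <;> simp
    rw [h1, h3, h4, neg_inj] at h2
    have hne : weightPart c v ≠ 0 := by
      intro h0
      have h5 := congrArg (coeff (Finsupp.single (Sum.inl i) 1)) h0
      rw [coeff_weightPart, if_pos, map_zero] at h5
      · have h6 := htan (Sum.inl i) (Finsupp.single (Sum.inl i) 1)
          (by simp [Finsupp.degree_single])
        rw [map_sub, ← hv, h5, coeff_X, if_pos rfl] at h6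
        norm_num at h6
      · intro l
        by_cases hl : l = i
        · subst hl; simp [c]
        · simp [c, hl]
    exact (mul_right_cancel₀ hne h2).symm
  ext m
  by_cases hm : IsRes m
  swap
  · rw [hu j m hm, hact j m hm]
  by_cases h0 : m = 0
  · subst h0
    have h1 := hord 2 _ (act_mem_orderIdeal j) 0 (by simp)
    have h2 := act_mem_orderIdeal (K := ℂ) j 0 (by simp)
    rw [h1, h2]
  · obtain ⟨i, hi⟩ : ∃ i, m (Sum.inl i) ≠ 0 := by
      by_contra! hall
      exact h0 (coord_ext hall fun i => by rw [← hm i]; exact hall i)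
    -- A nonconstant resonant monomial contains some `ξ_i`, so equality of the derivatives
    -- determines its coefficient in characteristic zero.
    have h1 : pderiv ℂ (Sum.inl i) (Ψ (act ℂ j)) = pderiv ℂ (Sum.inl i) (act ℂ j) := by
      rw [pderiv_inl_of_res (hu j), hderiv, act, Derivation.leibniz, pderiv_X, pderiv_X]
      by_cases hij : i = j
      · subst hij; simp
      · simp [hij, Ne.symm hij]
    have h2 := congrArg (coeff (m - Finsupp.single (Sum.inl i) 1)) h1
    have hle : Finsupp.single (Sum.inl i) 1 ≤ m := by
      simpa using Nat.one_le_iff_ne_zero.mpr hi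
    rw [coeff_pderiv, coeff_pderiv, tsub_add_cancel_of_le hle] at h2
    refine mul_right_cancel₀ ?_ h2
    norm_cast

end Uniqueness

/-! ### Passage between `(x,y)` and `(ξ,η)` -/

section ComplexCoordinates

/-- The coordinates `x_j`, `y_j` in terms of `ξ_j`, `η_j`. -/
def xyOfXiEta : Coord 2 → MvPowerSeries (Coord 2) ℂ
  | Sum.inl j => C ((Real.sqrt 2 : ℂ)⁻¹) * (X (Sum.inl j) + X (Sum.inr j))
  | Sum.inr j => C (-(Complex.I * (Real.sqrt 2 : ℂ)⁻¹)) * (X (Sum.inl j) - X (Sum.inr j))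

/-- The coordinates `ξ_j`, `η_j` in terms of `x_j`, `y_j`. -/
def xiEtaOfXY : Coord 2 → MvPowerSeries (Coord 2) ℂ
  | Sum.inl j => C ((Real.sqrt 2 : ℂ)⁻¹) * (X (Sum.inl j) + C Complex.I * X (Sum.inr j))
  | Sum.inr j => C ((Real.sqrt 2 : ℂ)⁻¹) * (X (Sum.inl j) - C Complex.I * X (Sum.inr j))

theorem inv_sqrt_two_mul_self : (Real.sqrt 2 : ℂ)⁻¹ * (Real.sqrt 2 : ℂ)⁻¹ = 1 / 2 := by
  rw [← mul_inv, ← Complex.ofReal_mul, Real.mul_self_sqrt (by norm_num)]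
  norm_num

theorem C_inv_sqrt_two_mul_self :
    (C ((Real.sqrt 2 : ℂ)⁻¹) * C ((Real.sqrt 2 : ℂ)⁻¹) : MvPowerSeries (Coord 2) ℂ) =
      C (1 / 2) := by
  rw [← map_mul, inv_sqrt_two_mul_self]

theorem C_I_mul_self : (C Complex.I * C Complex.I : MvPowerSeries (Coord 2) ℂ) = -1 := by
  rw [← map_mul, Complex.I_mul_I, map_neg, map_one]

theorem two_mul_C_half : (2 * C (1 / 2) : MvPowerSeries (Coord 2) ℂ) = 1 := by
  rw [show (2 : MvPowerSeries (Coord 2) ℂ) = C 2 from (map_ofNat C 2).symm, ← map_mul]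
  norm_num

theorem xyOfXiEta_mem (s : Coord 2) : xyOfXiEta s ∈ orderIdeal _ ℂ 1 := by
  rcases s with j | j
  · exact Ideal.mul_mem_left _ _ (add_mem (X_mem_orderIdeal _) (X_mem_orderIdeal _))
  · exact Ideal.mul_mem_left _ _ (sub_mem (X_mem_orderIdeal _) (X_mem_orderIdeal _))

theorem xiEtaOfXY_mem (s : Coord 2) : xiEtaOfXY s ∈ orderIdeal _ ℂ 1 := by
  rcases s with j | j
  · exact Ideal.mul_mem_left _ _ (add_mem (X_mem_orderIdeal _)
      (Ideal.mul_mem_left _ _ (X_mem_orderIdeal _)))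
  · exact Ideal.mul_mem_left _ _ (sub_mem (X_mem_orderIdeal _)
      (Ideal.mul_mem_left _ _ (X_mem_orderIdeal _)))

theorem subst_xyOfXiEta_xiEtaOfXY (s : Coord 2) : subst xyOfXiEta (xiEtaOfXY s) = X s := by
  have h := hasSubst_of_mem xyOfXiEta_mem
  have hC : ∀ r : ℂ, subst xyOfXiEta (C r : MvPowerSeries (Coord 2) ℂ) =
    (C r : MvPowerSeries (Coord 2) ℂ) := fun r => subst_C r
  have h1 := C_inv_sqrt_two_mul_self
  have h2 := C_I_mul_self
  have h3 := two_mul_C_half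
  rcases s with j | j
  · rw [xiEtaOfXY, subst_mul h, subst_add h, subst_mul h, hC, hC, subst_X h, subst_X h,
      xyOfXiEta, xyOfXiEta, map_neg, map_mul]
    linear_combination (X (Sum.inl j)) * h3 +
      (X (Sum.inl j) + X (Sum.inr j) - C Complex.I * C Complex.I * (X (Sum.inl j) - X (Sum.inr j)))
        * h1 - (C (1 / 2)) * (X (Sum.inl j) - X (Sum.inr j)) * h2
  · rw [xiEtaOfXY, subst_mul h, subst_sub h, subst_mul h, hC, hC, subst_X h, subst_X h,
      xyOfXiEta, xyOfXiEta, map_neg, map_mul]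
    linear_combination (X (Sum.inr j)) * h3 +
      (X (Sum.inl j) + X (Sum.inr j) + C Complex.I * C Complex.I * (X (Sum.inl j) - X (Sum.inr j)))
        * h1 + (C (1 / 2)) * (X (Sum.inl j) - X (Sum.inr j)) * h2

theorem subst_xiEtaOfXY_xyOfXiEta (s : Coord 2) : subst xiEtaOfXY (xyOfXiEta s) = X s := by
  have h := hasSubst_of_mem xiEtaOfXY_mem
  have hC : ∀ r : ℂ, subst xiEtaOfXY (C r : MvPowerSeries (Coord 2) ℂ) =
    (C r : MvPowerSeries (Coord 2) ℂ) := fun r => subst_C r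
  have h1 := C_inv_sqrt_two_mul_self
  have h2 := C_I_mul_self
  have h3 := two_mul_C_half
  rcases s with j | j
  · rw [xyOfXiEta, subst_mul h, subst_add h, hC, subst_X h, subst_X h, xiEtaOfXY, xiEtaOfXY]
    linear_combination (X (Sum.inl j)) * h3 + 2 * X (Sum.inl j) * h1
  · rw [xyOfXiEta, subst_mul h, subst_sub h, hC, subst_X h, subst_X h, xiEtaOfXY, xiEtaOfXY,
      map_neg, map_mul]
    linear_combination (X (Sum.inr j)) * h3 -
      2 * C Complex.I * C Complex.I * X (Sum.inr j) * h1 - 2 * C (1 / 2) * X (Sum.inr j) * h2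

theorem pb_X_X {K : Type*} [CommRing K] (s t : Coord 2) :
    pb (X s : MvPowerSeries (Coord 2) K) (X t) =
      match s, t with
      | Sum.inl i, Sum.inr j => if i = j then 1 else 0
      | Sum.inr i, Sum.inl j => if i = j then -1 else 0
      | _, _ => 0 := by
  classical
  rcases s with i | i <;> rcases t with j | j
  · rw [pb_X_inl, pderiv_X_of_ne (by simp), neg_zero]
  · rw [pb_X_inr, pderiv_X]
    by_cases h : i = j
    · subst h; simp
    · simp [h]
  · rw [pb_X_inl, pderiv_X]
    by_cases h : i = j
    · subst h; simp
    · simp [h]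
  · rw [pb_X_inr, pderiv_X_of_ne (by simp)]

/-- The change of coordinates is symplectic only up to the constant factor `i`, which the bracket
computations below must carry along. -/
theorem pb_xyOfXiEta (s t : Coord 2) :
    pb (xyOfXiEta s) (xyOfXiEta t) = C Complex.I * pb (X s) (X t) := by
  have h1 := C_inv_sqrt_two_mul_self
  have h3 := two_mul_C_half
  rcases s with i | i <;> rcases t with j | j <;>
    simp only [xyOfXiEta, C_mul_pb, pb_C_mul, add_pb, pb_add, sub_pb, pb_sub, pb_X_X] <;>
    (try split_ifs) <;> (try simp only [map_neg, map_mul]) <;> try ring1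
  · linear_combination C Complex.I * h3 + 2 * C Complex.I * h1
  · linear_combination - C Complex.I * h3 - 2 * C Complex.I * h1

theorem pb_xiEtaOfXY (s t : Coord 2) :
    pb (xiEtaOfXY s) (xiEtaOfXY t) = C (-Complex.I) * pb (X s) (X t) := by
  have h1 := C_inv_sqrt_two_mul_self
  have h3 := two_mul_C_half
  rcases s with i | i <;> rcases t with j | j <;>
    simp only [xiEtaOfXY, C_mul_pb, pb_C_mul, add_pb, pb_add, sub_pb, pb_sub, pb_X_X] <;>
    (try split_ifs) <;> (try simp only [map_neg]) <;> try ring1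
  · linear_combination - C Complex.I * h3 - 2 * C Complex.I * h1
  · linear_combination C Complex.I * h3 + 2 * C Complex.I * h1

/-- Complexification of a real series. -/
abbrev cplx {σ : Type*} (f : MvPowerSeries σ ℝ) : MvPowerSeries σ ℂ :=
  MvPowerSeries.map Complex.ofRealHom f

theorem cplx_injective {σ : Type*} : Function.Injective (cplx (σ := σ)) := fun f g h => by
  ext m
  have := congrArg (coeff m) h
  simpa using this

/-- A real series in `(x,y)` written as a complex series in `(ξ,η)`. -/
def toXiEta (f : MvPowerSeries (Coord 2) ℝ) : MvPowerSeries (Coord 2) ℂ :=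
  subst xyOfXiEta (cplx f)

theorem subst_xiEtaOfXY_subst (f : MvPowerSeries (Coord 2) ℂ) :
    subst xiEtaOfXY (subst xyOfXiEta f) = f := by
  rw [subst_comp_subst_apply (hasSubst_of_mem xyOfXiEta_mem) (hasSubst_of_mem xiEtaOfXY_mem)]
  simp only [subst_xiEtaOfXY_xyOfXiEta]
  exact congrFun subst_self f

theorem subst_xyOfXiEta_subst (f : MvPowerSeries (Coord 2) ℂ) :
    subst xyOfXiEta (subst xiEtaOfXY f) = f := by
  rw [subst_comp_subst_apply (hasSubst_of_mem xiEtaOfXY_mem) (hasSubst_of_mem xyOfXiEta_mem)]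
  simp only [subst_xyOfXiEta_xiEtaOfXY]
  exact congrFun subst_self f

theorem toXiEta_injective : Function.Injective toXiEta := fun f g h => by
  refine cplx_injective ?_
  rw [← subst_xiEtaOfXY_subst (cplx f), ← subst_xiEtaOfXY_subst (cplx g)]
  exact congrArg _ h

theorem toXiEta_X (s : Coord 2) : toXiEta (X s) = xyOfXiEta s := by
  rw [toXiEta, cplx, map_X, subst_X (hasSubst_of_mem xyOfXiEta_mem)]

theorem toXiEta_sub (f g : MvPowerSeries (Coord 2) ℝ) :
    toXiEta (f - g) = toXiEta f - toXiEta g := by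
  rw [toXiEta, cplx, map_sub, subst_sub (hasSubst_of_mem xyOfXiEta_mem)]
  rfl

theorem toXiEta_mem {d : ℕ} {f : MvPowerSeries (Coord 2) ℝ} :
    toXiEta f ∈ orderIdeal _ ℂ d ↔ f ∈ orderIdeal _ ℝ d := by
  constructor
  · intro h m hm
    have h1 := subst_mem_orderIdeal xiEtaOfXY_mem h m hm
    rw [toXiEta, subst_xiEtaOfXY_subst, coeff_map] at h1
    simpa using h1
  · intro h
    exact subst_mem_orderIdeal xyOfXiEta_mem (map_mem_orderIdeal h _)

theorem toXiEta_subst {σ : Type*} [Finite σ] {a : σ → MvPowerSeries (Coord 2) ℝ}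
    (ha : ∀ s, a s ∈ orderIdeal _ ℝ 1) (f : MvPowerSeries σ ℝ) :
    toXiEta (subst a f) = subst (fun s => toXiEta (a s)) (cplx f) := by
  have h1 := hasSubst_of_mem ha
  rw [toXiEta, cplx, map_subst h1,
    subst_comp_subst_apply (h1.map _) (hasSubst_of_mem xyOfXiEta_mem)]
  rfl

theorem pb_toXiEta (f g : MvPowerSeries (Coord 2) ℝ) :
    pb (toXiEta f) (toXiEta g) = C Complex.I * toXiEta (pb f g) := by
  rw [toXiEta, toXiEta, pb_subst xyOfXiEta_mem _ pb_xyOfXiEta, pb_map]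
  rfl

theorem toXiEta_formalAction (j : Fin 2) : toXiEta (formalAction j) = act ℂ j := by
  have h := hasSubst_of_mem xyOfXiEta_mem
  have h1 := C_inv_sqrt_two_mul_self
  have h2 := C_I_mul_self
  have h3 := two_mul_C_half
  have hC : ∀ r : ℂ, subst xyOfXiEta (C r : MvPowerSeries (Coord 2) ℂ) =
    (C r : MvPowerSeries (Coord 2) ℂ) := fun r => subst_C r
  have h4 : cplx (formalAction j) = C (1 / 2) * (X (Sum.inl j) ^ 2 + X (Sum.inr j) ^ 2) := by
    simp [cplx, formalAction]
  rw [toXiEta, h4, subst_mul h, subst_add h, subst_pow h, subst_pow h, subst_X h, subst_X h, hC,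
    xyOfXiEta, xyOfXiEta, act, map_neg, map_mul]
  set A : MvPowerSeries (Coord 2) ℂ := X (Sum.inl j)
  set B : MvPowerSeries (Coord 2) ℂ := X (Sum.inr j)
  linear_combination (C (1 / 2)) * ((A + B) ^ 2 + C Complex.I * C Complex.I * (A - B) ^ 2) * h1 +
    C (1 / 2) * C (1 / 2) * (A - B) ^ 2 * h2 + A * B * (1 + 2 * C (1 / 2)) * h3

theorem formalAction_mem (j : Fin 2) : formalAction j ∈ orderIdeal _ ℝ 1 := by
  rw [← toXiEta_mem, toXiEta_formalAction]
  exact act_mem_one j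

theorem toXiEta_subst_formalAction (B : MvPowerSeries (Fin 2) ℝ) :
    toXiEta (subst formalAction B) = subst (act ℂ) (cplx B) := by
  rw [toXiEta_subst formalAction_mem]
  simp only [toXiEta_formalAction]

theorem cplx_subst_act (B : MvPowerSeries (Fin 2) ℝ) :
    cplx (subst (act ℝ) B) = subst (act ℂ) (cplx B) := by
  rw [cplx, map_subst (hasSubst_of_mem act_mem_one)]
  congr 1
  funext j
  simp [act]

theorem cplx_quad (ω : Fin 2 → ℝ) : cplx (quad ℝ ω) = quad ℂ ω := by
  simp [quad, act]

end ComplexCoordinates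

/-! ### The exchange of `ξ` and `η` -/

section Swap

variable {K : Type*} [CommRing K]

/-- The substitution that exchanges `ξ` and `η`. -/
def swapVars (f : MvPowerSeries (Coord 2) K) : MvPowerSeries (Coord 2) K :=
  subst (fun s : Coord 2 => (X s.swap : MvPowerSeries (Coord 2) K)) f

theorem hasSubst_swap : HasSubst (fun s : Coord 2 => (X s.swap : MvPowerSeries (Coord 2) K)) :=
  hasSubst_of_mem fun _ => X_mem_orderIdeal _

theorem swapVars_X (s : Coord 2) : swapVars (X s : MvPowerSeries (Coord 2) K) = X s.swap := by
  rw [swapVars, subst_X hasSubst_swap]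

theorem swapVars_C (c : K) : swapVars (C c) = C c := subst_C c

theorem swapVars_mul (f g : MvPowerSeries (Coord 2) K) :
    swapVars (f * g) = swapVars f * swapVars g := subst_mul hasSubst_swap f g

theorem swapVars_add (f g : MvPowerSeries (Coord 2) K) :
    swapVars (f + g) = swapVars f + swapVars g := subst_add hasSubst_swap f g

theorem swapVars_sub (f g : MvPowerSeries (Coord 2) K) :
    swapVars (f - g) = swapVars f - swapVars g := subst_sub hasSubst_swap f g

theorem swapVars_pow (f : MvPowerSeries (Coord 2) K) (n : ℕ) :
    swapVars (f ^ n) = swapVars f ^ n := subst_pow hasSubst_swap f n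

theorem swapVars_mem {d : ℕ} {f : MvPowerSeries (Coord 2) K} (hf : f ∈ orderIdeal _ K d) :
    swapVars f ∈ orderIdeal _ K d :=
  subst_mem_orderIdeal (fun _ => X_mem_orderIdeal _) hf

theorem pb_swapVars (f g : MvPowerSeries (Coord 2) K) :
    pb (swapVars f) (swapVars g) = -swapVars (pb f g) := by
  rw [swapVars, swapVars, pb_subst (fun _ => X_mem_orderIdeal _) (-1)]
  · rw [map_neg, map_one, neg_one_mul]; rfl
  · intro s t
    rw [pb_X_X, pb_X_X]
    rcases s with i | i <;> rcases t with j | j <;> by_cases h : i = j <;> simp [h]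

/-- The exponent with the roles of `ξ` and `η` exchanged. -/
def swapExp (m : Coord 2 →₀ ℕ) : Coord 2 →₀ ℕ :=
  Finsupp.embDomain (Equiv.sumComm (Fin 2) (Fin 2)).toEmbedding m

theorem swapExp_inl (m : Coord 2 →₀ ℕ) (j : Fin 2) : swapExp m (Sum.inl j) = m (Sum.inr j) :=
  Finsupp.embDomain_apply_self (Equiv.sumComm (Fin 2) (Fin 2)).toEmbedding m (Sum.inr j)

theorem swapExp_inr (m : Coord 2 →₀ ℕ) (j : Fin 2) : swapExp m (Sum.inr j) = m (Sum.inl j) :=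
  Finsupp.embDomain_apply_self (Equiv.sumComm (Fin 2) (Fin 2)).toEmbedding m (Sum.inl j)

theorem swapExp_swapExp (m : Coord 2 →₀ ℕ) : swapExp (swapExp m) = m :=
  coord_ext (fun j => by rw [swapExp_inl, swapExp_inr])
    (fun j => by rw [swapExp_inr, swapExp_inl])

theorem isRes_swapExp {m : Coord 2 →₀ ℕ} : IsRes (swapExp m) ↔ IsRes m := by
  simp only [IsRes, swapExp_inl, swapExp_inr]
  exact forall_congr' fun _ => eq_comm

theorem coeff_swapVars (f : MvPowerSeries (Coord 2) K) (m : Coord 2 →₀ ℕ) :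
    coeff m (swapVars f) = coeff (swapExp m) f := by
  have h := coeff_embDomain_rename (Equiv.sumComm (Fin 2) (Fin 2)).toEmbedding f (swapExp m)
  rw [rename_eq_subst] at h
  rw [← h]
  conv_lhs => rw [← swapExp_swapExp m]
  rfl

variable [Algebra ℝ K]

/-- Swapping variables as a real linear map. -/
def swapLin : MvPowerSeries (Coord 2) K →ₗ[ℝ] MvPowerSeries (Coord 2) K where
  toFun := swapVars
  map_add' := swapVars_add
  map_smul' := fun r f => by
    ext m
    rw [coeff_swapVars]
    show r • coeff (swapExp m) f = r • coeff m (swapVars f)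
    rw [coeff_swapVars]

/-- The exchange reverses the sign of the bracket, so it turns the flow of `χ` into that of
`-swapVars χ`. The latter normalises the same symmetric Hamiltonian, and uniqueness applies. -/
theorem IsNormalizing.swapVars_eq {ω : Fin 2 → ℝ} (hω : ∀ m, divisor ω m = 0 → IsRes m)
    {h χ : MvPowerSeries (Coord 2) K} (hh : h - quad K ω ∈ orderIdeal _ K 3)
    (hs : swapVars h = h) (hχ : IsNormalizing h χ) : swapVars χ = -χ := by
  have hmem : -swapVars χ ∈ orderIdeal _ K 3 := neg_mem (swapVars_mem hχ.mem)
  have e : swapVars (expAd χ h) = expAd (-swapVars χ) h := by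
    have := expAd_intertwine hχ.mem hmem swapLin (fun d f hf => swapVars_mem hf) (fun f => by
      show swapVars (pb χ f) = pb (-swapVars χ) (swapVars f)
      rw [neg_pb, pb_swapVars, neg_neg]) h
    have h2 : swapVars (expAd χ h) = expAd (-swapVars χ) (swapVars h) := this
    rwa [hs] at h2
  have h' : IsNormalizing h (-swapVars χ) := by
    refine ⟨hmem, fun m hm => ?_, fun m hm => ?_⟩
    · rw [map_neg, coeff_swapVars, hχ.res _ (isRes_swapExp.mpr hm), neg_zero]
    · rw [← e, coeff_swapVars, hχ.nonres _ (mt isRes_swapExp.mp hm)]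
  have h1 := hχ.eq hω hh h'
  conv_rhs => rw [h1]
  rw [neg_neg]

end Swap

/-! ### Reality of the normalising transformation -/

section Reality

/-- The conjugation of series in `(ξ,η)` that fixes the real series in `(x,y)`. -/
def conjSwap (f : MvPowerSeries (Coord 2) ℂ) : MvPowerSeries (Coord 2) ℂ :=
  swapVars (MvPowerSeries.map (starRingEnd ℂ) f)

theorem xiEtaOfXY_swap (s : Coord 2) :
    MvPowerSeries.map (starRingEnd ℂ) (xiEtaOfXY s) = xiEtaOfXY s.swap := by
  rcases s with j | j <;>
    simp [xiEtaOfXY, sub_eq_add_neg]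

/-- Back in `(x,y)` this involution is plain conjugation of the coefficients, so its fixed series
are real. -/
theorem exists_toXiEta_eq {f : MvPowerSeries (Coord 2) ℂ} (hf : conjSwap f = f) :
    ∃ g, toXiEta g = f := by
  set g' : MvPowerSeries (Coord 2) ℂ := subst xiEtaOfXY f with hg'
  have h1 := hasSubst_of_mem xiEtaOfXY_mem
  have hconj : MvPowerSeries.map (starRingEnd ℂ) g' = g' := by
    conv_rhs => rw [hg', ← hf, conjSwap, swapVars, subst_comp_subst_apply hasSubst_swap h1]
    rw [hg', map_subst h1]
    congr 1
    funext s
    rw [xiEtaOfXY_swap, subst_X h1]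
  let g : MvPowerSeries (Coord 2) ℝ := fun m => (coeff m g').re
  have hg : cplx g = g' := by
    ext m
    have h2 := congrArg (coeff m) hconj
    rw [coeff_map] at h2
    rw [coeff_map]
    exact Complex.conj_eq_iff_re.mp h2
  refine ⟨g, ?_⟩
  rw [toXiEta, hg, hg', subst_xyOfXiEta_subst]

theorem conjSwap_xyOfXiEta (s : Coord 2) : conjSwap (xyOfXiEta s) = xyOfXiEta s := by
  rcases s with j | j
  · simp only [conjSwap, xyOfXiEta, map_mul, map_add, map_C, map_X, swapVars_mul, swapVars_add,
      swapVars_X, swapVars_C, Sum.swap_inl, Sum.swap_inr, map_inv₀, Complex.conj_ofReal]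
    ring
  · rw [conjSwap, xyOfXiEta, map_mul, map_sub, map_C, map_X, map_X, swapVars_mul, swapVars_sub,
      swapVars_C, swapVars_X, swapVars_X, Sum.swap_inl, Sum.swap_inr]
    simp only [map_neg, map_mul, map_inv₀, Complex.conj_ofReal, Complex.conj_I]
    ring

/-- The sign from the bracket under the exchange cancels the sign of the odd generator `χ`. -/
theorem conjSwap_expAd {χ : MvPowerSeries (Coord 2) ℝ} (hχ : χ ∈ orderIdeal _ ℝ 3)
    (hs : swapVars χ = -χ) (f : MvPowerSeries (Coord 2) ℂ) :
    conjSwap (expAd (cplx χ) f) = expAd (cplx χ) (conjSwap f) := by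
  have hχ' : cplx χ ∈ orderIdeal _ ℂ 3 := map_mem_orderIdeal hχ _
  have hconj : MvPowerSeries.map (starRingEnd ℂ) (cplx χ) = cplx χ := by
    ext m
    simp
  have hsw : swapVars (cplx χ) = -cplx χ := by
    ext m
    have h1 := congrArg (coeff m) hs
    rw [coeff_swapVars, map_neg] at h1
    rw [coeff_swapVars, coeff_map, h1, map_neg, map_neg, coeff_map]
  let W : MvPowerSeries (Coord 2) ℂ →ₗ[ℝ] MvPowerSeries (Coord 2) ℂ :=
    { toFun := conjSwap
      map_add' := fun f g => by rw [conjSwap, map_add, swapVars_add]; rfl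
      map_smul' := fun r f => by
        ext m
        rw [conjSwap, coeff_swapVars, coeff_map]
        show (starRingEnd ℂ) (r • coeff (swapExp m) f) = r • coeff m (conjSwap f)
        rw [conjSwap, coeff_swapVars, coeff_map, Complex.real_smul, Complex.real_smul, map_mul,
          Complex.conj_ofReal] }
  refine expAd_intertwine hχ' hχ' W
    (fun d f hf => swapVars_mem (map_mem_orderIdeal hf _)) (fun f => ?_) f
  show swapVars (MvPowerSeries.map (starRingEnd ℂ) (pb (cplx χ) f)) = pb (cplx χ) (conjSwap f)
  rw [← pb_map, hconj, ← neg_neg (swapVars _), ← pb_swapVars, hsw, neg_pb, neg_neg]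
  rfl

end Reality

/-! ### Existence and uniqueness of the formal Birkhoff normal form -/

section Conjugation

/-- A filtered homomorphism that is tangent to the identity on the variables is so everywhere. -/
theorem algHom_sub_self_mem {σ K : Type*} [Finite σ] [CommRing K]
    (Ψ : MvPowerSeries σ K →ₐ[K] MvPowerSeries σ K)
    (hord : ∀ d, ∀ f ∈ orderIdeal _ K d, Ψ f ∈ orderIdeal _ K d)
    (htan : ∀ s, Ψ (X s) - X s ∈ orderIdeal _ K 2) {d : ℕ} {f : MvPowerSeries σ K}
    (hf : f ∈ orderIdeal _ K d) : Ψ f - f ∈ orderIdeal _ K (d + 1) := by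
  classical
  -- The property passes to products by `Ψ f Ψ g - f g = (Ψ f - f) Ψ g + f (Ψ g - g)`.
  have hmul : ∀ {a b : ℕ} {f g : MvPowerSeries σ K}, f ∈ orderIdeal _ K a → g ∈ orderIdeal _ K b →
      Ψ f - f ∈ orderIdeal _ K (a + 1) → Ψ g - g ∈ orderIdeal _ K (b + 1) →
      Ψ (f * g) - f * g ∈ orderIdeal _ K (a + b + 1) := by
    intro a b f g hf hg h1 h2
    have h3 := mul_mem_orderIdeal h1 (hord _ _ hg)
    have h4 := mul_mem_orderIdeal hf h2
    convert add_mem (orderIdeal_anti (by omega : a + b + 1 ≤ a + 1 + b) h3)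
      (orderIdeal_anti (by omega : a + b + 1 ≤ a + (b + 1)) h4) using 1
    rw [map_mul]
    ring
  have hmono : ∀ (m : σ →₀ ℕ) (c : K), monomial m c ∈ orderIdeal _ K m.degree ∧
      Ψ (monomial m c) - monomial m c ∈ orderIdeal _ K (m.degree + 1) := by
    intro m c
    have hmem : ∀ (m : σ →₀ ℕ) (c : K), monomial m c ∈ orderIdeal _ K m.degree := by
      intro m c m' hm'
      rw [coeff_monomial_ne]
      rintro rfl
      exact absurd hm' (lt_irrefl _)
    refine ⟨hmem m c, ?_⟩
    induction m using Finsupp.induction with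
    | zero =>
      have h1 : Ψ (monomial 0 c) = monomial 0 c := Ψ.commutes c
      rw [h1, sub_self]
      exact zero_mem _
    | single_add s n m hs hn ih =>
      have hpow : ∀ n : ℕ, Ψ (X s ^ n) - X s ^ n ∈ orderIdeal _ K (n + 1) := by
        intro n
        induction n with
        | zero => simp
        | succ n ihn =>
          have hXn := hmem (Finsupp.single s n) 1
          rw [← X_pow_eq, Finsupp.degree_single] at hXn
          rw [pow_succ]
          exact hmul hXn (X_mem_orderIdeal s) ihn (htan s)
      have hXn := hmem (Finsupp.single s n) 1
      rw [← X_pow_eq, Finsupp.degree_single] at hXn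
      have h3 := hmul hXn (hmem m c) (hpow n) ih
      rwa [X_pow_eq, monomial_mul_monomial, one_mul,
        show n + m.degree = (Finsupp.single s n + m).degree by simp] at h3
  have h1 := sub_truncTotal_mem (d + 1) f
  set p := truncTotal (d + 1) f with hp
  have h2 : Ψ (p : MvPowerSeries σ K) - p ∈ orderIdeal _ K (d + 1) := by
    have hcoe : (p : MvPowerSeries σ K) = ∑ m ∈ p.support, monomial m (p.coeff m) := by
      conv_lhs => rw [p.as_sum]
      simp only [← MvPolynomial.coeToMvPowerSeries.ringHom_apply, map_sum]
      simp
    rw [hcoe, map_sum, ← Finset.sum_sub_distrib]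
    refine sum_mem fun m hm => orderIdeal_anti ?_ (hmono m _).2
    by_contra hlt
    rw [MvPolynomial.mem_support_iff, hp, coeff_truncTotal f (by omega), hf m (by omega)] at hm
    exact hm rfl
  have e : Ψ f - f = (Ψ (f - p) - (f - p)) + (Ψ (p : MvPowerSeries σ K) - p) := by
    rw [map_sub]
    ring
  rw [e]
  exact add_mem (sub_mem (hord _ _ h1) h1) h2

variable {ω : Fin 2 → ℝ} (hω : ∀ m, divisor ω m = 0 → IsRes m)
  {h hc χ : MvPowerSeries (Coord 2) ℝ} {B : MvPowerSeries (Fin 2) ℝ}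

theorem expAd_cplx (hχ : χ ∈ orderIdeal _ ℝ 3) (f : MvPowerSeries (Coord 2) ℝ) :
    cplx (expAd χ f) = expAd (cplx χ) (cplx f) := by
  let W : MvPowerSeries (Coord 2) ℝ →ₗ[ℝ] MvPowerSeries (Coord 2) ℂ :=
    { toFun := cplx
      map_add' := map_add _
      map_smul' := fun r f => by
        ext m
        exact (map_mul Complex.ofRealHom r (coeff m f)).trans (Complex.real_smul).symm }
  exact expAd_intertwine hχ (map_mem_orderIdeal hχ _) W
    (fun d f hf => map_mem_orderIdeal hf Complex.ofRealHom)
    (fun g => (pb_map Complex.ofRealHom χ g).symm) f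

include hω in
/-- A formal Hamiltonian with real coefficients in `(ξ,η)`, invariant under the exchange of `ξ`
and `η`, is conjugate to its normal form by a real formal symplectic transformation. -/
theorem exists_formal_conjugation (hT : toXiEta h = cplx hc)
    (hq : hc - quad ℝ ω ∈ orderIdeal _ ℝ 3) (hs : swapVars hc = hc) (hχ : IsNormalizing hc χ)
    (hB : expAd χ hc = subst (act ℝ) B) :
    ∃ Φ : Coord 2 → MvPowerSeries (Coord 2) ℝ,
      IsFormalSymplectic Φ ∧ IsTangentToId Φ ∧ subst Φ h = subst (formalAction (d := 2)) B := by
  have hsχ := hχ.swapVars_eq hω hq hs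
  have hχ' : cplx χ ∈ orderIdeal _ ℂ 3 := map_mem_orderIdeal hχ.mem _
  -- The components of the transformation are the images of the real coordinates under the Lie
  -- series.
  have hreal : ∀ s, ∃ g, toXiEta g = expAd (cplx χ) (xyOfXiEta s) := fun s =>
    exists_toXiEta_eq (by rw [conjSwap_expAd hχ.mem hsχ, conjSwap_xyOfXiEta])
  choose Φ hΦ using hreal
  have hmem : ∀ s, Φ s ∈ orderIdeal _ ℝ 1 := fun s => by
    rw [← toXiEta_mem, hΦ]
    exact expAd_mem_orderIdeal hχ' (xyOfXiEta_mem s)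
  refine ⟨Φ, fun s t => toXiEta_injective ?_, fun s m hm => ?_, toXiEta_injective ?_⟩
  · rw [poisson_eq_pb, poisson_eq_pb]
    have hI : (C Complex.I : MvPowerSeries (Coord 2) ℂ) ≠ 0 := fun h0 => by
      have := congrArg (coeff 0) h0
      simp at this
    refine mul_left_cancel₀ hI ?_
    rw [← pb_toXiEta, ← pb_toXiEta, hΦ, hΦ, ← expAd_pb hχ', toXiEta_X, toXiEta_X, pb_xyOfXiEta]
    -- The canonical brackets are constants, and the Lie series fixes constants.
    have hconst : ∃ c : ℂ, pb (X s : MvPowerSeries (Coord 2) ℂ) (X t) = C c := by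
      rw [pb_X_X]
      rcases s with i | i <;> rcases t with j | j
      · exact ⟨0, by simp⟩
      · exact ⟨if i = j then 1 else 0, by simp [apply_ite]⟩
      · exact ⟨if i = j then -1 else 0, by simp [apply_ite]⟩
      · exact ⟨0, by simp⟩
    obtain ⟨c, hc⟩ := hconst
    rw [hc, ← map_mul, expAd_C hχ']
  · have h1 : Φ s - X s ∈ orderIdeal _ ℝ 2 := by
      rw [← toXiEta_mem, toXiEta_sub, hΦ, toXiEta_X]
      exact expAd_sub_self_mem hχ' (xyOfXiEta_mem s)
    exact h1 m (by omega)
  · rw [toXiEta_subst hmem, toXiEta_subst_formalAction, ← cplx_subst_act, ← hB, expAd_cplx hχ.mem,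
      ← hT, toXiEta]
    simp only [hΦ]
    exact (algHom_subst xyOfXiEta_mem (expAdHom hχ')
      (fun d f hf => expAd_mem_orderIdeal hχ' hf) (cplx h)).symm

include hω in
/-- The Birkhoff normal form of a formal Hamiltonian is unique. -/
theorem formal_normalForm_unique (hT : toXiEta h = cplx hc)
    (hq : hc - quad ℝ ω ∈ orderIdeal _ ℝ 3) (hχ : IsNormalizing hc χ)
    (hB : expAd χ hc = subst (act ℝ) B) {Φ : Coord 2 → MvPowerSeries (Coord 2) ℝ}
    (hΦ : IsFormalSymplectic Φ) (hΦ' : IsTangentToId Φ) {B' : MvPowerSeries (Fin 2) ℝ}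
    (hB' : subst Φ h = subst (formalAction (d := 2)) B') : B' = B := by
  have hχ' : cplx χ ∈ orderIdeal _ ℂ 3 := map_mem_orderIdeal hχ.mem _
  have hχ'' : -cplx χ ∈ orderIdeal _ ℂ 3 := neg_mem hχ'
  have htan : ∀ s, Φ s - X s ∈ orderIdeal _ ℝ 2 := fun s m hm => hΦ' s m (by omega)
  have hmem : ∀ s, Φ s ∈ orderIdeal _ ℝ 1 := fun s => by
    have := add_mem (orderIdeal_anti (by omega : 1 ≤ 2) (htan s)) (X_mem_orderIdeal s)
    rwa [sub_add_cancel] at this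
  have hmemC : ∀ s, cplx (Φ s) ∈ orderIdeal _ ℂ 1 := fun s => map_mem_orderIdeal (hmem s) _
  have s1 := hasSubst_of_mem xiEtaOfXY_mem
  have s2 := hasSubst_of_mem hmemC
  have s3 := hasSubst_of_mem xyOfXiEta_mem
  -- `Ψ` first undoes the normalisation by `χ`, then applies `Φ` written in `(ξ,η)`; it therefore
  -- carries `B(I)` to `B'(I)`.
  let Ψ : MvPowerSeries (Coord 2) ℂ →ₐ[ℂ] MvPowerSeries (Coord 2) ℂ :=
    (substAlgHom s3).comp ((substAlgHom s2).comp ((substAlgHom s1).comp (expAdHom hχ'')))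
  have hΨ : ∀ f, Ψ f = subst xyOfXiEta (subst (fun s => cplx (Φ s))
      (subst xiEtaOfXY (expAd (-cplx χ) f))) := fun f => by
    simp only [Ψ, AlgHom.comp_apply, substAlgHom_apply, expAdHom_apply]
  have hord : ∀ d, ∀ f ∈ orderIdeal _ ℂ d, Ψ f ∈ orderIdeal _ ℂ d := fun d f hf => by
    rw [hΨ]
    exact subst_mem_orderIdeal xyOfXiEta_mem (subst_mem_orderIdeal hmemC
      (subst_mem_orderIdeal xiEtaOfXY_mem (expAd_mem_orderIdeal hχ'' hf)))
  have hpbΦ : ∀ f g, pb (subst (fun s => cplx (Φ s)) f) (subst (fun s => cplx (Φ s)) g) =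
      subst (fun s => cplx (Φ s)) (pb f g) := fun f g => by
    rw [pb_subst hmemC 1 (fun s t => ?_), map_one, one_mul]
    have h1 := hΦ s t
    rw [poisson_eq_pb, poisson_eq_pb] at h1
    rw [pb_map, h1, ← pb_map, map_X, map_X, map_one, one_mul]
  have hpb : ∀ f g, Ψ (pb f g) = pb (Ψ f) (Ψ g) := fun f g => by
    simp only [hΨ]
    rw [pb_subst xyOfXiEta_mem _ pb_xyOfXiEta, hpbΦ, pb_subst xiEtaOfXY_mem _ pb_xiEtaOfXY,
      expAd_pb hχ'', subst_mul s2, subst_mul s3]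
    have e1 : subst (fun s => cplx (Φ s)) (C (-Complex.I) : MvPowerSeries (Coord 2) ℂ) =
      (C (-Complex.I) : MvPowerSeries (Coord 2) ℂ) := subst_C _
    have e2 : subst xyOfXiEta (C (-Complex.I) : MvPowerSeries (Coord 2) ℂ) =
      (C (-Complex.I) : MvPowerSeries (Coord 2) ℂ) := subst_C _
    -- The factors `i` and `-i` of the two coordinate changes cancel.
    rw [e1, e2, ← mul_assoc, ← map_mul, mul_neg, Complex.I_mul_I, neg_neg, map_one, one_mul]
  have htanC : ∀ s, subst (fun s => cplx (Φ s)) (X s : MvPowerSeries (Coord 2) ℂ) - X s ∈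
      orderIdeal _ ℂ 2 := fun s => by
    rw [subst_X s2, ← map_X (Complex.ofRealHom) s, ← map_sub]
    exact map_mem_orderIdeal (htan s) _
  have hlow : ∀ f ∈ orderIdeal _ ℂ 1, subst (fun s => cplx (Φ s)) f - f ∈ orderIdeal _ ℂ 2 :=
    fun f hf => by
      rw [← substAlgHom_apply s2]
      exact algHom_sub_self_mem (substAlgHom s2)
        (fun d f hf => by rw [substAlgHom_apply]; exact subst_mem_orderIdeal hmemC hf)
        (fun s => by rw [substAlgHom_apply]; exact htanC s) hf
  have htanΨ : ∀ f ∈ orderIdeal _ ℂ 1, Ψ f - f ∈ orderIdeal _ ℂ 2 := by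
    intro f hf
    rw [hΨ]
    have h1 := expAd_sub_self_mem hχ'' hf
    have h2 := subst_mem_orderIdeal xyOfXiEta_mem (subst_mem_orderIdeal hmemC
      (subst_mem_orderIdeal xiEtaOfXY_mem h1))
    have h3 := subst_mem_orderIdeal xyOfXiEta_mem (hlow _ (subst_mem_orderIdeal xiEtaOfXY_mem hf))
    rw [subst_sub s1, subst_sub s2, subst_sub s3] at h2
    rw [subst_sub s3, subst_xyOfXiEta_subst] at h3
    convert add_mem h2 h3 using 1
    ring
  have hb : Ψ (subst (act ℂ) (cplx B)) = subst (act ℂ) (cplx B') := by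
    rw [hΨ, ← cplx_subst_act, ← hB, expAd_cplx hχ.mem, expAd_neg_expAd hχ', ← hT, toXiEta,
      subst_xiEtaOfXY_subst, ← map_subst (hasSubst_of_mem hmem), hB']
    exact toXiEta_subst_formalAction B'
  have hquad : subst (act ℂ) (cplx B') - quad ℂ ω ∈ orderIdeal _ ℂ 3 := by
    have h2 : subst (act ℂ) (cplx B) - quad ℂ ω ∈ orderIdeal _ ℂ 3 := by
      rw [← cplx_subst_act, ← hB, ← cplx_quad, ← map_sub]
      have := add_mem (expAd_sub_self_mem hχ.mem (mem_of_sub_quad_mem hq)) hq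
      rw [sub_add_sub_cancel] at this
      exact map_mem_orderIdeal this _
    have h3 := algHom_sub_self_mem Ψ hord (fun s => htanΨ _ (X_mem_orderIdeal s))
      (mem_of_sub_quad_mem h2)
    rw [hb] at h3
    have := add_mem h3 h2
    rwa [sub_add_sub_cancel] at this
  have hfix := fix_act hω Ψ hord hpb (fun s => htanΨ _ (X_mem_orderIdeal s))
    (fun m hm => coeff_subst_act_eq_zero _ hm) (fun m hm => coeff_subst_act_eq_zero _ hm) hquad hb
  -- Since `Ψ` fixes the actions, it fixes every series in them.
  rw [algHom_subst act_mem_one Ψ hord] at hb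
  simp only [hfix] at hb
  exact cplx_injective (subst_act_injective hb.symm)

end Conjugation

/-! ### Hamiltonians with finitely many perturbing terms -/

section Truncated

variable {K K' : Type*} [CommRing K] [Algebra ℝ K] [CommRing K'] [Algebra ℝ K']

/-- The resonant monomials `ξ₁^k ξ₂^l + η₁^k η₂^l`. -/
def pert (K : Type*) [CommRing K] (k l : ℕ) : MvPowerSeries (Coord 2) K :=
  X (Sum.inl 0) ^ k * X (Sum.inl 1) ^ l + X (Sum.inr 0) ^ k * X (Sum.inr 1) ^ l

/-- The integrable part `ω₁ I₁ + ω₂ I₂ + I₁ I₂`. -/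
def baseHam (K : Type*) [CommRing K] [Algebra ℝ K] (ω : Fin 2 → ℝ) : MvPowerSeries (Coord 2) K :=
  quad K ω + act K 0 * act K 1

/-- The Hamiltonian with finitely many perturbing terms, with coefficients in `K`. -/
def truncHam (ω : Fin 2 → ℝ) {N : ℕ} (a : Fin N → ℝ) (τ : Fin N → ℕ × ℕ) (z : Fin N → K) :
    MvPowerSeries (Coord 2) K :=
  baseHam K ω + ∑ j, C (z j * algebraMap ℝ K (a j)) * pert K (τ j).1 (τ j).2

omit [Algebra ℝ K] in
theorem pert_mem (k l : ℕ) : pert K k l ∈ orderIdeal _ K (k + l) := by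
  have hpow : ∀ (s : Coord 2) (n : ℕ), (X s : MvPowerSeries (Coord 2) K) ^ n ∈
      orderIdeal _ K n := by
    intro s n
    induction n with
    | zero => exact orderIdeal_zero _
    | succ n ih => rw [pow_succ]; exact mul_mem_orderIdeal ih (X_mem_orderIdeal s)
  exact add_mem (mul_mem_orderIdeal (hpow _ _) (hpow _ _))
    (mul_mem_orderIdeal (hpow _ _) (hpow _ _))

theorem baseHam_sub_quad_mem (ω : Fin 2 → ℝ) : baseHam K ω - quad K ω ∈ orderIdeal _ K 3 := by
  rw [baseHam, add_sub_cancel_left]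
  exact orderIdeal_anti (by omega) (mul_mem_orderIdeal (act_mem_orderIdeal 0)
    (act_mem_orderIdeal 1))

theorem truncHam_sub_quad_mem (ω : Fin 2 → ℝ) {N : ℕ} (a : Fin N → ℝ) {τ : Fin N → ℕ × ℕ}
    (hτ : ∀ j, 3 ≤ (τ j).1) (z : Fin N → K) :
    truncHam ω a τ z - quad K ω ∈ orderIdeal _ K 3 := by
  rw [truncHam, add_sub_right_comm]
  exact add_mem (baseHam_sub_quad_mem ω) (sum_mem fun j _ => Ideal.mul_mem_left _ _
    (orderIdeal_anti (by have := hτ j; omega) (pert_mem _ _)))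

theorem map_truncHam (ω : Fin 2 → ℝ) {N : ℕ} (a : Fin N → ℝ) (τ : Fin N → ℕ × ℕ)
    (z : Fin N → K) (φ : K →ₐ[ℝ] K') :
    MvPowerSeries.map φ.toRingHom (truncHam ω a τ z) = truncHam ω a τ (fun j => φ (z j)) := by
  simp [truncHam, baseHam, quad, act, pert]

omit [Algebra ℝ K] in
theorem swapVars_act (j : Fin 2) : swapVars (act K j) = act K j := by
  rw [act, swapVars_mul, swapVars_X, swapVars_X, Sum.swap_inl, Sum.swap_inr, mul_comm]

omit [Algebra ℝ K] in
theorem swapVars_pert (k l : ℕ) : swapVars (pert K k l) = pert K k l := by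
  simp only [pert, swapVars_add, swapVars_mul, swapVars_pow, swapVars_X, Sum.swap_inl,
    Sum.swap_inr]
  rw [add_comm]

omit [Algebra ℝ K] in
theorem swapVars_sum {ι : Type*} (s : Finset ι) (f : ι → MvPowerSeries (Coord 2) K) :
    swapVars (∑ i ∈ s, f i) = ∑ i ∈ s, swapVars (f i) := by
  simp only [swapVars, ← coe_substAlgHom hasSubst_swap, map_sum]

theorem swapVars_baseHam (ω : Fin 2 → ℝ) : swapVars (baseHam K ω) = baseHam K ω := by
  rw [baseHam, swapVars_add, swapVars_mul, quad, swapVars_sum]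
  simp only [swapVars_mul, swapVars_C, swapVars_act]

theorem swapVars_truncHam (ω : Fin 2 → ℝ) {N : ℕ} (a : Fin N → ℝ) (τ : Fin N → ℕ × ℕ)
    (z : Fin N → K) : swapVars (truncHam ω a τ z) = truncHam ω a τ z := by
  rw [truncHam, swapVars_add, swapVars_sum, swapVars_baseHam]
  simp only [swapVars_mul, swapVars_C, swapVars_pert]

end Truncated

/-! ### The weight bound on the parameters -/

section Filtration

variable {n : ℕ} (w : Fin n → ℕ)

/-- Polynomials whose exponents `α` satisfy `α · w + 2 ≤ b`. -/
def weightLE (b : ℕ) : Submodule ℝ (MvPolynomial (Fin n) ℝ) where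
  carrier := {p | ∀ α ∈ p.support, ∑ j, α j * w j + 2 ≤ b}
  zero_mem' := by simp
  add_mem' := fun {p q} hp hq α hα => by
    classical
    rcases Finset.mem_union.mp (MvPolynomial.support_add hα) with h | h
    · exact hp α h
    · exact hq α h
  smul_mem' := fun c p hp α hα => hp α (MvPolynomial.support_smul hα)

theorem weightLE_mono {b c : ℕ} (h : b ≤ c) : weightLE w b ≤ weightLE w c :=
  fun _ hp α hα => (hp α hα).trans h

theorem mul_mem_weightLE {a b c : ℕ} {p q : MvPolynomial (Fin n) ℝ} (hp : p ∈ weightLE w a)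
    (hq : q ∈ weightLE w b) (h : a + b ≤ c + 2) : p * q ∈ weightLE w c := by
  classical
  intro α hα
  obtain ⟨β, hβ, γ, hγ, rfl⟩ := Finset.mem_add.mp (MvPolynomial.support_mul p q hα)
  have h1 := hp β hβ
  have h2 := hq γ hγ
  simp only [Finsupp.add_apply, add_mul, Finset.sum_add_distrib]
  omega

theorem natCast_mul_mem_weightLE {b : ℕ} {p : MvPolynomial (Fin n) ℝ} (hp : p ∈ weightLE w b)
    (i : ℕ) : (i : MvPolynomial (Fin n) ℝ) * p ∈ weightLE w b := by
  rw [← nsmul_eq_mul]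
  exact nsmul_mem hp i

theorem natCast_add_one_mul_mem_weightLE {b : ℕ} {p : MvPolynomial (Fin n) ℝ}
    (hp : p ∈ weightLE w b) (i : ℕ) : ((i : MvPolynomial (Fin n) ℝ) + 1) * p ∈ weightLE w b := by
  rw [← Nat.cast_succ]
  exact natCast_mul_mem_weightLE w hp _

/-- Series whose coefficient of a monomial of degree `e` in `(ξ₁,η₁)` lies in
`weightLE w (e + c)`. -/
def filt (c : ℕ) : Submodule ℝ (MvPowerSeries (Coord 2) (MvPolynomial (Fin n) ℝ)) where
  carrier := {f | ∀ m, coeff m f ∈ weightLE w (m (Sum.inl 0) + m (Sum.inr 0) + c)}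
  zero_mem' := fun m => by rw [map_zero]; exact zero_mem _
  add_mem' := fun hf hg m => by rw [map_add]; exact add_mem (hf m) (hg m)
  smul_mem' := fun r _ hf m => Submodule.smul_mem _ r (hf m)

theorem mul_mem_filt {a b c : ℕ} {f g : MvPowerSeries (Coord 2) (MvPolynomial (Fin n) ℝ)}
    (hf : f ∈ filt w a) (hg : g ∈ filt w b) (h : a + b ≤ c + 2) : f * g ∈ filt w c := by
  classical
  intro m
  rw [coeff_mul]
  refine sum_mem fun p hp => mul_mem_weightLE w (hf p.1) (hg p.2) ?_
  rw [Finset.HasAntidiagonal.mem_antidiagonal] at hp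
  rw [← hp, Finsupp.add_apply, Finsupp.add_apply]
  omega

theorem pderiv_mem_filt {c : ℕ} {f : MvPowerSeries (Coord 2) (MvPolynomial (Fin n) ℝ)}
    (hf : f ∈ filt w c) (s : Coord 2) : pderiv _ s f ∈ filt w (c + 1) := by
  intro m
  rw [coeff_pderiv, mul_comm]
  refine natCast_add_one_mul_mem_weightLE w (weightLE_mono w ?_ (hf _)) (m s)
  simp only [Finsupp.add_apply, Finsupp.single_apply]
  rcases s with i | i <;> simp <;> split_ifs <;> omega

theorem pderiv_one_mem_filt {c : ℕ} {f : MvPowerSeries (Coord 2) (MvPolynomial (Fin n) ℝ)}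
    (hf : f ∈ filt w c) {s : Coord 2} (hs : s = Sum.inl 1 ∨ s = Sum.inr 1) :
    pderiv _ s f ∈ filt w c := by
  intro m
  rw [coeff_pderiv, mul_comm]
  refine natCast_add_one_mul_mem_weightLE w (weightLE_mono w ?_ (hf _)) (m s)
  rcases hs with rfl | rfl <;> simp

/-- The shift by 2 in `weightLE` is counted twice in a product, and the surplus pays exactly for the
two derivatives in `(ξ₁,η₁)`. Derivatives in `(ξ₂,η₂)` cost nothing. -/
theorem pb_mem_filt {f g : MvPowerSeries (Coord 2) (MvPolynomial (Fin n) ℝ)}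
    (hf : f ∈ filt w 0) (hg : g ∈ filt w 0) : pb f g ∈ filt w 0 := by
  rw [pb, Fin.sum_univ_two]
  refine add_mem (sub_mem ?_ ?_) (sub_mem ?_ ?_)
  · exact mul_mem_filt w (pderiv_mem_filt w hf _) (pderiv_mem_filt w hg _) (by omega)
  · exact mul_mem_filt w (pderiv_mem_filt w hf _) (pderiv_mem_filt w hg _) (by omega)
  · exact mul_mem_filt w (pderiv_one_mem_filt w hf (by simp)) (pderiv_one_mem_filt w hg (by simp))
      (by omega)
  · exact mul_mem_filt w (pderiv_one_mem_filt w hf (by simp)) (pderiv_one_mem_filt w hg (by simp))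
      (by omega)

/-- Needed because `I₂`, being of degree 0 in `(ξ₁,η₁)`, lies outside the filtration; its bracket is
diagonal on monomials and so preserves it. -/
theorem pb_act_mem_filt {f : MvPowerSeries (Coord 2) (MvPolynomial (Fin n) ℝ)}
    (hf : f ∈ filt w 0) (j : Fin 2) : pb f (act _ j) ∈ filt w 0 := by
  intro m
  rw [coeff_pb_act, sub_mul]
  exact sub_mem (natCast_mul_mem_weightLE w (hf m) _) (natCast_mul_mem_weightLE w (hf m) _)

variable {w} {r : ℝ} {h : MvPowerSeries (Coord 2) (MvPolynomial (Fin n) ℝ)}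
  (hh : h - C (algebraMap ℝ _ r) * act _ 1 ∈ filt w 0)

include hh in
theorem expAd_sub_mem_filt {χ : MvPowerSeries (Coord 2) (MvPolynomial (Fin n) ℝ)}
    (hχ : χ ∈ filt w 0) : expAd χ h - h ∈ filt w 0 := by
  have h1 : pb χ h ∈ filt w 0 := by
    have h2 : pb χ h = pb χ (h - C (algebraMap ℝ _ r) * act _ 1) + r • pb χ (act _ 1) := by
      rw [pb_sub, pb_C_mul]
      have : r • pb χ (act (MvPolynomial (Fin n) ℝ) 1) =
          C (algebraMap ℝ _ r) * pb χ (act _ 1) := by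
        ext1 m
        rw [coeff_C_mul, ← Algebra.smul_def]
        rfl
      rw [this]
      ring
    rw [h2]
    exact add_mem (pb_mem_filt w hχ hh) (Submodule.smul_mem _ r (pb_act_mem_filt w hχ 1))
  have h2 : ∀ k, (ad χ)^[k + 1] h ∈ filt w 0 := by
    intro k
    induction k with
    | zero => simpa [ad_apply] using h1
    | succ k ih =>
      rw [Function.iterate_succ_apply', ad_apply]
      exact pb_mem_filt w hχ ih
  intro m
  have h3 : lieSum (m.degree + 1) χ h - h ∈ filt w 0 := by
    rw [lieSum, Finset.sum_range_succ']
    simp only [Nat.factorial_zero, Nat.cast_one, inv_one, Function.iterate_zero, id, one_smul,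
      add_sub_cancel_right]
    exact sum_mem fun k _ => Submodule.smul_mem _ _ (h2 k)
  exact h3 m

-- The homological equation expresses each coefficient of `χ` by coefficients of lower degree and a
-- division by a real number, neither of which disturbs the weight bound.
include hh in
theorem IsNormalizing.mem_filt {ω : Fin 2 → ℝ} (hω : ∀ m, divisor ω m = 0 → IsRes m)
    (hq : h - quad _ ω ∈ orderIdeal _ _ 3)
    {χ : MvPowerSeries (Coord 2) (MvPolynomial (Fin n) ℝ)} (hχ : IsNormalizing h χ) :
    χ ∈ filt w 0 := by
  classical
  suffices H : ∀ d m, m.degree < d →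
      coeff m χ ∈ weightLE w (m (Sum.inl 0) + m (Sum.inr 0) + 0) from
    fun m => H (m.degree + 1) m (Nat.lt_succ_self _)
  intro d
  induction d with
  | zero => exact fun m hm => absurd hm (Nat.not_lt_zero _)
  | succ d ih =>
    intro m hm
    by_cases hlt : m.degree < d
    · exact ih m hlt
    by_cases h3 : m.degree < 3
    · rw [hχ.mem m h3]; exact zero_mem _
    by_cases hres : IsRes m
    · rw [hχ.res m hres]; exact zero_mem _
    -- The part of `χ` already known to satisfy the bound; restoring degree `d` changes the
    -- transformed series there by divisor times coefficient.
    let χ' : MvPowerSeries (Coord 2) (MvPolynomial (Fin n) ℝ) :=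
      fun m => if m.degree < d then coeff m χ else 0
    have hco : ∀ m, coeff m χ' = if m.degree < d then coeff m χ else 0 := fun _ => rfl
    have hχ'3 : χ' ∈ orderIdeal _ _ 3 := fun m hm => by
      rw [hco, hχ.mem m hm, ite_self]
    have hχ'f : χ' ∈ filt w 0 := fun m => by
      rw [hco]
      split_ifs with hmd
      · exact ih m hmd
      · exact zero_mem _
    have hτ : χ - χ' ∈ orderIdeal _ _ d := fun m hm => by
      rw [map_sub, hco, if_pos hm, sub_self]
    have h1 := coeff_expAd_add_left hq hχ'3 (by omega) hτ (m := m) (by omega)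
    rw [add_sub_cancel, hχ.nonres m hres, map_sub, hco, if_neg hlt, sub_zero] at h1
    have h5 : divisor ω m ≠ 0 := fun h0 => hres (hω m h0)
    have h6 : coeff m χ = -((divisor ω m)⁻¹ • coeff m (expAd χ' h)) := by
      rw [eq_neg_of_add_eq_zero_left h1.symm, smul_neg, neg_neg, smul_smul, inv_mul_cancel₀ h5,
        one_smul]
    rw [h6]
    refine neg_mem (Submodule.smul_mem _ _ ?_)
    have h7 := add_mem (expAd_sub_mem_filt hh hχ'f m) (hh m)
    have e : coeff m (expAd χ' h - h) + coeff m (h - C (algebraMap ℝ _ r) * act _ 1) =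
        coeff m (expAd χ' h) := by
      rw [map_sub, map_sub, coeff_C_mul, coeff_act_eq_zero hres, mul_zero]
      ring
    rwa [e] at h7

end Filtration

/-! ### Explicit brackets of monomials -/

section Monomials

variable {K : Type*} [CommRing K]

/-- The exponent of `ξ₁^k ξ₂^(l+j) η₂^j`. -/
def mixExp (k l j : ℕ) : Coord 2 →₀ ℕ :=
  Finsupp.single (Sum.inl 0) k + Finsupp.single (Sum.inl 1) (l + j) + Finsupp.single (Sum.inr 1) j

@[simp] theorem mixExp_inl_zero (k l j : ℕ) : mixExp k l j (Sum.inl 0) = k := by simp [mixExp]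

@[simp] theorem mixExp_inl_one (k l j : ℕ) : mixExp k l j (Sum.inl 1) = l + j := by simp [mixExp]

@[simp] theorem mixExp_inr_zero (k l j : ℕ) : mixExp k l j (Sum.inr 0) = 0 := by simp [mixExp]

@[simp] theorem mixExp_inr_one (k l j : ℕ) : mixExp k l j (Sum.inr 1) = j := by simp [mixExp]

theorem coord_ext_iff {m m' : Coord 2 →₀ ℕ} : m = m' ↔
    m (Sum.inl 0) = m' (Sum.inl 0) ∧ m (Sum.inl 1) = m' (Sum.inl 1) ∧
      m (Sum.inr 0) = m' (Sum.inr 0) ∧ m (Sum.inr 1) = m' (Sum.inr 1) :=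
  ⟨by rintro rfl; simp, fun ⟨h1, h2, h3, h4⟩ => coord_ext (Fin.forall_fin_two.mpr ⟨h1, h2⟩)
    (Fin.forall_fin_two.mpr ⟨h3, h4⟩)⟩

theorem coord_le_iff {m m' : Coord 2 →₀ ℕ} : m ≤ m' ↔
    m (Sum.inl 0) ≤ m' (Sum.inl 0) ∧ m (Sum.inl 1) ≤ m' (Sum.inl 1) ∧
      m (Sum.inr 0) ≤ m' (Sum.inr 0) ∧ m (Sum.inr 1) ≤ m' (Sum.inr 1) := by
  rw [Finsupp.le_def, Sum.forall, Fin.forall_fin_two, Fin.forall_fin_two, and_assoc]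

theorem act_eq_monomial (j : Fin 2) : act K j =
    monomial (Finsupp.single (Sum.inl j) 1 + Finsupp.single (Sum.inr j) 1) 1 := by
  rw [act, X, X, monomial_mul_monomial, one_mul]

theorem pert_eq_monomial (k l : ℕ) :
    pert K k l = monomial (mixExp k l 0) 1 + monomial (swapExp (mixExp k l 0)) 1 := by
  simp only [pert, X_pow_eq, monomial_mul_monomial, one_mul]
  congr 2 <;> congr 1 <;> rw [coord_ext_iff] <;> simp [swapExp_inl, swapExp_inr]

theorem coeff_pert_of_res {k l : ℕ} (hk : k ≠ 0) {m : Coord 2 →₀ ℕ} (hm : IsRes m) :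
    coeff m (pert K k l) = 0 := by
  classical
  have := hm 0
  rw [pert_eq_monomial, map_add, coeff_monomial, coeff_monomial, if_neg, if_neg, add_zero]
  · rintro rfl
    simp only [swapExp_inl, swapExp_inr, mixExp_inl_zero, mixExp_inr_zero] at this
    omega
  · rintro rfl
    simp only [mixExp_inl_zero, mixExp_inr_zero] at this
    omega

theorem coeff_pert_mixExp {k l : ℕ} (hk : k ≠ 0) (j : ℕ) :
    coeff (mixExp k l j) (pert K k l) = if j = 0 then 1 else 0 := by
  classical
  rw [pert_eq_monomial, map_add, coeff_monomial, coeff_monomial,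
    if_neg (c := _ = swapExp _), add_zero]
  · congr 1
    simp [coord_ext_iff]
  · intro h
    have := DFunLike.congr_fun h (Sum.inl 0)
    simp only [swapExp_inl, mixExp_inl_zero, mixExp_inr_zero] at this
    exact hk this

theorem coeff_pb_act_mul_act (f : MvPowerSeries (Coord 2) K) (m : Coord 2 →₀ ℕ)
    [DecidableLE (Coord 2 →₀ ℕ)] :
    coeff m (pb f (act K 0 * act K 1)) =
      (if Finsupp.single (Sum.inl 1) 1 + Finsupp.single (Sum.inr 1) 1 ≤ m then
        ((m (Sum.inl 0) : K) - m (Sum.inr 0)) *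
          coeff (m - (Finsupp.single (Sum.inl 1) 1 + Finsupp.single (Sum.inr 1) 1)) f else 0) +
      (if Finsupp.single (Sum.inl 0) 1 + Finsupp.single (Sum.inr 0) 1 ≤ m then
        ((m (Sum.inl 1) : K) - m (Sum.inr 1)) *
          coeff (m - (Finsupp.single (Sum.inl 0) 1 + Finsupp.single (Sum.inr 0) 1)) f else 0) := by
  have h : ∀ i j : Fin 2, i ≠ j → coeff m (act K i * pb f (act K j)) =
      if Finsupp.single (Sum.inl i) 1 + Finsupp.single (Sum.inr i) 1 ≤ m then
        ((m (Sum.inl j) : K) - m (Sum.inr j)) *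
          coeff (m - (Finsupp.single (Sum.inl i) 1 + Finsupp.single (Sum.inr i) 1)) f else 0 := by
    intro i j hij
    conv_lhs => rw [act_eq_monomial i, coeff_monomial_mul]
    simp only [one_mul, coeff_pb_act, Finsupp.tsub_apply, Finsupp.add_apply]
    simp only [Finsupp.single_apply, Sum.inl.injEq, Sum.inr.injEq, reduceCtorEq, hij, if_false,
      add_zero, Nat.sub_zero]
  rw [pb_mul, map_add, h 0 1 (by decide), h 1 0 (by decide), add_comm]

theorem coeff_pb_act_mul_act_of_res {f : MvPowerSeries (Coord 2) K} {m : Coord 2 →₀ ℕ}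
    (hm : IsRes m) : coeff m (pb f (act K 0 * act K 1)) = 0 := by
  classical
  rw [coeff_pb_act_mul_act, hm 0, hm 1]
  simp

/-- The term `I₂ {f, I₁}` moves one step up the chain `mixExp k l j`. The term `I₁ {f, I₂}` would
bring in a factor `η₁`, which is absent from the chain. -/
theorem coeff_pb_act_mul_act_mixExp (f : MvPowerSeries (Coord 2) K) (k l j : ℕ) :
    coeff (mixExp k l (j + 1)) (pb f (act K 0 * act K 1)) = k * coeff (mixExp k l j) f := by
  classical
  rw [coeff_pb_act_mul_act, if_pos, if_neg, add_zero, mixExp_inl_zero, mixExp_inr_zero,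
    Nat.cast_zero, sub_zero]
  · have e : mixExp k l (j + 1) -
        (Finsupp.single (Sum.inl 1) 1 + Finsupp.single (Sum.inr 1) 1) = mixExp k l j := by
      rw [coord_ext_iff]
      simp
    rw [e]
  · simp [coord_le_iff]
  · simp [coord_le_iff]
    omega

theorem coeff_pb_act_mul_act_mixExp_zero (f : MvPowerSeries (Coord 2) K) (k l : ℕ) :
    coeff (mixExp k l 0) (pb f (act K 0 * act K 1)) = 0 := by
  classical
  rw [coeff_pb_act_mul_act, if_neg, if_neg, add_zero]
  · simp [coord_le_iff]
  · simp [coord_le_iff]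

/-- The resonant exponent of `I₁^(k-1) I₂^q`. -/
abbrev resExp (k q : ℕ) : Fin 2 →₀ ℕ := Finsupp.single 0 (k - 1) + Finsupp.single 1 q

/-- The target exponent has only `k - 1` factors `η₁`, so the monomial `η₁^k η₂^l` must be
differentiated in `η₁`. The two derivatives then each contribute a factor `k`. -/
theorem coeff_pb_monomial {k l q : ℕ} (hk : k ≠ 0) (hq : l ≤ q)
    (f : MvPowerSeries (Coord 2) K) :
    coeff (diagExp (resExp k q)) (pb f (monomial (swapExp (mixExp k l 0)) 1)) =
      k * k * coeff (mixExp k l (q - l)) f := by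
  classical
  rw [pb, Fin.sum_univ_two]
  have hinl : ∀ i, pderiv K (Sum.inl i) (monomial (swapExp (mixExp k l 0)) (1 : K)) = 0 := by
    intro i
    ext m
    rw [coeff_pderiv, coeff_monomial, if_neg, zero_mul, map_zero]
    intro h
    have := DFunLike.congr_fun h (Sum.inl i)
    rw [swapExp_inl] at this
    fin_cases i <;> simp at this
  have h0 : pderiv K (Sum.inr 0) (monomial (swapExp (mixExp k l 0)) (1 : K)) =
      monomial (swapExp (mixExp (k - 1) l 0)) (k : K) := by
    ext m
    rw [coeff_pderiv, coeff_monomial, coeff_monomial]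
    have : m + Finsupp.single (Sum.inr 0) 1 = swapExp (mixExp k l 0) ↔
        m = swapExp (mixExp (k - 1) l 0) := by
      rw [coord_ext_iff, coord_ext_iff]
      simp [swapExp_inl, swapExp_inr]
      omega
    simp only [this]
    split_ifs with h
    · rw [h, swapExp_inr, mixExp_inl_zero, one_mul, ← Nat.cast_succ, Nat.succ_eq_add_one,
        Nat.sub_add_cancel (Nat.one_le_iff_ne_zero.mpr hk)]
    · rw [zero_mul]
  have h1 : coeff (diagExp (resExp k q)) (pderiv K (Sum.inl 1) f *
      pderiv K (Sum.inr 1) (monomial (swapExp (mixExp k l 0)) (1 : K))) = 0 := by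
    rw [coeff_mul]
    refine Finset.sum_eq_zero fun p hp => ?_
    rw [Finset.HasAntidiagonal.mem_antidiagonal] at hp
    rw [coeff_pderiv (f := monomial _ _), coeff_monomial, if_neg, zero_mul, mul_zero]
    intro h
    have h2 := DFunLike.congr_fun h (Sum.inr 0)
    have h3 := DFunLike.congr_fun hp (Sum.inr 0)
    simp [swapExp_inr] at h2 h3
    omega
  rw [hinl, hinl, mul_zero, mul_zero, sub_zero, sub_zero, map_add, h1, add_zero, h0,
    coeff_mul_monomial, if_pos, coeff_pderiv]
  · have e : diagExp (resExp k q) - swapExp (mixExp (k - 1) l 0) + Finsupp.single (Sum.inl 0) 1 =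
        mixExp k l (q - l) := by
      rw [coord_ext_iff]
      simp [swapExp_inl, swapExp_inr]
      omega
    rw [e]
    have e2 : (((diagExp (resExp k q) - swapExp (mixExp (k - 1) l 0)) (Sum.inl 0) : ℕ) : K) + 1 =
        k := by
      rw [← Nat.cast_succ]
      congr 1
      simp [swapExp_inl]
      omega
    rw [e2]
    ring
  · rw [coord_le_iff]
    simp [swapExp_inl, swapExp_inr]
    omega

/-- As `f` is odd under the exchange and the bracket changes sign, both monomials of the
perturbation contribute equally; hence the 2. -/
theorem coeff_pb_pert {k l q : ℕ} (hk : k ≠ 0) (hq : l ≤ q) {f : MvPowerSeries (Coord 2) K}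
    (hf : swapVars f = -f) :
    coeff (diagExp (resExp k q)) (pb f (pert K k l)) =
      2 * (k * k * coeff (mixExp k l (q - l)) f) := by
  classical
  have h : swapVars (monomial (swapExp (mixExp k l 0)) (1 : K)) = monomial (mixExp k l 0) 1 := by
    ext m
    rw [coeff_swapVars, coeff_monomial, coeff_monomial]
    have : swapExp m = swapExp (mixExp k l 0) ↔ m = mixExp k l 0 :=
      ⟨fun h => by rw [← swapExp_swapExp m, h, swapExp_swapExp], fun h => by rw [h]⟩
    simp only [this]
  have h2 : pb f (monomial (mixExp k l 0) 1) =
      swapVars (pb f (monomial (swapExp (mixExp k l 0)) 1)) := by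
    rw [← neg_inj, ← pb_swapVars, hf, neg_pb, h]
  have h3 : swapExp (diagExp (resExp k q)) = diagExp (resExp k q) :=
    coord_ext (fun j => by rw [swapExp_inl]; rfl) (fun j => by rw [swapExp_inr]; rfl)
  rw [pert_eq_monomial, pb_add, map_add, h2, coeff_swapVars, h3, coeff_pb_monomial hk hq]
  ring

end Monomials

/-! ### The second-order contribution of one perturbation -/

section SecondOrder

/-- Brackets with the integrable part have no resonant terms. This eliminates the second-order
generator from the coefficient sought. -/
theorem coeff_pb_baseHam_of_res {K : Type*} [CommRing K] [Algebra ℝ K] (ω : Fin 2 → ℝ)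
    (f : MvPowerSeries (Coord 2) K) {m : Coord 2 →₀ ℕ} (hm : IsRes m) :
    coeff m (pb f (baseHam K ω)) = 0 := by
  rw [baseHam, pb_add, map_add, coeff_pb_quad, coeff_pb_act_mul_act_of_res hm, add_zero, divisor,
    Finset.sum_eq_zero fun j _ => by rw [hm j, sub_self, mul_zero], zero_smul]

theorem isNormalizing_baseHam {K : Type*} [CommRing K] [Algebra ℝ K] (ω : Fin 2 → ℝ) :
    IsNormalizing (baseHam K ω) (0 : MvPowerSeries (Coord 2) K) where
  mem := zero_mem _
  res m _ := map_zero _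
  nonres m hm := by
    have h0 : expAd (0 : MvPowerSeries (Coord 2) K) (baseHam K ω) = baseHam K ω :=
      eq_of_sub_mem_orderIdeal fun d => by
        have h1 := expAd_sub_lieSum_mem' (K := K) (zero_mem _) (d + 1) (baseHam K ω)
        have h2 : lieSum (d + 1) 0 (baseHam K ω) = baseHam K ω := by
          rw [lieSum, Finset.sum_range_succ', Finset.sum_eq_zero]
          · simp
          · intro k _
            rw [Function.iterate_succ_apply', ad_apply]
            simp [pb]
        rw [h2] at h1
        exact orderIdeal_anti (by omega) h1
    rw [h0, baseHam, map_add, coeff_quad_eq_zero ω hm, zero_add]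
    classical
    rw [act_eq_monomial, act_eq_monomial, monomial_mul_monomial, coeff_monomial, if_neg]
    rintro rfl
    refine hm fun i => ?_
    fin_cases i <;> simp

open Polynomial in
/-- The Lie series of `h = b + X F` generated by `χ = X χ₁ + X² χ₂`, modulo `X³`. -/
theorem coeff_expAd_polynomial {b F χ₁ : MvPowerSeries (Coord 2) ℝ}
    {χ₂ : MvPowerSeries (Coord 2) ℝ[X]}
    (hχ : MvPowerSeries.C Polynomial.X * MvPowerSeries.map Polynomial.C χ₁ +
      MvPowerSeries.C (Polynomial.X ^ 2) * χ₂ ∈ orderIdeal _ ℝ[X] 3) (m : Coord 2 →₀ ℕ) :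
    ∃ g : ℝ[X], MvPowerSeries.coeff m (expAd (MvPowerSeries.C Polynomial.X *
      MvPowerSeries.map Polynomial.C χ₁ + MvPowerSeries.C (Polynomial.X ^ 2) * χ₂)
      (MvPowerSeries.map Polynomial.C b + MvPowerSeries.C Polynomial.X *
        MvPowerSeries.map Polynomial.C F)) =
      Polynomial.C (MvPowerSeries.coeff m b) +
      Polynomial.X * Polynomial.C (MvPowerSeries.coeff m F + MvPowerSeries.coeff m (pb χ₁ b)) +
      Polynomial.X ^ 2 * (Polynomial.C (MvPowerSeries.coeff m (pb χ₁ F)) +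
        MvPowerSeries.coeff m (pb χ₂ (MvPowerSeries.map Polynomial.C b)) +
        Polynomial.C (2⁻¹ * MvPowerSeries.coeff m (pb χ₁ (pb χ₁ b)))) +
      Polynomial.X ^ 3 * g := by
  set χ := MvPowerSeries.C Polynomial.X * MvPowerSeries.map Polynomial.C χ₁ +
      MvPowerSeries.C (Polynomial.X ^ 2) * χ₂ with hχd
  set h := MvPowerSeries.map Polynomial.C b + MvPowerSeries.C Polynomial.X *
        MvPowerSeries.map Polynomial.C F with hh
  let χ' := MvPowerSeries.map Polynomial.C χ₁ + MvPowerSeries.C Polynomial.X * χ₂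
  have hχ' : χ = MvPowerSeries.C Polynomial.X * χ' := by
    rw [hχd, pow_two, MvPowerSeries.C.map_mul]
    simp only [χ']
    ring
  -- Since `χ` is divisible by `X`, all iterates from the third on go into the remainder `X³ g`.
  have hit : ∀ j, (ad χ)^[j] h = MvPowerSeries.C (Polynomial.X ^ j) * (ad χ')^[j] h := by
    intro j
    induction j with
    | zero => simp
    | succ j ih =>
      rw [Function.iterate_succ_apply', Function.iterate_succ_apply', ih, ad_apply, ad_apply,
        pb_C_mul, hχ', C_mul_pb, pow_succ, MvPowerSeries.C.map_mul, mul_assoc]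
  have h1 := expAd_sub_lieSum_mem' hχ (3 + m.degree) h m (by omega)
  rw [map_sub, sub_eq_zero] at h1
  have h3 : pb χ h = MvPowerSeries.C Polynomial.X * MvPowerSeries.map Polynomial.C (pb χ₁ b) +
      MvPowerSeries.C Polynomial.X ^ 2 * (MvPowerSeries.map Polynomial.C (pb χ₁ F) +
        pb χ₂ (MvPowerSeries.map Polynomial.C b)) +
      MvPowerSeries.C Polynomial.X ^ 3 * pb χ₂ (MvPowerSeries.map Polynomial.C F) := by
    rw [hχd, hh, add_pb, pb_add, pb_add, C_mul_pb, C_mul_pb, C_mul_pb, C_mul_pb, pb_C_mul,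
      pb_C_mul, pb_map, pb_map, map_pow]
    ring
  have h4 : pb χ (pb χ h) = MvPowerSeries.C Polynomial.X ^ 2 *
        MvPowerSeries.map Polynomial.C (pb χ₁ (pb χ₁ b)) +
      MvPowerSeries.C Polynomial.X ^ 3 * (pb χ₂ (MvPowerSeries.map Polynomial.C (pb χ₁ b)) +
        pb χ' (MvPowerSeries.map Polynomial.C (pb χ₁ F) +
          pb χ₂ (MvPowerSeries.map Polynomial.C b) +
          MvPowerSeries.C Polynomial.X * pb χ₂ (MvPowerSeries.map Polynomial.C F))) := by
    have e : pb χ h = MvPowerSeries.C Polynomial.X * (MvPowerSeries.map Polynomial.C (pb χ₁ b) +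
        MvPowerSeries.C Polynomial.X * (MvPowerSeries.map Polynomial.C (pb χ₁ F) +
          pb χ₂ (MvPowerSeries.map Polynomial.C b) +
          MvPowerSeries.C Polynomial.X * pb χ₂ (MvPowerSeries.map Polynomial.C F))) := by
      rw [h3]; ring
    rw [e, pb_C_mul, pb_add, pb_C_mul]
    nth_rewrite 1 [hχd]
    rw [hχ', C_mul_pb, add_pb, C_mul_pb, C_mul_pb, pb_map, map_pow]
    ring
  have h5 : ∃ g, lieSum (3 + m.degree) χ h = h + pb χ h + (2⁻¹ : ℝ) • pb χ (pb χ h) +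
      MvPowerSeries.C Polynomial.X ^ 3 * g := by
    refine ⟨∑ j ∈ Finset.range m.degree, ((3 + j).factorial : ℝ)⁻¹ •
      (MvPowerSeries.C Polynomial.X ^ j * (ad χ')^[3 + j] h), ?_⟩
    rw [lieSum, Finset.sum_range_add, Finset.mul_sum]
    congr 1
    · simp [Finset.sum_range_succ, ad_apply, Nat.factorial]
    · refine Finset.sum_congr rfl fun j _ => ?_
      rw [hit, mul_smul_comm, map_pow, pow_add, mul_assoc]
  obtain ⟨g, hg⟩ := h5
  have hs : ∀ r : ℝ, ∀ f : MvPowerSeries (Coord 2) ℝ[X],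
      r • f = MvPowerSeries.C (Polynomial.C r) * f := fun r f => by
    ext1 m
    rw [MvPowerSeries.coeff_C_mul, ← Polynomial.smul_eq_C_mul]
    rfl
  rw [h4, h3, hs] at hg
  have e : lieSum (3 + m.degree) χ h = MvPowerSeries.map Polynomial.C b +
      MvPowerSeries.C Polynomial.X * MvPowerSeries.map Polynomial.C (F + pb χ₁ b) +
      MvPowerSeries.C (Polynomial.X ^ 2) * (MvPowerSeries.map Polynomial.C (pb χ₁ F) +
        pb χ₂ (MvPowerSeries.map Polynomial.C b) +
        MvPowerSeries.C (Polynomial.C 2⁻¹) * MvPowerSeries.map Polynomial.C (pb χ₁ (pb χ₁ b))) +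
      MvPowerSeries.C (Polynomial.X ^ 3) * (pb χ₂ (MvPowerSeries.map Polynomial.C F) +
        MvPowerSeries.C (Polynomial.C 2⁻¹) * (pb χ₂ (MvPowerSeries.map Polynomial.C (pb χ₁ b)) +
        pb χ' (MvPowerSeries.map Polynomial.C (pb χ₁ F) +
          pb χ₂ (MvPowerSeries.map Polynomial.C b) +
          MvPowerSeries.C Polynomial.X * pb χ₂ (MvPowerSeries.map Polynomial.C F))) + g) := by
    rw [hg, hh, map_add, map_pow, map_pow]
    ring
  rw [h1, e]
  exact ⟨_, by
    simp only [map_add, MvPowerSeries.coeff_C_mul, MvPowerSeries.coeff_map, Polynomial.C_mul]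
    rfl⟩

open Polynomial in
/-- The coefficient of the Birkhoff normal form which a single pair of resonant monomials
produces at second order. -/
theorem coeff_two_coeff_expAd {ω : Fin 2 → ℝ} (hω : ∀ m, divisor ω m = 0 → IsRes m) (a : ℝ)
    {k l q : ℕ} (hk : 3 ≤ k) (hq : l ≤ q) {χ : MvPowerSeries (Coord 2) ℝ[X]}
    (hχ : IsNormalizing (baseHam _ ω + MvPowerSeries.C (Polynomial.X * algebraMap ℝ _ a) *
      pert _ k l) χ) :
    (MvPowerSeries.coeff (diagExp (resExp k q)) (expAd χ (baseHam _ ω +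
      MvPowerSeries.C (Polynomial.X * algebraMap ℝ _ a) * pert _ k l))).coeff 2 =
      (-1) ^ (q - l + 1) * a ^ 2 * k * (k / (k * ω 0 + l * ω 1)) ^ (q - l + 1) := by
  set h := baseHam ℝ[X] ω + MvPowerSeries.C (Polynomial.X * algebraMap ℝ _ a) * pert _ k l
    with hh
  let b : MvPowerSeries (Coord 2) ℝ := baseHam ℝ ω
  let F : MvPowerSeries (Coord 2) ℝ := MvPowerSeries.C a * pert ℝ k l
  have hb : baseHam ℝ[X] ω = MvPowerSeries.map Polynomial.C b := by
    simp [b, baseHam, quad, act, Polynomial.C_eq_algebraMap]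
  have hF : h = MvPowerSeries.map Polynomial.C b +
      MvPowerSeries.C Polynomial.X * MvPowerSeries.map Polynomial.C F := by
    rw [hh, hb]
    simp [F, pert, Polynomial.C_eq_algebraMap, mul_assoc]
  have hq3 : h - quad _ ω ∈ orderIdeal _ _ 3 := by
    rw [hh, add_sub_right_comm]
    exact add_mem (baseHam_sub_quad_mem ω) (Ideal.mul_mem_left _ _
      (orderIdeal_anti (by omega) (pert_mem _ _)))
  have hs : swapVars h = h := by
    rw [hh, swapVars_add, swapVars_mul, swapVars_baseHam, swapVars_pert, swapVars_C]
  have hsχ := hχ.swapVars_eq hω hq3 hs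
  -- At `X = 0` the Hamiltonian is already normal, and its unique generator is 0.
  have hχ0 : ∀ m, (MvPowerSeries.coeff m χ).coeff 0 = 0 := by
    let ev : ℝ[X] →ₐ[ℝ] ℝ := Polynomial.aeval 0
    have h1 := (hχ.map ev).1
    have h2 : MvPowerSeries.map ev.toRingHom h = baseHam ℝ ω := by
      ext m
      rw [hF, MvPowerSeries.coeff_map, map_add, MvPowerSeries.coeff_C_mul,
        MvPowerSeries.coeff_map]
      simp [ev, b]
    rw [h2] at h1
    have h3 := h1.eq hω (baseHam_sub_quad_mem ω) (isNormalizing_baseHam ω)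
    intro m
    have h4 := congrArg (MvPowerSeries.coeff m) h3
    rw [MvPowerSeries.coeff_map, map_zero] at h4
    rw [Polynomial.coeff_zero_eq_aeval_zero]
    exact h4
  let χ₁ : MvPowerSeries (Coord 2) ℝ := fun m => (MvPowerSeries.coeff m χ).coeff 1
  let χ₂ : MvPowerSeries (Coord 2) ℝ[X] := fun m => (MvPowerSeries.coeff m χ).divX.divX
  have hχ₁ : ∀ m, MvPowerSeries.coeff m χ₁ = (MvPowerSeries.coeff m χ).coeff 1 := fun _ => rfl
  have hχ₂ : ∀ m, MvPowerSeries.coeff m χ₂ = (MvPowerSeries.coeff m χ).divX.divX := fun _ => rfl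
  have hχe : χ = MvPowerSeries.C Polynomial.X * MvPowerSeries.map Polynomial.C χ₁ +
      MvPowerSeries.C (Polynomial.X ^ 2) * χ₂ := by
    ext1 m
    rw [map_add, MvPowerSeries.coeff_C_mul, MvPowerSeries.coeff_C_mul, MvPowerSeries.coeff_map,
      hχ₁, hχ₂]
    have h1 := Polynomial.divX_mul_X_add (MvPowerSeries.coeff m χ)
    have h2 := Polynomial.divX_mul_X_add (MvPowerSeries.coeff m χ).divX
    rw [Polynomial.coeff_divX] at h2
    rw [hχ0, map_zero, add_zero] at h1
    linear_combination -h1 - Polynomial.X * h2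
  have hsχ₁ : swapVars χ₁ = -χ₁ := by
    ext m
    have h1 := congrArg (fun f => (MvPowerSeries.coeff m f).coeff 1) hsχ
    simp only [coeff_swapVars, map_neg, Polynomial.coeff_neg] at h1
    rw [coeff_swapVars, map_neg, hχ₁, hχ₁, h1]
  have hexp := fun m => coeff_expAd_polynomial (b := b) (F := F) (hχe ▸ hχ.mem) m
  rw [← hχe, ← hF] at hexp
  -- The first-order homological equation. It holds without projection because `F` has no resonant
  -- monomials.
  have hG : pb χ₁ b = -F := by
    ext m
    by_cases hm : IsRes m
    · rw [coeff_pb_baseHam_of_res ω χ₁ hm, map_neg, MvPowerSeries.coeff_C_mul,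
        coeff_pert_of_res (by omega) hm, mul_zero, neg_zero]
    · obtain ⟨g, hg⟩ := hexp m
      have h1 := congrArg (fun p => Polynomial.coeff p 1) hg
      simp only [hχ.nonres m hm] at h1
      simp [Polynomial.coeff_X_pow_mul', Polynomial.coeff_X_mul] at h1
      rw [map_neg]
      linear_combination -h1
  -- By `hG`, `{χ₁,F} + {χ₁,{χ₁,b}}/2` collapses to `{χ₁,F}/2`.
  have hmain : (MvPowerSeries.coeff (diagExp (resExp k q)) (expAd χ h)).coeff 2 =
      2⁻¹ * MvPowerSeries.coeff (diagExp (resExp k q)) (pb χ₁ F) := by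
    obtain ⟨g, hg⟩ := hexp (diagExp (resExp k q))
    have h1 : pb χ₁ (-F) = -pb χ₁ F := by rw [← ad_apply, map_neg, ad_apply]
    rw [hg, hG, h1, ← hb, coeff_pb_baseHam_of_res ω χ₂ (isRes_diagExp _)]
    simp [Polynomial.coeff_X_pow_mul', Polynomial.coeff_C]
    ring
  have hκ : ∀ j, divisor ω (mixExp k l j) = k * ω 0 + l * ω 1 := fun j => by
    simp [divisor, Fin.sum_univ_two]
    ring
  have hκ0 : (k : ℝ) * ω 0 + l * ω 1 ≠ 0 := fun h0 => by
    have := hω _ ((hκ 0).trans h0) 0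
    simp at this
    omega
  set κ := (k : ℝ) * ω 0 + l * ω 1
  -- Along the chain the homological equation reads `κ c₀ = -a` and `κ c_(j+1) + k c_j = 0`.
  have hc : ∀ j, MvPowerSeries.coeff (mixExp k l j) χ₁ = -(a / κ) * (-(k / κ)) ^ j := by
    have h1 : ∀ j, κ * MvPowerSeries.coeff (mixExp k l j) χ₁ + MvPowerSeries.coeff (mixExp k l j)
        (pb χ₁ (act ℝ 0 * act ℝ 1)) = -(a * if j = 0 then 1 else 0) := fun j => by
      have h1 := congrArg (MvPowerSeries.coeff (mixExp k l j)) hG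
      simp only [b, F, baseHam] at h1
      rwa [pb_add, map_add, coeff_pb_quad, map_neg, MvPowerSeries.coeff_C_mul,
        coeff_pert_mixExp (by omega), hκ, smul_eq_mul] at h1
    intro j
    induction j with
    | zero =>
      have h2 := h1 0
      rw [coeff_pb_act_mul_act_mixExp_zero, if_pos rfl] at h2
      field_simp
      linear_combination h2
    | succ j ih =>
      have h2 := h1 (j + 1)
      rw [coeff_pb_act_mul_act_mixExp, if_neg (Nat.succ_ne_zero j), ih] at h2
      refine mul_left_cancel₀ hκ0 ?_
      rw [pow_succ]
      have e : κ * (-(a / κ) * ((-(k / κ)) ^ j * -(k / κ))) =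
          -(k * (-(a / κ) * (-(k / κ)) ^ j)) := by
        field_simp
      rw [e]
      linear_combination h2
  have hF2 : pb χ₁ F = MvPowerSeries.C a * pb χ₁ (pert ℝ k l) := pb_C_mul _ _ _
  rw [hmain, hF2, MvPowerSeries.coeff_C_mul, coeff_pb_pert (by omega) hq hsχ₁, hc, neg_pow,
    pow_succ, pow_succ]
  ring

end SecondOrder

/-! ### Coefficients of the normal form as polynomials in the parameters -/

section Universal

theorem monomial_mem_weightLE {n : ℕ} (w : Fin n → ℕ) {b : ℕ} {β : Fin n →₀ ℕ} (r : ℝ)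
    (h : ∑ j, β j * w j + 2 ≤ b) : MvPolynomial.monomial β r ∈ weightLE w b := by
  intro α hα
  rw [Finset.mem_singleton.mp (MvPolynomial.support_monomial_subset hα)]
  exact h

theorem C_mul_monomial_mem_filt {n : ℕ} (w : Fin n → ℕ) {e : Coord 2 →₀ ℕ}
    {c : MvPolynomial (Fin n) ℝ} (hc : c ∈ weightLE w (e (Sum.inl 0) + e (Sum.inr 0))) :
    C c * monomial e 1 ∈ filt w 0 := by
  classical
  intro m
  rw [coeff_C_mul, coeff_monomial]
  split_ifs with h
  · rw [mul_one, h]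
    exact hc
  · rw [mul_zero]
    exact zero_mem _

/-- The weight `k_j - 2` is the largest for which the perturbation `z_j ξ₁^(k_j) ξ₂^(l_j)` fits;
`I₁` and `I₁ I₂`, of degree 2 in the first pair, fit with constant coefficients. -/
theorem truncHam_sub_mem_filt (ω : Fin 2 → ℝ) {n : ℕ} (a : Fin n → ℝ) (τ : Fin n → ℕ × ℕ)
    (hτ : ∀ j, 3 ≤ (τ j).1) :
    truncHam ω a τ MvPolynomial.X - C (algebraMap ℝ _ (ω 1)) * act _ 1 ∈
      filt (fun j => (τ j).1 - 2) 0 := by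
  have e : truncHam (K := MvPolynomial (Fin n) ℝ) ω a τ MvPolynomial.X - C (algebraMap ℝ _ (ω 1)) * act _ 1 =
      C (algebraMap ℝ _ (ω 0)) * act _ 0 + C (algebraMap ℝ _ 1) * (act _ 0 * act _ 1) +
        ∑ j, C (MvPolynomial.X j * algebraMap ℝ _ (a j)) * pert _ (τ j).1 (τ j).2 := by
    rw [truncHam, baseHam, quad, Fin.sum_univ_two, map_one (algebraMap ℝ _), map_one C]
    ring
  have hC : ∀ r : ℝ, ∀ b, 2 ≤ b → (algebraMap ℝ (MvPolynomial (Fin n) ℝ) r) ∈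
      weightLE (fun j => (τ j).1 - 2) b := fun r b hb => by
    rw [MvPolynomial.algebraMap_eq, MvPolynomial.C_apply]
    exact monomial_mem_weightLE _ _ (by simpa using hb)
  rw [e]
  refine add_mem (add_mem ?_ ?_) (sum_mem fun j _ => ?_)
  · rw [act_eq_monomial]
    exact C_mul_monomial_mem_filt _ (hC _ _ (by simp))
  · rw [act_eq_monomial, act_eq_monomial, monomial_mul_monomial, one_mul]
    exact C_mul_monomial_mem_filt _ (hC _ _ (by simp))
  · have hX : MvPolynomial.X j * algebraMap ℝ _ (a j) =
        MvPolynomial.monomial (Finsupp.single j 1) (a j) := by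
      rw [MvPolynomial.algebraMap_eq, MvPolynomial.X, mul_comm, MvPolynomial.C_mul_monomial,
        mul_one]
    have hs : ∑ i, (Finsupp.single j 1 : Fin n →₀ ℕ) i * ((τ i).1 - 2) = (τ j).1 - 2 := by
      rw [Finset.sum_eq_single j] <;> simp +contextual
    have hj := hτ j
    rw [pert_eq_monomial, mul_add, hX]
    exact add_mem (C_mul_monomial_mem_filt _ (monomial_mem_weightLE _ _ (by rw [hs]; simp; omega)))
      (C_mul_monomial_mem_filt _ (monomial_mem_weightLE _ _
        (by rw [hs, swapExp_inl, swapExp_inr]; simp; omega)))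

/-- A polynomial whose only monomial of degree at least two in the last variable is its square. -/
theorem exists_eq_quadratic {n : ℕ} {p : MvPolynomial (Fin (n + 1)) ℝ}
    (hp : ∀ α ∈ p.support, α (Fin.last n) ≤ 1 ∨ α = Finsupp.single (Fin.last n) 2) :
    ∃ (P Q : MvPolynomial (Fin n) ℝ) (c : ℝ), ∀ (A : Type) [CommRing A] [Algebra ℝ A]
      (z : Fin (n + 1) → A), MvPolynomial.aeval z p = z (Fin.last n) ^ 2 * algebraMap ℝ A c +
        z (Fin.last n) * MvPolynomial.aeval (fun j : Fin n => z j.castSucc) P +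
        MvPolynomial.aeval (fun j : Fin n => z j.castSucc) Q := by
  rw [p.as_sum]
  refine Finset.sum_induction _ (fun p : MvPolynomial (Fin (n + 1)) ℝ => ∃ (P Q : MvPolynomial (Fin n) ℝ) (c : ℝ),
    ∀ (A : Type) [CommRing A] [Algebra ℝ A] (z : Fin (n + 1) → A),
      MvPolynomial.aeval z p = z (Fin.last n) ^ 2 * algebraMap ℝ A c +
        z (Fin.last n) * MvPolynomial.aeval (fun j : Fin n => z j.castSucc) P +
        MvPolynomial.aeval (fun j : Fin n => z j.castSucc) Q) ?_ ⟨0, 0, 0, by simp⟩ ?_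
  · rintro p p' ⟨P, Q, c, h⟩ ⟨P', Q', c', h'⟩
    refine ⟨P + P', Q + Q', c + c', fun A _ _ z => ?_⟩
    rw [map_add, h, h', map_add, map_add, map_add]
    ring
  · intro α hα
    have hmon : ∀ (A : Type) [CommRing A] [Algebra ℝ A] (z : Fin (n + 1) → A),
        MvPolynomial.aeval z (MvPolynomial.monomial α (p.coeff α)) = z (Fin.last n) ^ α (Fin.last n)
          * MvPolynomial.aeval (fun j : Fin n => z j.castSucc) (MvPolynomial.monomial
            (Finsupp.equivFunOnFinite.symm fun j => α j.castSucc) (p.coeff α)) := by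
      intro A _ _ z
      rw [MvPolynomial.aeval_monomial, MvPolynomial.aeval_monomial, Finsupp.prod_fintype _ _
        (by simp), Finsupp.prod_fintype _ _ (by simp), Fin.prod_univ_castSucc]
      simp only [Finsupp.equivFunOnFinite_symm_apply_apply]
      ring
    rcases hp α hα with h | h
    · rcases Nat.le_one_iff_eq_zero_or_eq_one.mp h with h0 | h1
      · exact ⟨0, _, 0, fun A _ _ z => by rw [hmon, h0]; simp; rfl⟩
      · exact ⟨_, 0, 0, fun A _ _ z => by rw [hmon, h1]; simp; rfl⟩
    · refine ⟨0, 0, p.coeff α, fun A _ _ z => ?_⟩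
      rw [MvPolynomial.aeval_monomial, h]
      simp [mul_comm]

/-- Normalisation is carried out once with indeterminate parameters and then specialised. The weight
bound reads `∑ α_j (k_j - 2) ≤ 2 (k - 2)`; as all weights are positive, an exponent 2 in the last
variable excludes every other variable. -/
theorem exists_coeff_expAd_truncHam {ω : Fin 2 → ℝ} (hω : ∀ m, divisor ω m = 0 → IsRes m) {n : ℕ}
    (a : Fin (n + 1) → ℝ) {τ : Fin (n + 1) → ℕ × ℕ} (hτ : ∀ j, 3 ≤ (τ j).1) {k l q : ℕ}
    (hkl : τ (Fin.last n) = (k, l)) (hq : l ≤ q) :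
    ∃ P Q : MvPolynomial (Fin n) ℝ, ∀ (z : Fin (n + 1) → ℝ) (χ : MvPowerSeries (Coord 2) ℝ),
      IsNormalizing (truncHam ω a τ z) χ →
      coeff (diagExp (resExp k q)) (expAd χ (truncHam ω a τ z)) =
        z (Fin.last n) ^ 2 * ((-1) ^ (q - l + 1) * a (Fin.last n) ^ 2 * k *
          (k / (k * ω 0 + l * ω 1)) ^ (q - l + 1)) +
        z (Fin.last n) * MvPolynomial.eval (fun j => z j.castSucc) P +
        MvPolynomial.eval (fun j => z j.castSucc) Q := by
  have hk : 3 ≤ k := by have := hτ (Fin.last n); rwa [hkl] at this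
  let h : MvPowerSeries (Coord 2) (MvPolynomial (Fin (n + 1)) ℝ) :=
    truncHam ω a τ MvPolynomial.X
  have hq3 : h - quad _ ω ∈ orderIdeal _ _ 3 := truncHam_sub_quad_mem ω a hτ _
  obtain ⟨χ, hχ⟩ := exists_isNormalizing hω hq3
  have hf := truncHam_sub_mem_filt ω a τ hτ
  set w : Fin (n + 1) → ℕ := fun j => (τ j).1 - 2 with hw
  have hp : coeff (diagExp (resExp k q)) (expAd χ h) ∈ weightLE w (2 * (k - 1)) := by
    have h1 := add_mem (expAd_sub_mem_filt hf (hχ.mem_filt hf hω hq3) (diagExp (resExp k q)))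
      (hf (diagExp (resExp k q)))
    have h2 : coeff (diagExp (resExp k q)) (act (MvPolynomial (Fin (n + 1)) ℝ) 1) = 0 := by
      classical
      rw [act_eq_monomial, coeff_monomial, if_neg]
      intro h
      have := DFunLike.congr_fun h (Sum.inl 0)
      simp at this
      omega
    rw [map_sub, map_sub, coeff_C_mul, h2, mul_zero, sub_zero, sub_add_cancel] at h1
    simpa [two_mul] using h1
  have hp' : ∀ α ∈ (coeff (diagExp (resExp k q)) (expAd χ h)).support,
      α (Fin.last n) ≤ 1 ∨ α = Finsupp.single (Fin.last n) 2 := by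
    intro α hα
    have h1 := hp α hα
    rw [Fin.sum_univ_castSucc] at h1
    have h2 : w (Fin.last n) = k - 2 := by rw [hw]; simp only [hkl]
    rw [h2] at h1
    by_contra! hcon
    have h3 : α (Fin.last n) = 2 := by
      have h4 : α (Fin.last n) * (k - 2) ≤ 2 * (k - 2) := by omega
      have h5 := Nat.le_of_mul_le_mul_right h4 (by omega)
      omega
    rw [h3] at h1
    have h6 : ∑ j : Fin n, α j.castSucc * w j.castSucc = 0 := by omega
    refine hcon.2 ?_
    ext j
    refine Fin.lastCases ?_ (fun j => ?_) j
    · simpa using h3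
    · have h7 := (Finset.sum_eq_zero_iff.mp h6) j (Finset.mem_univ _)
      have h8 := hτ j.castSucc
      rw [Finsupp.single_apply, if_neg (Fin.castSucc_lt_last j).ne']
      rcases Nat.mul_eq_zero.mp h7 with h9 | h9
      · exact h9
      · simp only [hw] at h9
        omega
  obtain ⟨P, Q, c, hPQ⟩ := exists_eq_quadratic hp'
  -- Specialisation is needed both in `ℝ`, for the result, and in `ℝ[X]`, to identify the constant
  -- `c`.
  have hspec : ∀ (A : Type) [CommRing A] [Algebra ℝ A] (z : Fin (n + 1) → A)
      (χ' : MvPowerSeries (Coord 2) A), IsNormalizing (truncHam ω a τ z) χ' →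
      coeff (diagExp (resExp k q)) (expAd χ' (truncHam ω a τ z)) =
        z (Fin.last n) ^ 2 * algebraMap ℝ A c +
        z (Fin.last n) * MvPolynomial.aeval (fun j => z j.castSucc) P +
        MvPolynomial.aeval (fun j => z j.castSucc) Q := by
    intro A _ _ z χ' hχ'
    have h1 := hχ.map (MvPolynomial.aeval z : MvPolynomial (Fin (n + 1)) ℝ →ₐ[ℝ] A)
    simp only [h, map_truncHam, MvPolynomial.aeval_X] at h1
    rw [hχ'.eq hω (truncHam_sub_quad_mem ω a hτ z) h1.1, ← h1.2, coeff_map, ← hPQ A z]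
    rfl
  refine ⟨P, Q, fun z χ' hχ' => ?_⟩
  have hc : c = (-1) ^ (q - l + 1) * a (Fin.last n) ^ 2 * k *
      (k / (k * ω 0 + l * ω 1)) ^ (q - l + 1) := by
    -- With the other parameters set to 0, `c` is the coefficient of `X²` in the one-perturbation
    -- problem.
    let z₀ : Fin (n + 1) → Polynomial ℝ := fun j => if j = Fin.last n then Polynomial.X else 0
    obtain ⟨χ₀, hχ₀⟩ := exists_isNormalizing hω (truncHam_sub_quad_mem ω a hτ z₀)
    have h1 := hspec _ z₀ χ₀ hχ₀
    have h2 : truncHam ω a τ z₀ = baseHam _ ω +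
        C (Polynomial.X * algebraMap ℝ _ (a (Fin.last n))) * pert _ k l := by
      rw [truncHam, Finset.sum_eq_single (Fin.last n)]
      · simp [z₀, hkl]
      · intro j _ hj
        simp [z₀, hj]
      · simp
    rw [h2] at hχ₀ h1
    have h3 := coeff_two_coeff_expAd hω (a (Fin.last n)) hk hq hχ₀
    rw [h1] at h3
    have h4 : ∀ R : MvPolynomial (Fin n) ℝ, MvPolynomial.aeval (fun j => z₀ j.castSucc) R =
        Polynomial.C (MvPolynomial.constantCoeff R) := fun R => by
      have : (fun j : Fin n => z₀ j.castSucc) = 0 := by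
        funext j
        simp [z₀, (Fin.castSucc_lt_last j).ne]
      rw [this, MvPolynomial.aeval_zero]
      rfl
    rw [h4, h4] at h3
    rw [← h3]
    simp [z₀]
  rw [hspec ℝ z χ' hχ', hc]
  rfl

end Universal

/-! ### Convergent power series and uniqueness of Taylor coefficients -/

section Taylor

theorem prod_smul_pow {σ : Type} [Fintype σ] (t : ℝ) (z : σ → ℝ) (m : σ →₀ ℕ) :
    m.prod (fun s e => (t • z) s ^ e) = t ^ m.degree * m.prod (fun s e => z s ^ e) := by
  simp only [Pi.smul_apply, smul_eq_mul, mul_pow, Finsupp.prod_mul]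
  congr 1
  rw [Finsupp.prod, Finset.prod_pow_eq_pow_sum, Finsupp.degree_apply]

/-- On a line `t ↦ t z` the sum is a power series in `t` whose coefficients are the homogeneous
parts of `p` at `z`. These vanish for every `z`, hence as polynomials. -/
theorem eq_zero_of_hasSum_zero {σ : Type} [Fintype σ] {p : MvPowerSeries σ ℝ}
    (h : HasTaylorSeriesAtZero 0 p) : p = 0 := by
  classical
  have hfin : ∀ d : ℕ, {m : σ →₀ ℕ | m.degree = d}.Finite := fun d =>
    (Finset.finite_toSet (Finset.finsuppAntidiag Finset.univ d)).subset fun m hm => by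
      simp only [Finset.mem_coe, Finset.mem_finsuppAntidiag, Finset.subset_univ, and_true]
      rw [← hm, Finsupp.degree_eq_sum]
  let A : ℕ → MvPolynomial σ ℝ := fun d =>
    ∑ m ∈ (hfin d).toFinset, MvPolynomial.monomial m (coeff m p)
  have hA : ∀ d, A d = 0 := by
    suffices H : ∀ (z : σ → ℝ) (d : ℕ), MvPolynomial.eval z (A d) = 0 from
      fun d => MvPolynomial.funext fun z => by rw [H z d, map_zero]
    intro z
    let q : FormalMultilinearSeries ℝ ℝ ℝ :=
      FormalMultilinearSeries.ofScalars ℝ fun d => MvPolynomial.eval z (A d)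
    have hq : HasFPowerSeriesAt (0 : ℝ → ℝ) q 0 := by
      rw [hasFPowerSeriesAt_iff]
      have hc : Filter.Tendsto (fun t : ℝ => t • z) (nhds 0) (nhds 0) := by
        have : Continuous fun t : ℝ => t • z := by fun_prop
        simpa using this.tendsto 0
      filter_upwards [hc.eventually h] with t ht
      simp only [prod_smul_pow, Pi.zero_apply] at ht
      rw [← (Equiv.sigmaFiberEquiv (fun m : σ →₀ ℕ => m.degree)).hasSum_iff] at ht
      have h2 := ht.sigma (g := fun d => t ^ d • q.coeff d) fun d => ?_
      · exact h2
      · have : Finite {m : σ →₀ ℕ // m.degree = d} := hfin d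
        have := Fintype.ofFinite {m : σ →₀ ℕ // m.degree = d}
        have h3 := hasSum_fintype fun m : {m : σ →₀ ℕ // m.degree = d} =>
          ((fun m => coeff m p * (t ^ m.degree * m.prod fun s e => z s ^ e)) ∘
            Equiv.sigmaFiberEquiv fun m : σ →₀ ℕ => m.degree) ⟨d, m⟩
        convert h3 using 1
        simp only [q, FormalMultilinearSeries.coeff_ofScalars, A, map_sum,
          MvPolynomial.eval_monomial, Finset.smul_sum]
        rw [Finset.sum_subtype (p := fun m : σ →₀ ℕ => m.degree = d) _ (by simp)]
        refine Finset.sum_congr rfl fun m _ => ?_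
        simp only [Function.comp, Equiv.sigmaFiberEquiv, Equiv.coe_fn_mk, smul_eq_mul, m.2]
        ring
    have h0 := hq.eq_zero
    intro d
    have h1 : q.coeff d = 0 := by rw [h0]; rfl
    simpa [q, FormalMultilinearSeries.coeff_ofScalars] using h1
  ext m
  have h1 := congrArg (MvPolynomial.coeff m) (hA m.degree)
  simp only [A, MvPolynomial.coeff_sum, MvPolynomial.coeff_monomial, MvPolynomial.coeff_zero] at h1
  rw [Finset.sum_ite_eq' , if_pos (by simp)] at h1
  rw [h1, map_zero]

theorem HasTaylorSeriesAtZero.unique {σ : Type} [Fintype σ] {f : (σ → ℝ) → ℝ}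
    {p q : MvPowerSeries σ ℝ} (hp : HasTaylorSeriesAtZero f p) (hq : HasTaylorSeriesAtZero f q) :
    p = q := by
  rw [← sub_eq_zero]
  apply eq_zero_of_hasSum_zero
  filter_upwards [hp, hq] with z h1 h2
  simpa [sub_mul] using h1.sub h2

theorem HasTaylorSeriesAtZero.add {σ : Type} [Fintype σ] {f g : (σ → ℝ) → ℝ}
    {p q : MvPowerSeries σ ℝ} (hp : HasTaylorSeriesAtZero f p) (hq : HasTaylorSeriesAtZero g q) :
    HasTaylorSeriesAtZero (fun z => f z + g z) (p + q) := by
  filter_upwards [hp, hq] with z h1 h2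
  simpa [add_mul] using h1.add h2

theorem hasSum_coe {σ : Type} [Fintype σ] (p : MvPolynomial σ ℝ) (z : σ → ℝ) :
    HasSum (fun m : σ →₀ ℕ => coeff m (p : MvPowerSeries σ ℝ) * m.prod (fun s e => z s ^ e))
      (MvPolynomial.eval z p) := by
  rw [MvPolynomial.eval_eq']
  simp only [MvPolynomial.coeff_coe]
  have : ∀ m : σ →₀ ℕ, m.prod (fun s e => z s ^ e) = ∏ i, z i ^ m i := fun m =>
    Finsupp.prod_fintype _ _ (by simp)
  simp only [this]
  exact hasSum_sum_of_ne_finset_zero fun m hm => by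
    rw [MvPolynomial.notMem_support_iff.mp hm, zero_mul]

/-- A series of polynomials that converges absolutely, uniformly near the origin, can be summed
coefficientwise. -/
theorem hasTaylorSeriesAtZero_tsum {σ : Type} [Fintype σ] {p M : ℕ → MvPolynomial σ ℝ}
    (hpM : ∀ n m, |(p n).coeff m| ≤ (M n).coeff m) {s : ℕ → ℕ} (hs : ∀ n, n ≤ s n)
    (hdeg : ∀ n m, m.degree < s n → (p n).coeff m = 0)
    {r : ℝ} (hr : 0 < r) (hM : Summable fun n => MvPolynomial.eval (fun _ => r) (M n)) :
    HasTaylorSeriesAtZero (fun z => ∑' n, MvPolynomial.eval z (p n))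
      (fun m => ∑ n ∈ Finset.range (m.degree + 1), (p n).coeff m : MvPowerSeries σ ℝ) := by
  have hnhds : Metric.ball (0 : σ → ℝ) r ∈ nhds 0 := Metric.ball_mem_nhds 0 hr
  filter_upwards [hnhds] with z hz
  have hz' : ∀ i, |z i| ≤ r := fun i =>
    (norm_le_pi_norm z i).trans (mem_ball_zero_iff.mp hz).le
  have hprod : ∀ m : σ →₀ ℕ, |m.prod (fun s e => z s ^ e)| ≤ m.prod (fun _ e => r ^ e) := by
    intro m
    rw [Finsupp.prod, Finsupp.prod, Finset.abs_prod]
    refine Finset.prod_le_prod (fun _ _ => abs_nonneg _) fun i _ => ?_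
    rw [abs_pow]
    exact pow_le_pow_left₀ (abs_nonneg _) (hz' i) _
  let F : ℕ × (σ →₀ ℕ) → ℝ := fun x => (p x.1).coeff x.2 * x.2.prod (fun s e => z s ^ e)
  have hM0 : ∀ n m, 0 ≤ (M n).coeff m := fun n m => (abs_nonneg _).trans (hpM n m)
  -- Absolute summability over all pairs allows summing first over the monomials or first over `n`.
  have hsM : Summable fun x : ℕ × (σ →₀ ℕ) => (M x.1).coeff x.2 * x.2.prod (fun _ e => r ^ e) := by
    have h1 := fun n => hasSum_coe (M n) fun _ => r
    simp only [MvPolynomial.coeff_coe] at h1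
    refine (summable_prod_of_nonneg fun x => mul_nonneg (hM0 _ _)
      (Finset.prod_nonneg fun _ _ => by positivity)).mpr ⟨fun n => (h1 n).summable, hM.congr fun n => (h1 n).tsum_eq.symm⟩
  have hsF : Summable F := by
    refine Summable.of_norm_bounded hsM fun x => ?_
    rw [Real.norm_eq_abs, abs_mul]
    exact mul_le_mul (hpM _ _) (hprod _) (abs_nonneg _) (hM0 _ _)
  have h1 : HasSum (fun n => MvPolynomial.eval z (p n)) (∑' x, F x) := by
    refine hsF.hasSum.prod_fiberwise fun n => ?_
    have := hasSum_coe (p n) z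
    simpa only [MvPolynomial.coeff_coe] using this
  have h2 : HasSum (fun m : σ →₀ ℕ => (∑ n ∈ Finset.range (m.degree + 1), (p n).coeff m) *
      m.prod (fun s e => z s ^ e)) (∑' x, F x) := by
    have h3 := (Equiv.prodComm (σ →₀ ℕ) ℕ).hasSum_iff.mpr hsF.hasSum
    refine h3.prod_fiberwise fun m => ?_
    rw [Finset.sum_mul]
    refine hasSum_sum_of_ne_finset_zero fun n hn => ?_
    have h4 : m.degree < s n := by
      have := hs n
      rw [Finset.mem_range] at hn
      omega
    simp [F, hdeg n m h4]
  rw [h1.tsum_eq]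
  exact h2

end Taylor

/-! ### Locally finite sums of formal series -/

section LocallyFinite

variable {σ : Type*} {K : Type*} [CommRing K]

/-- The sum of a sequence of series, the `n`-th of which has order at least `n`. -/
def lazySum (f : ℕ → MvPowerSeries σ K) : MvPowerSeries σ K :=
  fun m => ∑ n ∈ Finset.range (m.degree + 1), coeff m (f n)

theorem coeff_lazySum (f : ℕ → MvPowerSeries σ K) (m : σ →₀ ℕ) :
    coeff m (lazySum f) = ∑ n ∈ Finset.range (m.degree + 1), coeff m (f n) := rfl

theorem lazySum_sub_sum_mem {f : ℕ → MvPowerSeries σ K} {s : ℕ → ℕ}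
    (hf : ∀ n, f n ∈ orderIdeal σ K (s n)) (hs : ∀ n, n ≤ s n) {N e : ℕ}
    (hN : ∀ n, N ≤ n → e ≤ s n) : lazySum f - ∑ n ∈ Finset.range N, f n ∈ orderIdeal σ K e := by
  intro m hm
  rw [map_sub, map_sum, coeff_lazySum, sub_eq_zero]
  have h1 : ∀ M, (∀ n, M ≤ n → m.degree < s n) →
      ∑ n ∈ Finset.range M, coeff m (f n) =
        ∑ n ∈ Finset.range (max N (m.degree + 1)), coeff m (f n) := by
    intro M hM
    have h2 : ∀ M' M'', M'' ≤ M' → (∀ n, M'' ≤ n → m.degree < s n) →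
        ∑ n ∈ Finset.range M'', coeff m (f n) = ∑ n ∈ Finset.range M', coeff m (f n) :=
      fun M' M'' h h' => Finset.sum_subset (Finset.range_subset_range.mpr h) fun n _ hn =>
        hf n m (h' n (by simpa using hn))
    rcases le_total M (max N (m.degree + 1)) with h | h
    · exact h2 _ _ h hM
    · exact (h2 _ _ h fun n hn => by have := hs n; omega).symm
  rw [h1 _ fun n hn => hm.trans_le (hN n hn)]
  exact h1 _ fun n hn => by have := hs n; omega

end LocallyFinite

/-! ### Coefficientwise majorants -/

section Majorants

variable {σ : Type*}

theorem norm_coeff_mul_le {f f' : MvPolynomial σ ℂ} {g g' : MvPolynomial σ ℝ}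
    (h : ∀ m, ‖f.coeff m‖ ≤ g.coeff m) (h' : ∀ m, ‖f'.coeff m‖ ≤ g'.coeff m) (m : σ →₀ ℕ) :
    ‖(f * f').coeff m‖ ≤ (g * g').coeff m := by
  classical
  rw [MvPolynomial.coeff_mul, MvPolynomial.coeff_mul]
  refine (norm_sum_le _ _).trans (Finset.sum_le_sum fun x _ => ?_)
  rw [norm_mul]
  exact mul_le_mul (h _) (h' _) (norm_nonneg _) ((norm_nonneg _).trans (h _))

theorem norm_coeff_pow_le {f : MvPolynomial σ ℂ} {g : MvPolynomial σ ℝ}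
    (h : ∀ m, ‖f.coeff m‖ ≤ g.coeff m) (n : ℕ) (m : σ →₀ ℕ) :
    ‖(f ^ n).coeff m‖ ≤ (g ^ n).coeff m := by
  induction n generalizing m with
  | zero =>
    classical
    rw [pow_zero, pow_zero, MvPolynomial.coeff_one, MvPolynomial.coeff_one]
    split_ifs <;> simp
  | succ n ih =>
    rw [pow_succ, pow_succ]
    exact norm_coeff_mul_le ih h m

end Majorants

/-! ### The perturbing terms as real polynomials in `(x,y)` -/

section RealForm

/-- The polynomial `ξ_j` (for `c = i`) or `η_j` (for `c = -i`). -/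
def xiPoly (c : ℂ) (j : Fin 2) : MvPolynomial (Coord 2) ℂ :=
  MvPolynomial.C ((Real.sqrt 2 : ℂ)⁻¹) *
    (MvPolynomial.X (Sum.inl j) + MvPolynomial.C c * MvPolynomial.X (Sum.inr j))

/-- The resonant monomials `ξ₁^k ξ₂^l + η₁^k η₂^l` in the variables `(x,y)`. -/
def pertPoly (k l : ℕ) : MvPolynomial (Coord 2) ℂ :=
  xiPoly Complex.I 0 ^ k * xiPoly Complex.I 1 ^ l +
    xiPoly (-Complex.I) 0 ^ k * xiPoly (-Complex.I) 1 ^ l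

/-- A majorant of `pertPoly k l`. -/
def pertMajorant (k l : ℕ) : MvPolynomial (Coord 2) ℝ :=
  2 * ((MvPolynomial.X (Sum.inl 0) + MvPolynomial.X (Sum.inr 0)) ^ k *
    (MvPolynomial.X (Sum.inl 1) + MvPolynomial.X (Sum.inr 1)) ^ l)

theorem norm_coeff_xiPoly_le {c : ℂ} (hc : ‖c‖ ≤ 1) (j : Fin 2) (m : Coord 2 →₀ ℕ) :
    ‖(xiPoly c j).coeff m‖ ≤ (MvPolynomial.X (Sum.inl j) + MvPolynomial.X (Sum.inr j) :
      MvPolynomial (Coord 2) ℝ).coeff m := by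
  classical
  have h2 : ‖(Real.sqrt 2 : ℂ)⁻¹‖ ≤ 1 := by
    rw [norm_inv, Complex.norm_real, Real.norm_of_nonneg (Real.sqrt_nonneg _)]
    exact inv_le_one_of_one_le₀ (Real.one_le_sqrt.mpr (by norm_num))
  rw [xiPoly, MvPolynomial.coeff_C_mul, MvPolynomial.coeff_add, MvPolynomial.coeff_add,
    MvPolynomial.coeff_C_mul, norm_mul]
  refine (mul_le_of_le_one_left (norm_nonneg _) h2).trans ((norm_add_le _ _).trans ?_)
  rw [norm_mul]
  have h3 : ∀ s : Coord 2, ‖(MvPolynomial.X s : MvPolynomial (Coord 2) ℂ).coeff m‖ =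
      (MvPolynomial.X s : MvPolynomial (Coord 2) ℝ).coeff m := fun s => by
    rw [MvPolynomial.coeff_X, MvPolynomial.coeff_X]
    split_ifs <;> simp
  rw [← h3, ← h3]
  gcongr
  exact mul_le_of_le_one_left (norm_nonneg _) hc

theorem norm_coeff_pertPoly_le (k l : ℕ) (m : Coord 2 →₀ ℕ) :
    ‖(pertPoly k l).coeff m‖ ≤ (pertMajorant k l).coeff m := by
  have h : ∀ c : ℂ, ‖c‖ ≤ 1 → ‖(xiPoly c 0 ^ k * xiPoly c 1 ^ l).coeff m‖ ≤
      ((MvPolynomial.X (Sum.inl 0) + MvPolynomial.X (Sum.inr 0)) ^ k *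
        (MvPolynomial.X (Sum.inl 1) + MvPolynomial.X (Sum.inr 1)) ^ l :
        MvPolynomial (Coord 2) ℝ).coeff m := fun c hc =>
    norm_coeff_mul_le (norm_coeff_pow_le (norm_coeff_xiPoly_le hc 0) k)
      (norm_coeff_pow_le (norm_coeff_xiPoly_le hc 1) l) m
  rw [pertPoly, pertMajorant, two_mul, MvPolynomial.coeff_add, MvPolynomial.coeff_add]
  exact (norm_add_le _ _).trans (add_le_add (h _ (by simp)) (h _ (by simp)))

theorem eval_pertMajorant (k l : ℕ) (r : ℝ) :
    MvPolynomial.eval (fun _ => r) (pertMajorant k l) = 2 * (2 * r) ^ (k + l) := by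
  simp [pertMajorant, two_mul, pow_add]

/-- Conjugating the coefficients exchanges the two summands of `pertPoly`. -/
theorem exists_map_eq_pertPoly (k l : ℕ) :
    ∃ p : MvPolynomial (Coord 2) ℝ, MvPolynomial.map Complex.ofRealHom p = pertPoly k l := by
  have hconj : MvPolynomial.map (starRingEnd ℂ) (pertPoly k l) = pertPoly k l := by
    simp only [pertPoly, xiPoly, map_add, map_mul, map_pow, MvPolynomial.map_C, MvPolynomial.map_X,
      map_inv₀, Complex.conj_ofReal, Complex.conj_I, map_neg, neg_neg]
    exact add_comm _ _
  have : pertPoly k l ∈ Set.range (MvPolynomial.map (σ := Coord 2) Complex.ofRealHom) := by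
    rw [MvPolynomial.mem_range_map_iff_coeffs_subset]
    intro c hc
    rw [Finset.mem_coe, MvPolynomial.mem_coeffs_iff] at hc
    obtain ⟨m, -, rfl⟩ := hc
    have h1 := congrArg (MvPolynomial.coeff m) hconj
    rw [MvPolynomial.coeff_map] at h1
    exact ⟨_, Complex.conj_eq_iff_re.mp h1⟩
  exact this

/-- The real polynomial `ξ₁^k ξ₂^l + η₁^k η₂^l` in the variables `(x,y)`. -/
def realPert (k l : ℕ) : MvPolynomial (Coord 2) ℝ := (exists_map_eq_pertPoly k l).choose

theorem map_realPert (k l : ℕ) :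
    MvPolynomial.map Complex.ofRealHom (realPert k l) = pertPoly k l :=
  (exists_map_eq_pertPoly k l).choose_spec

theorem abs_coeff_realPert_le (k l : ℕ) (m : Coord 2 →₀ ℕ) :
    |(realPert k l).coeff m| ≤ (pertMajorant k l).coeff m := by
  have h := norm_coeff_pertPoly_le k l m
  rwa [← map_realPert, MvPolynomial.coeff_map, Complex.ofRealHom_eq_coe, Complex.norm_real] at h

theorem eval_realPert (k l : ℕ) (z : Coord 2 → ℝ) :
    MvPolynomial.eval z (realPert k l) =
      (xi 0 z ^ k * xi 1 z ^ l + eta 0 z ^ k * eta 1 z ^ l).re := by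
  have h1 : ((MvPolynomial.eval z (realPert k l) : ℝ) : ℂ) =
      MvPolynomial.eval (fun s => (z s : ℂ)) (pertPoly k l) := by
    rw [← map_realPert, MvPolynomial.eval_map, ← Complex.ofRealHom_eq_coe,
      MvPolynomial.eval₂_comp]
    rfl
  have h2 : ∀ j, MvPolynomial.eval (fun s => (z s : ℂ)) (xiPoly Complex.I j) = xi j z := fun j => by
    simp [xiPoly, xi]
    ring
  have h3 : ∀ j, MvPolynomial.eval (fun s => (z s : ℂ)) (xiPoly (-Complex.I) j) = eta j z :=
    fun j => by
    simp [xiPoly, eta]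
    ring
  rw [← Complex.ofReal_re (MvPolynomial.eval z _), h1]
  simp only [pertPoly, map_add, map_mul, map_pow, h2, h3]

theorem toXiEta_realPert (k l : ℕ) :
    toXiEta (realPert k l : MvPowerSeries (Coord 2) ℝ) = cplx (pert ℝ k l) := by
  have h1 : cplx (realPert k l : MvPowerSeries (Coord 2) ℝ) =
      (pertPoly k l : MvPowerSeries (Coord 2) ℂ) := by
    ext m
    rw [← map_realPert, coeff_map, MvPolynomial.coeff_coe, MvPolynomial.coeff_coe,
      MvPolynomial.coeff_map]
  have h2 : ∀ j, (xiPoly Complex.I j : MvPowerSeries (Coord 2) ℂ) = xiEtaOfXY (Sum.inl j) :=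
    fun j => by simp [xiPoly, xiEtaOfXY]
  have h3 : ∀ j, (xiPoly (-Complex.I) j : MvPowerSeries (Coord 2) ℂ) = xiEtaOfXY (Sum.inr j) :=
    fun j => by
      simp only [xiPoly, xiEtaOfXY, MvPolynomial.coe_mul, MvPolynomial.coe_add, MvPolynomial.coe_C,
        MvPolynomial.coe_X, map_neg, neg_mul, sub_eq_add_neg]
      rw [← neg_mul, ← map_neg MvPolynomial.C, MvPolynomial.coe_mul, MvPolynomial.coe_C, map_neg,
        MvPolynomial.coe_X, neg_mul]
  have hsub := hasSubst_of_mem xiEtaOfXY_mem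
  have h4 : (pertPoly k l : MvPowerSeries (Coord 2) ℂ) = subst xiEtaOfXY (pert ℂ k l) := by
    rw [pert, subst_add hsub, subst_mul hsub, subst_mul hsub, subst_pow hsub, subst_pow hsub,
      subst_pow hsub, subst_pow hsub, subst_X hsub, subst_X hsub, subst_X hsub, subst_X hsub,
      ← h2, ← h2, ← h3, ← h3]
    simp [pertPoly]
  rw [toXiEta, h1, h4, subst_xyOfXiEta_subst]
  simp [pert]

theorem realPert_mem (k l : ℕ) :
    (realPert k l : MvPowerSeries (Coord 2) ℝ) ∈ orderIdeal _ ℝ (k + l) := by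
  rw [← toXiEta_mem, toXiEta_realPert]
  exact map_mem_orderIdeal (pert_mem k l) Complex.ofRealHom

end RealForm

/-! ### The full Hamiltonian, its Taylor series and its truncations -/

section FullHamiltonian

theorem toXiEta_add (f g : MvPowerSeries (Coord 2) ℝ) :
    toXiEta (f + g) = toXiEta f + toXiEta g := by
  rw [toXiEta, cplx, map_add, subst_add (hasSubst_of_mem xyOfXiEta_mem)]
  rfl

theorem toXiEta_mul (f g : MvPowerSeries (Coord 2) ℝ) :
    toXiEta (f * g) = toXiEta f * toXiEta g := by
  rw [toXiEta, cplx, map_mul, subst_mul (hasSubst_of_mem xyOfXiEta_mem)]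
  rfl

theorem toXiEta_C (r : ℝ) : toXiEta (C r) = C (r : ℂ) := by
  rw [toXiEta, cplx, map_C, subst_C]
  rfl

theorem toXiEta_sum {ι : Type*} (s : Finset ι) (f : ι → MvPowerSeries (Coord 2) ℝ) :
    toXiEta (∑ i ∈ s, f i) = ∑ i ∈ s, toXiEta (f i) := by
  classical
  induction s using Finset.induction_on with
  | empty => simpa using toXiEta_C 0
  | insert i s hi ih => rw [Finset.sum_insert hi, Finset.sum_insert hi, toXiEta_add, ih]

/-- The action variable as a polynomial in `(x,y)`. -/
def actPoly (j : Fin 2) : MvPolynomial (Coord 2) ℝ :=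
  MvPolynomial.C (1 / 2 : ℝ) *
    (MvPolynomial.X (Sum.inl j) ^ 2 + MvPolynomial.X (Sum.inr j) ^ 2)

/-- The integrable part `(ω₁ + I₂) I₁ + ω₂ I₂` as a polynomial in `(x,y)`. -/
def basePoly (ω : Fin 2 → ℝ) : MvPolynomial (Coord 2) ℝ :=
  (MvPolynomial.C (ω 0) + actPoly 1) * actPoly 0 + MvPolynomial.C (ω 1) * actPoly 1

theorem toXiEta_basePoly (ω : Fin 2 → ℝ) :
    toXiEta (basePoly ω : MvPowerSeries (Coord 2) ℝ) = cplx (baseHam ℝ ω) := by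
  have h1 : ∀ j, (actPoly j : MvPowerSeries (Coord 2) ℝ) = formalAction j := fun j => by
    simp [actPoly, formalAction]
  have h2 : (basePoly ω : MvPowerSeries (Coord 2) ℝ) =
      (C (ω 0) + formalAction 1) * formalAction 0 + C (ω 1) * formalAction 1 := by
    simp [basePoly, h1]
  rw [h2, toXiEta_add, toXiEta_mul, toXiEta_mul, toXiEta_add, toXiEta_C, toXiEta_C,
    toXiEta_formalAction, toXiEta_formalAction]
  simp [baseHam, quad, act, Fin.sum_univ_two]
  ring

variable (ω : Fin 2 → ℝ) (k l : ℕ → ℕ) (c : ℕ → ℝ)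

/-- The series `H` in the variables `(ξ,η)`; `c n` is the coefficient of the `n`-th
perturbation. -/
def fullHam : MvPowerSeries (Coord 2) ℝ :=
  baseHam ℝ ω + lazySum fun n => C (c n) * pert ℝ (k n) (l n)

/-- The Taylor series of `H` in the variables `(x,y)`. -/
def realHam : MvPowerSeries (Coord 2) ℝ :=
  (basePoly ω : MvPowerSeries (Coord 2) ℝ) +
    lazySum fun n => C (c n) * (realPert (k n) (l n) : MvPowerSeries (Coord 2) ℝ)

variable {k l} (hs : StrictMono fun n => k n + l n)

include hs in
theorem toXiEta_realHam : toXiEta (realHam ω k l c) = cplx (fullHam ω k l c) := by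
  have h0 : cplx (fullHam ω k l c) = cplx (baseHam ℝ ω) +
      cplx (lazySum fun n => C (c n) * pert ℝ (k n) (l n)) := map_add _ _ _
  rw [h0, realHam, toXiEta_add, toXiEta_basePoly]
  congr 1
  refine eq_of_sub_mem_orderIdeal fun e => ?_
  have hN : ∀ n, e ≤ n → e ≤ k n + l n := fun n hn => hn.trans (hs.le_apply (x := n))
  have h1 := lazySum_sub_sum_mem (f := fun n => C (c n) * pert ℝ (k n) (l n))
    (fun n => Ideal.mul_mem_left _ _ (pert_mem (k n) (l n))) (fun n => hs.le_apply) hN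
  have h2 := lazySum_sub_sum_mem
    (f := fun n => C (c n) * (realPert (k n) (l n) : MvPowerSeries (Coord 2) ℝ))
    (fun n => Ideal.mul_mem_left _ _ (realPert_mem (k n) (l n))) (fun n => hs.le_apply) hN
  rw [← toXiEta_mem, toXiEta_sub, toXiEta_sum] at h2
  simp only [toXiEta_mul, toXiEta_C, toXiEta_realPert] at h2
  have h3 := map_mem_orderIdeal h1 Complex.ofRealHom
  rw [map_sub, map_sum] at h3
  simp only [map_mul, map_C, Complex.ofRealHom_eq_coe] at h3
  have h4 := sub_mem h2 h3
  rwa [sub_sub_sub_cancel_right] at h4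

include hs in
theorem fullHam_sub_truncHam_mem {ζ a : ℕ → ℝ} (hc : ∀ n, c n = ζ n * a n) (N : ℕ) :
    fullHam ω k l c - truncHam ω (fun j : Fin N => a j) (fun j => (k j, l j)) (fun j => ζ j) ∈
      orderIdeal _ ℝ (k N + l N) := by
  have h1 := lazySum_sub_sum_mem (f := fun n => C (c n) * pert ℝ (k n) (l n))
    (fun n => Ideal.mul_mem_left _ _ (pert_mem (k n) (l n))) (fun n => hs.le_apply)
    (N := N) (e := k N + l N) (fun n hn => hs.monotone hn)
  rw [Finset.sum_range] at h1
  rw [fullHam, truncHam, add_sub_add_left_eq_sub]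
  simpa only [Algebra.algebraMap_self, RingHom.id_apply, ← hc] using h1

include hs in
theorem fullHam_sub_quad_mem (hk : ∀ n, 3 ≤ k n) :
    fullHam ω k l c - quad ℝ ω ∈ orderIdeal _ ℝ 3 := by
  have h1 := fullHam_sub_truncHam_mem ω c hs (ζ := c) (a := 1) (by simp) 0
  have h2 := truncHam_sub_quad_mem ω (fun j : Fin 0 => (1 : ℕ → ℝ) j)
    (τ := fun j => (k j, l j)) (fun j => hk j) (fun j => c j)
  have h3 := add_mem (orderIdeal_anti (by have := hk 0; omega) h1) h2
  rwa [sub_add_sub_cancel] at h3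

include hs in
theorem swapVars_fullHam : swapVars (fullHam ω k l c) = fullHam ω k l c := by
  refine eq_of_sub_mem_orderIdeal fun e => ?_
  have h1 := fullHam_sub_truncHam_mem ω c hs (ζ := c) (a := 1) (by simp) e
  have h2 := sub_mem (swapVars_mem h1) h1
  rw [swapVars_sub, swapVars_truncHam, sub_sub_sub_cancel_right] at h2
  exact orderIdeal_anti (hs.le_apply (x := e)) h2

theorem degree_diagExp_resExp (k q : ℕ) :
    (diagExp (resExp k q)).degree = 2 * (k - 1) + 2 * q := by
  simp [Finsupp.degree_eq_sum, Fin.sum_univ_two]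
  omega

include hs in
/-- The low order coefficients of the normal form of `H` are those of the normal form of a
truncation. -/
theorem coeff_expAd_fullHam {ω : Fin 2 → ℝ} (hω : ∀ m, divisor ω m = 0 → IsRes m)
    (hk : ∀ n, 3 ≤ k n) {ζ a : ℕ → ℝ} (hc : ∀ n, c n = ζ n * a n)
    {χ : MvPowerSeries (Coord 2) ℝ} (hχ : IsNormalizing (fullHam ω k l c) χ) {N : ℕ}
    {m : Coord 2 →₀ ℕ} (hm : m.degree < k N + l N) :
    ∃ χ', IsNormalizing (truncHam ω (fun j : Fin N => a j) (fun j => (k j, l j))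
        (fun j => ζ j)) χ' ∧
      coeff m (expAd χ (fullHam ω k l c)) = coeff m (expAd χ' (truncHam ω (fun j : Fin N => a j)
        (fun j => (k j, l j)) (fun j => ζ j))) := by
  obtain ⟨χ', hχ'⟩ := exists_isNormalizing hω (truncHam_sub_quad_mem ω (fun j : Fin N => a j)
    (τ := fun j => (k j, l j)) (fun j => hk j) (fun j => ζ j))
  refine ⟨χ', hχ', ?_⟩
  have he := fullHam_sub_truncHam_mem ω c hs hc N
  have hq := fullHam_sub_quad_mem ω c hs hk
  have h1 := expAd_sub_expAd_mem (mem_of_sub_quad_mem hq) hχ.mem hχ'.mem he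
    (hχ.sub_mem hω hq hχ' he) m hm
  rwa [map_sub, sub_eq_zero] at h1

include hs in
theorem hasTaylorSeriesAtZero_realHam {ω₁ ω₂ : ℝ} {ζ : ℕ → ℝ}
    (hζ : ∀ n, ζ n ∈ Set.Icc (0 : ℝ) 1) :
    HasTaylorSeriesAtZero (Ham ω₁ ω₂ k l ζ)
      (realHam ![ω₁, ω₂] k l fun n => ζ n * amp k l n) := by
  have h1 : HasTaylorSeriesAtZero
      (fun z => ∑' n, MvPolynomial.eval z (MvPolynomial.C (ζ n * amp k l n) *
        realPert (k n) (l n))) (lazySum fun n => C (ζ n * amp k l n) *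
          (realPert (k n) (l n) : MvPowerSeries (Coord 2) ℝ)) := by
    -- At radius `1/4` the majorant takes the value `2 (1/2)^(k_n+l_n)`, at most `2 (1/2)^n`; the
    -- bound `|ζ_n a_n| ≤ 1` then suffices.
    have hr : (0 : ℝ) < 1 / 4 := by norm_num
    have h2 := hasTaylorSeriesAtZero_tsum
      (p := fun n => MvPolynomial.C (ζ n * amp k l n) * realPert (k n) (l n))
      (M := fun n => pertMajorant (k n) (l n)) (s := fun n => k n + l n) ?_
      (fun n => hs.le_apply) ?_ hr ?_
    · have e : (lazySum fun n => C (ζ n * amp k l n) *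
          (realPert (k n) (l n) : MvPowerSeries (Coord 2) ℝ)) = fun m =>
          ∑ n ∈ Finset.range (m.degree + 1),
            (MvPolynomial.C (ζ n * amp k l n) * realPert (k n) (l n)).coeff m := by
        funext m
        refine Finset.sum_congr rfl fun n _ => ?_
        rw [MvPolynomial.coeff_C_mul, coeff_C_mul, MvPolynomial.coeff_coe]
      rw [e]
      exact h2
    · intro n m
      have h3 : |ζ n * amp k l n| ≤ 1 := by
        have h4 : amp k l n ≤ 1 := Real.exp_le_one_iff.mpr (neg_nonpos.mpr (by positivity))
        have h5 : 0 ≤ amp k l n := (Real.exp_pos _).le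
        rw [abs_of_nonneg (mul_nonneg (hζ n).1 h5)]
        exact mul_le_one₀ (hζ n).2 h5 h4
      rw [MvPolynomial.coeff_C_mul, abs_mul]
      exact (mul_le_of_le_one_left (abs_nonneg _) h3).trans (abs_coeff_realPert_le _ _ m)
    · intro n m hm
      have h3 := realPert_mem (k n) (l n) m hm
      rw [MvPolynomial.coeff_coe] at h3
      rw [MvPolynomial.coeff_C_mul, h3, mul_zero]
    · simp only [eval_pertMajorant]
      refine Summable.of_nonneg_of_le (fun n => by positivity) (fun n => ?_)
        ((summable_geometric_of_lt_one (r := (2 : ℝ) * (1 / 4)) (by norm_num)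
          (by norm_num)).mul_left 2)
      exact mul_le_mul_of_nonneg_left (pow_le_pow_of_le_one (by norm_num) (by norm_num)
        (hs.le_apply (x := n))) (by norm_num)
  have h2 : HasTaylorSeriesAtZero (fun z => MvPolynomial.eval z (basePoly ![ω₁, ω₂]))
      (basePoly ![ω₁, ω₂]) := Filter.Eventually.of_forall fun z => hasSum_coe _ z
  refine (congrArg (fun f => HasTaylorSeriesAtZero f _) ?_).mpr (h2.add h1)
  funext z
  have h3 : ∀ j, MvPolynomial.eval z (actPoly j) = action j z := fun j => by
    simp [actPoly, action]
    ring
  simp only [Ham, basePoly, Ftilde, map_add, map_mul, MvPolynomial.eval_C, h3, eval_realPert,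
    Matrix.cons_val_zero, Matrix.cons_val_one, mul_assoc]

end FullHamiltonian

/-! ### The lower bound for `γ_n` -/

section LowerBound

variable {ω₁ ω₂ θ ε : ℝ} {k l : ℕ → ℕ}

theorem IsAdmissible.exp_natCast_le (h : IsAdmissible ω₁ ω₂ ε k l) (n : ℕ) :
    Real.exp (Real.exp n) ≤ k n :=
  le_trans (by linarith [Real.exp_pos (Real.exp n)]) (h.large n)

theorem IsAdmissible.ten_le (h : IsAdmissible ω₁ ω₂ ε k l) (n : ℕ) : 10 ≤ k n := by
  have h1 := h.large n
  have h2 : (1 : ℝ) ≤ Real.exp (Real.exp n) := Real.one_le_exp (Real.exp_pos _).le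
  exact_mod_cast (by linarith : (10 : ℝ) ≤ k n)

theorem IsAdmissible.strictMono (h : IsAdmissible ω₁ ω₂ ε k l) (hε : 0 ≤ ε) :
    StrictMono fun n => k n + l n :=
  strictMono_nat_of_lt_succ fun n => by
    have h1 := h.sparse n
    have h2 := le_hatk hε l n
    omega

theorem natCast_le_exp_exp (n : ℕ) : (n : ℝ) ≤ Real.exp (Real.exp n) := by
  have h1 := Real.add_one_le_exp (n : ℝ)
  have h2 := Real.add_one_le_exp (Real.exp n)
  linarith

/-- Opposite signs give `ω₂ = -θ ω₁`, so a small divisor forces `k_n` to be close to `θ l_n`. -/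
theorem abs_add_mul_eq (hsign : ω₁ * ω₂ < 0) (hωθ : |ω₂| = θ * |ω₁|) (u v : ℝ) :
    |u * ω₁ + v * ω₂| = |u - θ * v| * |ω₁| := by
  have h : ω₂ = -θ * ω₁ := by
    rcases mul_neg_iff.mp hsign with ⟨h1, h2⟩ | ⟨h1, h2⟩
    · rw [abs_of_pos h1, abs_of_neg h2] at hωθ
      linarith
    · rw [abs_of_neg h1, abs_of_pos h2] at hωθ
      linarith
  rw [← abs_mul, h]
  congr 1
  ring

theorem exists_forall_exp_le_abs_gam
    (hnonres : ∀ u v : ℤ, (u : ℝ) * ω₁ + (v : ℝ) * ω₂ = 0 → u = 0 ∧ v = 0)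
    (hsign : ω₁ * ω₂ < 0) (hθ : 1 < θ) (hωθ : |ω₂| = θ * |ω₁|) (hε : 0 < ε) :
    ∃ N : ℕ, ∀ k l : ℕ → ℕ, IsAdmissible ω₁ ω₂ ε k l → ∀ n : ℕ, N ≤ n →
      Real.exp ((n : ℝ) * (k n : ℝ)) ≤ |gam ω₁ ω₂ ε k l n| := by
  have hω₁ : 0 < |ω₁| := abs_pos.mpr fun h0 => by simp [h0] at hsign
  -- The term `2/|ω₁|` gives `|K - θ L| ≤ K/2`; the term `14 θ/ε`, with `e^n ≥ n²/2`, gives `(ε/θ)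
  -- e^n ≥ 7 n`.
  refine ⟨⌈14 * (θ / ε) + 2 / |ω₁|⌉₊, fun k l h n hn => ?_⟩
  have hn' : 14 * (θ / ε) + 2 / |ω₁| ≤ n := Nat.ceil_le.mp hn
  have hθε : 0 < θ / ε := by positivity
  have h2ω : 0 < 2 / |ω₁| := by positivity
  have hk10 : (10 : ℝ) ≤ k n := by exact_mod_cast h.ten_le n
  have hkn : (n : ℝ) ≤ k n := (natCast_le_exp_exp n).trans (h.exp_natCast_le n)
  set K : ℝ := (k n : ℝ)
  set L : ℝ := (l n : ℝ) with hL
  have hL0 : 0 ≤ L := Nat.cast_nonneg _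
  set κ : ℝ := K * ω₁ + L * ω₂ with hκ
  have hκ0 : 0 < |κ| := abs_pos.mpr fun h0 => by
    have h1 := (hnonres (k n) (l n) (by push_cast; exact h0)).1
    have h2 := h.ten_le n
    omega
  have hκK : |κ| < 1 / K := h.small n
  have hsm : |K - θ * L| ≤ K / 2 := by
    have h1 : |K - θ * L| * |ω₁| < 1 / K := by
      rw [← abs_add_mul_eq hsign hωθ]
      exact hκK
    have h2 : 1 / K ≤ K / 2 * |ω₁| := by
      have h3 : 2 / |ω₁| ≤ K := by linarith
      rw [div_le_iff₀ hω₁] at h3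
      rw [div_le_iff₀ (by linarith)]
      nlinarith
    exact le_of_mul_le_mul_right (h1.le.trans h2) hω₁
  obtain ⟨hs1, hs2⟩ := abs_le.mp hsm
  have hL1 : L ≤ 2 * K := by nlinarith
  have hL2 : K / (2 * θ) ≤ L := by
    rw [div_le_iff₀ (by linarith)]
    linarith
  set d : ℕ := hatk ε l n - l n + 1 with hd
  -- The `+ 1` in the exponent makes up for the rounding in `k̂_n`.
  have hdL : ε * L ≤ d := by
    have h1 : (1 + ε) * L < hatk ε l n + 1 := Nat.lt_floor_add_one _
    have h2 := le_hatk hε.le l n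
    have h3 : (d : ℝ) = hatk ε l n - L + 1 := by rw [hd, hL]; push_cast [h2]; ring
    linarith
  have hlog : Real.exp n ≤ Real.log K := by
    rw [Real.le_log_iff_exp_le (by linarith)]
    exact h.exp_natCast_le n
  have hgam : |gam ω₁ ω₂ ε k l n| = amp k l n ^ 2 * K * (K / |κ|) ^ d := by
    rw [gam, abs_mul, abs_mul, abs_mul, abs_pow, abs_neg, abs_one, one_pow, one_mul, abs_pow,
      abs_pow, abs_div, Nat.abs_cast, amp, Real.abs_exp]
  have hbase : K ^ 2 ≤ K / |κ| := by
    rw [le_div_iff₀ hκ0]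
    rw [lt_div_iff₀ (by linarith)] at hκK
    nlinarith
  have hK0 : 0 < K := by linarith
  have hpow : Real.exp (d * (2 * Real.log K)) ≤ (K / |κ|) ^ d := by
    rw [Real.exp_nat_mul, two_mul, Real.exp_add, Real.exp_log hK0, ← pow_two]
    exact pow_le_pow_left₀ (by positivity) hbase d
  have hamp : amp k l n ^ 2 = Real.exp (-(2 * (n * (K + L)))) := by
    rw [amp, ← Real.exp_nat_mul]
    congr 1
    push_cast
    ring
  have hexp : (n : ℝ) * K ≤ -(2 * (n * (K + L))) + d * (2 * Real.log K) := by
    have h1 : ε * (K / (2 * θ)) * Real.exp n ≤ d * Real.log K :=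
      mul_le_mul ((mul_le_mul_of_nonneg_left hL2 hε.le).trans hdL) hlog (Real.exp_pos _).le
        (Nat.cast_nonneg _)
    have h2 : (n : ℝ) ^ 2 / 2 ≤ Real.exp n := by
      have := Real.quadratic_le_exp_of_nonneg (Nat.cast_nonneg n : (0 : ℝ) ≤ n)
      linarith [(Nat.cast_nonneg n : (0 : ℝ) ≤ n)]
    -- The 7 collects `n K` from the claim and `2 n (K + L) ≤ 6 n K` from the amplitude, as `L ≤ 2
    -- K`.
    have h3 : 7 * (n : ℝ) ≤ ε / θ * Real.exp n := by
      have h4 : 14 * θ ≤ n * ε := by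
        have h5 : 14 * (θ / ε) ≤ n := by linarith
        calc 14 * θ = 14 * (θ / ε) * ε := by field_simp
          _ ≤ n * ε := mul_le_mul_of_nonneg_right h5 hε.le
      rw [div_mul_eq_mul_div, le_div_iff₀ (by linarith)]
      have h6 : ε * ((n : ℝ) ^ 2 / 2) ≤ ε * Real.exp n := mul_le_mul_of_nonneg_left h2 hε.le
      nlinarith [mul_le_mul_of_nonneg_left h4 (Nat.cast_nonneg n : (0 : ℝ) ≤ n)]
    have h7 : 2 * (ε * (K / (2 * θ)) * Real.exp n) = K * (ε / θ * Real.exp n) := by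
      field_simp
    have h8 := mul_le_mul_of_nonneg_left h3 hK0.le
    have h9 := mul_le_mul_of_nonneg_left hL1 (Nat.cast_nonneg n : (0 : ℝ) ≤ n)
    linarith
  rw [hgam, hamp]
  calc Real.exp (n * K) ≤ Real.exp (-(2 * (n * (K + L)))) * Real.exp (d * (2 * Real.log K)) := by
        rw [← Real.exp_add]
        exact Real.exp_le_exp.mpr hexp
    _ ≤ Real.exp (-(2 * (n * (K + L)))) * K * (K / |κ|) ^ d :=
        mul_le_mul (le_mul_of_one_le_right (Real.exp_pos _).le (by linarith)) hpow
          (Real.exp_pos _).le (by positivity)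

end LowerBound

/-! ### Assembly of the normal form and its coefficients -/

section NormalForm

theorem isRes_of_divisor_eq_zero {ω₁ ω₂ : ℝ}
    (hnonres : ∀ u v : ℤ, (u : ℝ) * ω₁ + (v : ℝ) * ω₂ = 0 → u = 0 ∧ v = 0) (m : Coord 2 →₀ ℕ)
    (hm : divisor ![ω₁, ω₂] m = 0) : IsRes m := by
  have h1 := hnonres ((m (Sum.inl 0) : ℤ) - m (Sum.inr 0)) ((m (Sum.inl 1) : ℤ) - m (Sum.inr 1))
    (by
      rw [divisor, Fin.sum_univ_two] at hm
      simp only [Matrix.cons_val_zero, Matrix.cons_val_one] at hm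
      push_cast
      linarith)
  rw [IsRes, Fin.forall_fin_two]
  omega

/-- The coefficients of the normal form, as functions of the parameters. -/
theorem exists_polynomials {ω₁ ω₂ ε : ℝ}
    (hnonres : ∀ u v : ℤ, (u : ℝ) * ω₁ + (v : ℝ) * ω₂ = 0 → u = 0 ∧ v = 0) (hε : 0 ≤ ε) (n : ℕ)
    (τ : Fin (n + 1) → ℕ × ℕ) :
    ∃ P Q : MvPolynomial (Fin n) ℝ, ∀ k l : ℕ → ℕ, (∀ j, 3 ≤ k j) →
      (τ = fun j : Fin (n + 1) => (k j, l j)) → ∀ (ζ : ℕ → ℝ) (χ : MvPowerSeries (Coord 2) ℝ),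
      IsNormalizing (truncHam ![ω₁, ω₂] (fun j : Fin (n + 1) => amp k l j)
        (fun j => (k j, l j)) (fun j => ζ j)) χ →
      coeff (diagExp (resExp (k n) (hatk ε l n))) (expAd χ (truncHam ![ω₁, ω₂]
        (fun j : Fin (n + 1) => amp k l j) (fun j => (k j, l j)) (fun j => ζ j))) =
        ζ n ^ 2 * gam ω₁ ω₂ ε k l n + ζ n * MvPolynomial.eval (fun j : Fin n => ζ j) P +
          MvPolynomial.eval (fun j : Fin n => ζ j) Q := by
  -- The polynomials are to be functions of the finite data `τ` alone, so they are chosen for every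
  -- `τ`, with the value 0 where no sequence in question restricts to `τ`.
  by_cases hτ : ∀ j, 3 ≤ (τ j).1
  -- The amplitudes are rebuilt from `τ`, so that the polynomials do not see the rest of the
  -- sequence.
  · let a : Fin (n + 1) → ℝ := fun j =>
      Real.exp (-(((j : ℕ) : ℝ) * (((τ j).1 : ℝ) + ((τ j).2 : ℝ))))
    obtain ⟨P, Q, h⟩ := exists_coeff_expAd_truncHam (isRes_of_divisor_eq_zero hnonres) a hτ
      (k := (τ (Fin.last n)).1) (l := (τ (Fin.last n)).2) rfl
      (le_hatk hε (fun _ => (τ (Fin.last n)).2) 0)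
    refine ⟨P, Q, fun k l _ hkl ζ χ hχ => ?_⟩
    subst hkl
    exact h (fun j => ζ j) χ hχ
  · refine ⟨0, 0, fun k l hk hkl => absurd (fun j => ?_) hτ⟩
    rw [hkl]
    exact hk j

theorem exists_normalForm {ω₁ ω₂ ε : ℝ}
    (hnonres : ∀ u v : ℤ, (u : ℝ) * ω₁ + (v : ℝ) * ω₂ = 0 → u = 0 ∧ v = 0) (hε : 0 ≤ ε)
    {k l : ℕ → ℕ} (h : IsAdmissible ω₁ ω₂ ε k l) {ζ : ℕ → ℝ}
    (hζ : ∀ n, ζ n ∈ Set.Icc (0 : ℝ) 1) :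
    ∃ B : MvPowerSeries (Fin 2) ℝ, IsBNF (Ham ω₁ ω₂ k l ζ) B ∧
      (∀ B', IsBNF (Ham ω₁ ω₂ k l ζ) B' → B' = B) ∧
      ∀ n, ∃ χ, IsNormalizing (truncHam ![ω₁, ω₂] (fun j : Fin (n + 1) => amp k l j)
        (fun j => (k j, l j)) (fun j => ζ j)) χ ∧
        coeff (resExp (k n) (hatk ε l n)) B =
          coeff (diagExp (resExp (k n) (hatk ε l n))) (expAd χ (truncHam ![ω₁, ω₂]
            (fun j : Fin (n + 1) => amp k l j) (fun j => (k j, l j)) (fun j => ζ j))) := by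
  have hω := isRes_of_divisor_eq_zero hnonres
  have hk : ∀ n, 3 ≤ k n := fun n => by have := h.ten_le n; omega
  have hs := h.strictMono hε
  have hq := fullHam_sub_quad_mem ![ω₁, ω₂] (fun n => ζ n * amp k l n) hs hk
  have hT := toXiEta_realHam ![ω₁, ω₂] (fun n => ζ n * amp k l n) hs
  have hH := hasTaylorSeriesAtZero_realHam (ω₁ := ω₁) (ω₂ := ω₂) hs hζ
  obtain ⟨χ, hχ⟩ := exists_isNormalizing hω hq
  obtain ⟨B, hB⟩ := exists_eq_subst_act hχ.nonres
  refine ⟨B, ⟨_, hH, exists_formal_conjugation hω hT hq (swapVars_fullHam _ _ hs) hχ hB⟩, ?_,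
    fun n => ?_⟩
  · rintro B' ⟨h', hh', Φ, hΦ, hΦ', hB'⟩
    rw [hh'.unique hH] at hB'
    exact formal_normalForm_unique hω hT hq hχ hB hΦ hΦ' hB'
  -- Keeping the terms of index at most `n` suffices: the degree `2(k_n - 1) + 2 k̂_n` lies below
  -- `k_(n+1) + l_(n+1)` by sparsity.
  · obtain ⟨χ', hχ', he⟩ := coeff_expAd_fullHam (fun n => ζ n * amp k l n) hs hω hk
      (fun _ => rfl) hχ (N := n + 1) (m := diagExp (resExp (k n) (hatk ε l n)))
      (by rw [degree_diagExp_resExp]; have := h.sparse n; omega)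
    refine ⟨χ', hχ', ?_⟩
    rw [← he, hB, coeff_diagExp_subst_act]

end NormalForm

end BirkhoffNF
end

theorem mainTheorem7 (ω₁ ω₂ θ ε : ℝ)
    (hnonres : ∀ u v : ℤ, (u : ℝ) * ω₁ + (v : ℝ) * ω₂ = 0 → u = 0 ∧ v = 0)
    (hsign : ω₁ * ω₂ < 0) (hθ : 1 < θ) (hωθ : |ω₂| = θ * |ω₁|)
    (hε : 0 < ε) (hε' : ε < 1 / 100) (hεθ : 1 + 2 * ε < θ) :
    (∃ P Q : (n : ℕ) → (Fin (n + 1) → ℕ × ℕ) → MvPolynomial (Fin n) ℝ,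
      ∀ k l : ℕ → ℕ, BirkhoffNF.IsAdmissible ω₁ ω₂ ε k l →
      ∀ ζ : ℕ → ℝ, (∀ n, ζ n ∈ Set.Icc (0 : ℝ) 1) →
        ∃ B : MvPowerSeries (Fin 2) ℝ,
          BirkhoffNF.IsBNF (BirkhoffNF.Ham ω₁ ω₂ k l ζ) B ∧
          (∀ B' : MvPowerSeries (Fin 2) ℝ,
            BirkhoffNF.IsBNF (BirkhoffNF.Ham ω₁ ω₂ k l ζ) B' → B' = B) ∧
          ∀ n : ℕ,
            MvPowerSeries.coeff
                (Finsupp.single 0 (k n - 1) + Finsupp.single 1 (BirkhoffNF.hatk ε l n)) B =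
              ζ n ^ 2 * BirkhoffNF.gam ω₁ ω₂ ε k l n
                + ζ n * MvPolynomial.eval (fun j : Fin n => ζ j)
                    (P n (fun j : Fin (n + 1) => (k j, l j)))
                + MvPolynomial.eval (fun j : Fin n => ζ j)
                    (Q n (fun j : Fin (n + 1) => (k j, l j)))) ∧
    ∃ N : ℕ, ∀ k l : ℕ → ℕ, BirkhoffNF.IsAdmissible ω₁ ω₂ ε k l → ∀ n : ℕ, N ≤ n →
      Real.exp ((n : ℝ) * (k n : ℝ)) ≤ |BirkhoffNF.gam ω₁ ω₂ ε k l n| := by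
  refine ⟨?_, BirkhoffNF.exists_forall_exp_le_abs_gam hnonres hsign hθ hωθ hε⟩
  -- The choice precedes the sequences and `ζ`, so `P` and `Q` depend only on `n` and the initial
  -- segment of pairs.
  choose P Q hPQ using BirkhoffNF.exists_polynomials (ω₁ := ω₁) (ω₂ := ω₂) hnonres hε.le
  refine ⟨P, Q, fun k l h ζ hζ => ?_⟩
  obtain ⟨B, hB, huniq, hcoeff⟩ := BirkhoffNF.exists_normalForm hnonres hε.le h hζ
  refine ⟨B, hB, huniq, fun n => ?_⟩
  obtain ⟨χ, hχ, he⟩ := hcoeff n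
  rw [← hPQ n _ k l (fun j => by have := h.ten_le j; omega) rfl ζ χ hχ]
  exact he
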